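/- **Setting.** Let $I\ge 1$ agents cooperate to minimize $U(\mathbf x)=F(\mathbf x)+G^+(\mathbf x)-G^-(\mathbf x)$, $F=\sum_{i=1}^I f_i$, over $\mathcal K\subseteq\mathbb R^m$ (Euclidean norm throughout). Assume: * **(A)** $\mathcal K$ is nonempty, closed and convex; $\mathcal O\supseteq\mathcal K$ is open; each $f_i:\mathcal O\to\mathbb R$ is $C^1$ with $\nabla f_i$ $L_i$-Lipschitz on $\mathcal K$; $G^+:\mathcal K\to\mathbb R$ is convex and lower semicontinuous; $G^-:\mathcal O\to\mathbb R$ is $C^1$ with $\nabla G^-$ $L_G$-Lipschitz on $\mathcal K$; $U$ is bounded below on $\mathcal K$. * **(B)** The agents communicate over digraphs $\mathcal G^n=(\{1,\dots,I\},\mathcal E^n)$, $n\ge 0$, and for some integer $B>0$ the digraph with edge set $\bigcup_{t=k}^{k+B-1}\mathcal E^t$ is strongly connected for every $k\ge0$. * **(C)** The weights $\mathbf A^n=(a_{ij}^n)$ satisfy, for some $\kappa>0$ independent of $n$: $a_{ii}^n\ge\kappa$; $a_{ij}^n\ge\kappa$ if $(j,i)\in\mathcal E^n$; $a_{ij}^n=0$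 if $i\neq j$ and $(j,i)\notin\mathcal E^n$. * **(D)** Every $\mathbf A^n$ is column stochastic: $\mathbf 1^\top\mathbf A^n=\mathbf 1^\top$. * **(E)** The surrogates $\tilde f_i:\mathcal K\times\mathcal K\to\mathbb R$ are $C^1$ in the first argument, with partial gradient $\nabla\tilde f_i(\mathbf x;\mathbf y)$ in that argument, and $\nabla\tilde f_i(\mathbf x;\mathbf x)=\nabla f_i(\mathbf x)$ for $\mathbf x\in\mathcal K$; $\tilde f_i(\bullet;\mathbf y)$ is strongly convex on $\mathcal K$ with constant $\tau_i>0$, for every $\mathbf y\in\mathcal K$; $\nabla\tilde f_i(\mathbf x;\bullet)$ is $\tilde L_i$-Lipschitz on $\mathcal K$, for every $\mathbf x\in\mathcal K$. **SONATA.** Start from $\mathbf x_{(i)}^0\in\mathcal K$, $\phi_i^0=1$, $\mathbf y_{(i)}^0=\nabla f_i(\mathbf x^0_{(i)})$, and for $n\ge 0$ iterate $$\tilde{\mathbf x}_{(i)}^n=\operatorname*{argmin}_{\mathbf z\in\mathcal K}\ \tilde f_i(\mathbf z;\mathbf x_{(i)}^n)-\nabla G^-(\mathbf x_{(i)}^n)^\top(\mathbf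 z-\mathbf x_{(i)}^n)+\big(I\,\mathbf y_{(i)}^n-\nabla f_i(\mathbf x_{(i)}^n)\big)^\top(\mathbf z-\mathbf x_{(i)}^n)+G^+(\mathbf z),$$ $$\phi_i^{n+1}=\sum_j a_{ij}^n\phi_j^n,\qquad \mathbf x_{(i)}^{n+1}=\frac1{\phi_i^{n+1}}\sum_j a_{ij}^n\phi_j^n\big(\mathbf x_{(j)}^n+\alpha^n(\tilde{\mathbf x}_{(j)}^n-\mathbf x_{(j)}^n)\big),$$ $$\mathbf y_{(i)}^{n+1}=\frac1{\phi_i^{n+1}}\sum_j a_{ij}^n\phi_j^n\,\mathbf y_{(j)}^n+\frac1{\phi_i^{n+1}}\big(\nabla f_i(\mathbf x_{(i)}^{n+1})-\nabla f_i(\mathbf x_{(i)}^n)\big).$$ **(F) Step-size.** Put $L=\sum_iL_i$, $L_{\rm mx}=\max_iL_i$, $\tilde L_{\rm mx}=\max_i\tilde L_i+L_G$, $c_\tau=\min_i\tau_i$, $c_L=(L\sqrt I+L_{\rm mx}+\tilde L_{\rm mx})/I$. One of the following holds. * *(diminishing)* $\alpha^n\in(0,1]$ for all $n$, $\alpha^n\to0$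 and $\sum_n\alpha^n=\infty$; * *(constant)* $\alpha^n\equiv\alpha>0$ and, for some $\sigma\in(0,1)$, $$\alpha\le\min\Big\{\tfrac{(1-\rho_{\bar B})\sigma}{\sqrt2\,c\,\bar B},\ \tfrac{2c_\tau\phi_{lb}}{I\phi_{ub}}\Big(\tfrac{L+L_G}{I}+\tfrac{2c_L\bar Bc}{1-\rho_{\bar B}}\sqrt{\tfrac2{1-\sigma^2}}+\tfrac{12L_{\rm mx}\phi_{lb}^{-1}\bar B^2c^2}{(1-\rho_{\bar B})^2}\sqrt{\tfrac1{1-\sigma^2}}\Big)^{-1}\Big\}$$ (the second bound is void if the bracket vanishes), where either $I\ge2$, $c=I\sqrt{2I}$, $\phi_{lb}=\kappa^{2(I-1)B}$, $\phi_{ub}=I-\kappa^{2(I-1)B}$, $\tilde\kappa=\kappa^{2(I-1)B+1}/I$, $c_0=2(1+\tilde\kappa^{-(I-1)B})$, $\rho=1-\tilde\kappa^{(I-1)B}$, $\rho_{\bar B}=2c_0I\rho^{\lfloor\bar B/((I-1)B)\rfloor}$, and $\bar B$ is an integer with $\rho_{\bar B}<1$; or all $\mathbf A^n$ are doubly stochastic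 and $c=1$, $\bar B=B$, $\phi_{lb}=\phi_{ub}=1$, $\rho_{\bar B}=(1-\kappa/(2I^2))^{1/2}$. **Merit function.** With $\bar{\mathbf x}=\frac1I\sum_i\mathbf x_{(i)}$, let $$J(\bar{\mathbf x})=\Big\|\bar{\mathbf x}-\operatorname*{argmin}_{\mathbf z\in\mathcal K}\Big\{\big(\nabla F(\bar{\mathbf x})-\nabla G^-(\bar{\mathbf x})\big)^\top(\mathbf z-\bar{\mathbf x})+\tfrac12\|\mathbf z-\bar{\mathbf x}\|^2+G^+(\mathbf z)\Big\}\Big\|,\qquad D(\mathbf x)=\Big(\sum_i\|\mathbf x_{(i)}-\bar{\mathbf x}\|^2\Big)^{1/2},$$ and $M(\mathbf x)=\max\{J(\bar{\mathbf x})^2,D(\mathbf x)^2\}$. **Theorem (asymptotic convergence).** Under (A)–(F), the minimizer in the definition of $J$ exists and is unique at every point of $\mathcal K$, and every sequence $\mathbf x^n=(\mathbf x_{(i)}^n)_{i=1}^I$ generated by SONATA satisfies $\lim_{n\to\infty}M(\mathbf x^n)=0$. -/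

import Mathlib

open Filter Topology
open scoped NNReal BigOperators InnerProductSpace

namespace Sonata

noncomputable section

/-- The decision space `ℝᵐ` with its Euclidean norm. -/
abbrev Vec (m : ℕ) : Type := EuclideanSpace ℝ (Fin m)

/-- `z` is a minimizer of `h` over `K`. -/
def IsArgmin {m : ℕ} (K : Set (Vec m)) (h : Vec m → ℝ) (z : Vec m) : Prop :=
  z ∈ K ∧ ∀ w ∈ K, h z ≤ h w

/-! ### The optimization problem -/

/-- Standing assumptions on the problem of minimizing `∑ i, f i + Gp - Gm` over `K`.
`O` is an open set containing `K`, on which the smooth functions live. Lower semicontinuity of the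
convex part on `K` makes the minimizers appearing in the algorithm and in the stationarity measure
exist (it is automatic for a convex function that is finite on the whole space). -/
structure ProblemAssumptions {m I : ℕ} (K O : Set (Vec m)) (f : Fin I → Vec m → ℝ)
    (Gp Gm : Vec m → ℝ) (L : Fin I → ℝ≥0) (LG : ℝ≥0) : Prop where
  nonempty : K.Nonempty
  closed : IsClosed K
  convex : Convex ℝ K
  isOpen : IsOpen O
  subset : K ⊆ O
  f_C1 : ∀ i, ContDiffOn ℝ 1 (f i) O
  f_lip : ∀ i, LipschitzOnWith (L i) (gradient (f i)) K
  Gp_convex : ConvexOn ℝ K Gp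
  Gp_lsc : LowerSemicontinuousOn Gp K
  Gm_C1 : ContDiffOn ℝ 1 Gm O
  Gm_lip : LipschitzOnWith LG (gradient Gm) K
  bddBelow : BddBelow ((fun x => ∑ i, f i x + (Gp x - Gm x)) '' K)

/-! ### The network -/

/-- `(𝒢 t).Adj i j` means that there is a link directed from `i` to `j` at time `t`. The union of
the edge sets over every window of `B` consecutive times is strongly connected. -/
def BStronglyConnected {I : ℕ} (𝒢 : ℕ → Digraph (Fin I)) (B : ℕ) : Prop :=
  0 < B ∧ ∀ k : ℕ, ∀ i j : Fin I,
    Relation.ReflTransGen (fun a b => ∃ t, k ≤ t ∧ t < k + B ∧ (𝒢 t).Adj a b) i j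

/-- The weight matrices are compliant with the digraphs, with nonzero weights at least `κ`
(`A n i j` is the weight that `i` gives to the message of `j`). -/
structure Compliant {I : ℕ} (𝒢 : ℕ → Digraph (Fin I)) (A : ℕ → Matrix (Fin I) (Fin I) ℝ)
    (κ : ℝ) : Prop where
  pos : 0 < κ
  diag : ∀ n i, κ ≤ A n i i
  edge : ∀ n i j, (𝒢 n).Adj j i → κ ≤ A n i j
  nonedge : ∀ n i j, i ≠ j → ¬ (𝒢 n).Adj j i → A n i j = 0

/-- Every column sums to one. -/
def ColumnStochastic {I : ℕ} (A : ℕ → Matrix (Fin I) (Fin I) ℝ) : Prop :=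
  ∀ n j, ∑ i, A n i j = 1

/-- Every row sums to one. -/
def RowStochastic {I : ℕ} (A : ℕ → Matrix (Fin I) (Fin I) ℝ) : Prop :=
  ∀ n i, ∑ j, A n i j = 1

/-! ### Surrogate functions -/

/-- Assumptions on the surrogates `ft i : K × K → ℝ`. Here `dft i x y` is the gradient of
`ft i (·) y` at `x` relative to `K`; it depends continuously on `x`, so `ft i` is `C¹` in its first
argument. -/
structure SurrogateAssumptions {m I : ℕ} (K : Set (Vec m)) (f : Fin I → Vec m → ℝ)
    (ft : Fin I → Vec m → Vec m → ℝ) (dft : Fin I → Vec m → Vec m → Vec m)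
    (τ : Fin I → ℝ) (Lt : Fin I → ℝ≥0) : Prop where
  hasGradient : ∀ i, ∀ x ∈ K, ∀ y ∈ K,
    HasGradientWithinAt (fun w => ft i w y) (dft i x y) K x
  gradient_cont : ∀ i, ∀ y ∈ K, ContinuousOn (fun x => dft i x y) K
  consistent : ∀ i, ∀ x ∈ K, dft i x x = gradient (f i) x
  tau_pos : ∀ i, 0 < τ i
  strongConvex : ∀ i, ∀ y ∈ K, StrongConvexOn K (τ i) (fun x => ft i x y)
  lip : ∀ i, ∀ x ∈ K, LipschitzOnWith (Lt i) (fun y => dft i x y) K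

/-! ### The algorithm -/

/-- The objective of the local subproblem of agent `i` as a function of `z`, given the current
local copy `x` and the current tracking variable `y` of that agent. -/
def localObjective {m I : ℕ} (f : Fin I → Vec m → ℝ) (Gp Gm : Vec m → ℝ)
    (ft : Fin I → Vec m → Vec m → ℝ) (i : Fin I) (x y z : Vec m) : ℝ :=
  ft i z x - ⟪gradient Gm x, z - x⟫_ℝ
    + ⟪(I : ℝ) • y - gradient (f i) x, z - x⟫_ℝ + Gp z

/-- `(φ, x, xt, y)` is a sequence generated by SONATA: `x n i` is the local copy of agent `i` at
iteration `n`, `xt n i` the solution of its local subproblem, `y n i` its gradient-tracking variable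
and `φ n i` its push-sum weight. -/
structure IsRun {m I : ℕ} (K : Set (Vec m)) (f : Fin I → Vec m → ℝ) (Gp Gm : Vec m → ℝ)
    (ft : Fin I → Vec m → Vec m → ℝ) (A : ℕ → Matrix (Fin I) (Fin I) ℝ) (α : ℕ → ℝ)
    (φ : ℕ → Fin I → ℝ) (x xt y : ℕ → Fin I → Vec m) : Prop where
  x_init : ∀ i, x 0 i ∈ K
  phi_init : ∀ i, φ 0 i = 1
  y_init : ∀ i, y 0 i = gradient (f i) (x 0 i)
  local_opt : ∀ n i, IsArgmin K (localObjective f Gp Gm ft i (x n i) (y n i)) (xt n i)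
  phi_step : ∀ n i, φ (n + 1) i = ∑ j, A n i j * φ n j
  x_step : ∀ n i, x (n + 1) i =
    (φ (n + 1) i)⁻¹ • ∑ j, (A n i j * φ n j) • (x n j + α n • (xt n j - x n j))
  y_step : ∀ n i, y (n + 1) i =
    (φ (n + 1) i)⁻¹ • ∑ j, (A n i j * φ n j) • y n j
      + (φ (n + 1) i)⁻¹ • (gradient (f i) (x (n + 1) i) - gradient (f i) (x n i))

/-! ### Step-size rules -/

/-- `L = ∑ i, L i`. -/
def LSum {I : ℕ} (L : Fin I → ℝ≥0) : ℝ := ∑ i, (L i : ℝ)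

/-- The largest `L i`. -/
def LMax {I : ℕ} (L : Fin I → ℝ≥0) : ℝ := ⨆ i, (L i : ℝ)

/-- The largest `Lt i`, plus `LG`. -/
def LtMax {I : ℕ} (Lt : Fin I → ℝ≥0) (LG : ℝ≥0) : ℝ := (⨆ i, (Lt i : ℝ)) + LG

/-- The smallest `τ i`. -/
def cTau {I : ℕ} (τ : Fin I → ℝ) : ℝ := ⨅ i, τ i

def cL {I : ℕ} (L Lt : Fin I → ℝ≥0) (LG : ℝ≥0) : ℝ :=
  (LSum L * √(I : ℝ) + LMax L + LtMax Lt LG) / I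

/-- Lower bound on the push-sum weights. -/
def phiLb (I B : ℕ) (κ : ℝ) : ℝ := κ ^ (2 * (I - 1) * B)

/-- Upper bound on the push-sum weights. -/
def phiUb (I B : ℕ) (κ : ℝ) : ℝ := I - κ ^ (2 * (I - 1) * B)

def kappaTilde (I B : ℕ) (κ : ℝ) : ℝ := κ ^ (2 * (I - 1) * B + 1) / I

def c0 (I B : ℕ) (κ : ℝ) : ℝ := 2 * (1 + (kappaTilde I B κ ^ ((I - 1) * B))⁻¹)

def rho (I B : ℕ) (κ : ℝ) : ℝ := 1 - kappaTilde I B κ ^ ((I - 1) * B)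

/-- Contraction factor of the consensus error over `Bbar` iterations (the exponent is
`⌊Bbar / ((I - 1) B)⌋`). -/
def rhoBar (I B : ℕ) (κ : ℝ) (Bbar : ℕ) : ℝ :=
  2 * c0 I B κ * I * rho I B κ ^ (Bbar / ((I - 1) * B))

/-- The upper bound on a constant step-size `a`, for network constants `c`, `Bbar`, `φlb`, `φub`,
`ρ`, and a free parameter `σ ∈ (0, 1)`. The second bound `a ≤ (2 c_τ φlb / (I φub)) * (…)⁻¹` is
written without the inverse, so that it is no restriction if the bracket vanishes. -/
def StepBound {I : ℕ} (L Lt : Fin I → ℝ≥0) (LG : ℝ≥0) (τ : Fin I → ℝ)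
    (c : ℝ) (Bbar : ℕ) (φlb φub ρ σ a : ℝ) : Prop :=
  a ≤ (1 - ρ) * σ / (√2 * c * Bbar) ∧
  a * ((LSum L + LG) / I
      + 2 * cL L Lt LG * Bbar * c / (1 - ρ) * √(2 / (1 - σ ^ 2))
      + 12 * LMax L * φlb⁻¹ * Bbar ^ 2 * c ^ 2 / (1 - ρ) ^ 2 * √(1 / (1 - σ ^ 2)))
    ≤ 2 * cTau τ * φlb / (I * φub)

/-- Diminishing step-size: values in `(0, 1]`, tending to zero, with divergent sum. -/
def Diminishing (α : ℕ → ℝ) : Prop :=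
  (∀ n, 0 < α n ∧ α n ≤ 1) ∧ Tendsto α atTop (𝓝 0) ∧
    Tendsto (fun N => ∑ n ∈ Finset.range N, α n) atTop atTop

/-- Constant positive step-size below the explicit bound, either with the network constants for
general column-stochastic weights, or, if all the matrices are also row stochastic, with the
improved ones. The general constants involve a division by `I - 1`; for a single agent the matrices
are all equal to `1` and the second alternative applies. -/
def ConstantSmall {I : ℕ} (A : ℕ → Matrix (Fin I) (Fin I) ℝ) (B : ℕ) (κ : ℝ)
    (L Lt : Fin I → ℝ≥0) (LG : ℝ≥0) (τ : Fin I → ℝ) (α : ℕ → ℝ) : Prop :=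
  ∃ a : ℝ, 0 < a ∧ (∀ n, α n = a) ∧ ∃ σ : ℝ, 0 < σ ∧ σ < 1 ∧
    ((2 ≤ I ∧ ∃ Bbar : ℕ, rhoBar I B κ Bbar < 1 ∧
        StepBound L Lt LG τ (I * √(2 * I)) Bbar (phiLb I B κ) (phiUb I B κ)
          (rhoBar I B κ Bbar) σ a) ∨
      (RowStochastic A ∧
        StepBound L Lt LG τ 1 B 1 1 (√(1 - κ / (2 * (I : ℝ) ^ 2))) σ a))

/-! ### Merit function -/

/-- The strongly convex model of the objective at `x`, as a function of `z`. -/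
def proxModel {m I : ℕ} (f : Fin I → Vec m → ℝ) (Gp Gm : Vec m → ℝ) (x z : Vec m) : ℝ :=
  ⟪gradient (fun w => ∑ i, f i w) x - gradient Gm x, z - x⟫_ℝ + 1 / 2 * ‖z - x‖ ^ 2 + Gp z

/-- A minimizer of the model at `x` over `K`. -/
def proxPoint {m I : ℕ} (K : Set (Vec m)) (f : Fin I → Vec m → ℝ) (Gp Gm : Vec m → ℝ)
    (x : Vec m) : Vec m :=
  Classical.epsilon (IsArgmin K (proxModel f Gp Gm x))

/-- The stationarity measure. -/
def J {m I : ℕ} (K : Set (Vec m)) (f : Fin I → Vec m → ℝ) (Gp Gm : Vec m → ℝ) (x : Vec m) : ℝ :=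
  ‖x - proxPoint K f Gp Gm x‖

/-- The average of the local copies. -/
def avg {m I : ℕ} (x : Fin I → Vec m) : Vec m := (I : ℝ)⁻¹ • ∑ i, x i

/-- The consensus disagreement: the Euclidean norm of the stacked deviations from the average. -/
def D {m I : ℕ} (x : Fin I → Vec m) : ℝ := √(∑ i, ‖x i - avg x‖ ^ 2)

/-- The merit function. -/
def M {m I : ℕ} (K : Set (Vec m)) (f : Fin I → Vec m → ℝ) (Gp Gm : Vec m → ℝ)
    (x : Fin I → Vec m) : ℝ :=
  max (J K f Gp Gm (avg x) ^ 2) (D x ^ 2)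

end

end Sonata

/-!
The proof couples three recursions. Write `Δ` for the local steps `xt n i - x n i`, and average with
the push-sum weights `φ n i / I`.

*Descent.* The smooth part of the objective at the weighted average of the local copies, plus the
weighted average of the values of the convex part, is a Lyapunov function (`Run.lyapunov`). Strong
convexity of the surrogates makes it decrease by a multiple of `α * ‖Δ‖ ^ 2`, up to terms of order
`α ^ 2 * ‖Δ‖ ^ 2` and products of `α * ‖Δ‖` with the consensus error and the gradient-tracking error
(`Run.lyapunov_succ_le`).

*Consensus and tracking.* Rescaled by the push-sum weights, the mixing matrices are row stochastic,
and the deviation of their products from the projection on the weighted average contracts by a fixed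
factor over each block of steps. For column-stochastic weights this holds because, after sufficiently
many steps, all entries of the products are bounded below (`PushSum.stackNorm_deviation_le`); for
doubly stochastic weights it is a variance estimate in which each gap between consecutive sorted
values is charged to the first link across it (`sum_sq_prod_mulVec_le`). Hence both errors are
dominated by discrete convolutions of `α * ‖Δ‖` with summable kernels (`Mixing.disagreement_le`).

*Small gain.* By Young's inequality for convolutions, the error terms in the descent add up to at most
a constant multiple of `∑ (α * ‖Δ‖) ^ 2`, which small step-sizes make less than the decrease. As the
Lyapunov function is bounded below, `∑ α * ‖Δ‖ ^ 2` is finite (`summable_of_small_gain`). The explicit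
bound on a constant step-size implies the smallness that is needed (`StepBound.gain_lt`).

*From summability to limits.* The local solutions are Lipschitz functions of the data of the agents,
so `‖Δ‖` plus a suitable multiple of geometric majorants of the errors grows at most by factors
`1 + C * α`. Together with `∑ α = ∞` this forces convergence to zero (`tendsto_zero_of_growth`,
`tendsto_zero_of_summable`). Adding the variational inequalities of the proximal point and of a local
solution bounds the stationarity measure by `‖Δ‖` and the two errors (`Run.J_le`).
-/

namespace Sonata

/-! ### Euclidean norms of finite families -/

/-- The Euclidean norm of the real numbers `u i`, `i ∈ s`. -/
noncomputable def l2 {ι : Type*} (s : Finset ι) (u : ι → ℝ) : ℝ := √(∑ i ∈ s, u i ^ 2)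

section l2

variable {ι : Type*} {s : Finset ι} {u v : ι → ℝ}

lemma l2_nonneg : 0 ≤ l2 s u := Real.sqrt_nonneg _

lemma l2_sq : l2 s u ^ 2 = ∑ i ∈ s, u i ^ 2 :=
  Real.sq_sqrt (Finset.sum_nonneg fun _ _ => sq_nonneg _)

lemma l2_mono (hu : ∀ i ∈ s, 0 ≤ u i) (h : ∀ i ∈ s, u i ≤ v i) : l2 s u ≤ l2 s v :=
  Real.sqrt_le_sqrt (Finset.sum_le_sum fun i hi => pow_le_pow_left₀ (hu i hi) (h i hi) 2)

lemma sum_mul_le_l2 : ∑ i ∈ s, u i * v i ≤ l2 s u * l2 s v :=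
  Real.sum_mul_le_sqrt_mul_sqrt s u v

lemma l2_add_le : l2 s (fun i => u i + v i) ≤ l2 s u + l2 s v := by
  refine Real.sqrt_le_iff.2 ⟨add_nonneg l2_nonneg l2_nonneg, ?_⟩
  have h := sum_mul_le_l2 (s := s) (u := u) (v := v)
  have e : ∑ i ∈ s, (u i + v i) ^ 2
      = ∑ i ∈ s, u i ^ 2 + ∑ i ∈ s, v i ^ 2 + 2 * ∑ i ∈ s, u i * v i := by
    rw [Finset.mul_sum, ← Finset.sum_add_distrib, ← Finset.sum_add_distrib]
    exact Finset.sum_congr rfl fun i _ => by ring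
  rw [e, ← l2_sq, ← l2_sq]
  nlinarith

lemma l2_const_mul {c : ℝ} (hc : 0 ≤ c) : l2 s (fun i => c * u i) = c * l2 s u := by
  unfold l2
  simp_rw [mul_pow]
  rw [← Finset.mul_sum, Real.sqrt_mul (sq_nonneg c), Real.sqrt_sq hc]

lemma le_l2 {i : ι} (hi : i ∈ s) : u i ≤ l2 s u := by
  refine Real.le_sqrt_of_sq_le ?_
  exact Finset.single_le_sum (f := fun i => u i ^ 2) (fun _ _ => sq_nonneg _) hi

lemma l2_mono_set {t : Finset ι} (h : s ⊆ t) : l2 s u ≤ l2 t u :=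
  Real.sqrt_le_sqrt (Finset.sum_le_sum_of_subset_of_nonneg h fun _ _ _ => sq_nonneg _)

end l2

/-! ### Discrete convolutions -/

/-- Young's inequality for a summable kernel and a square-summable sequence, on finite windows. -/
lemma l2_convolution_le {h b : ℕ → ℝ} {X : ℝ} (hh : ∀ n, 0 ≤ h n) (N : ℕ)
    (hX : ∀ N, ∑ n ∈ Finset.range N, h n ≤ X) :
    l2 (Finset.range N) (fun n => ∑ t ∈ Finset.range (n + 1), h (n - t) * b t)
      ≤ X * l2 (Finset.range N) b := by
  have hX0 : 0 ≤ X := by simpa using hX 0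
  have key : ∀ n, (∑ t ∈ Finset.range (n + 1), h (n - t) * b t) ^ 2
      ≤ X * ∑ t ∈ Finset.range (n + 1), h (n - t) * b t ^ 2 := by
    intro n
    have h1 : ∑ t ∈ Finset.range (n + 1), h (n - t) ≤ X := by
      have := Finset.sum_range_reflect h (n + 1)
      simp only [Nat.add_sub_cancel] at this
      rw [this]
      exact hX _
    have h2 := Finset.sum_mul_sq_le_sq_mul_sq (Finset.range (n + 1))
      (fun t => √(h (n - t))) (fun t => √(h (n - t)) * b t)
    have e1 : ∀ t, √(h (n - t)) * (√(h (n - t)) * b t) = h (n - t) * b t := fun t => by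
      rw [← mul_assoc, Real.mul_self_sqrt (hh _)]
    have e2 : ∀ t, (√(h (n - t)) * b t) ^ 2 = h (n - t) * b t ^ 2 := fun t => by
      rw [mul_pow, Real.sq_sqrt (hh _)]
    simp only [e1, e2, Real.sq_sqrt (hh _)] at h2
    exact h2.trans (mul_le_mul_of_nonneg_right h1
      (Finset.sum_nonneg fun t _ => mul_nonneg (hh _) (sq_nonneg _)))
  refine Real.sqrt_le_iff.2 ⟨mul_nonneg hX0 l2_nonneg, ?_⟩
  calc ∑ n ∈ Finset.range N, (∑ t ∈ Finset.range (n + 1), h (n - t) * b t) ^ 2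
      ≤ ∑ n ∈ Finset.range N, X * ∑ t ∈ Finset.range (n + 1), h (n - t) * b t ^ 2 :=
        Finset.sum_le_sum fun n _ => key n
    _ = X * ∑ t ∈ Finset.range N, ∑ n ∈ Finset.Ico t N, h (n - t) * b t ^ 2 := by
        rw [← Finset.mul_sum]
        congr 1
        refine Finset.sum_comm' fun n t => ?_
        simp only [Finset.mem_range, Finset.mem_Ico]
        omega
    _ ≤ X * ∑ t ∈ Finset.range N, X * b t ^ 2 := by
        refine mul_le_mul_of_nonneg_left (Finset.sum_le_sum fun t _ => ?_) hX0
        rw [← Finset.sum_mul, Finset.sum_Ico_eq_sum_range]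
        simp only [Nat.add_sub_cancel_left]
        exact mul_le_mul_of_nonneg_right (hX _) (sq_nonneg _)
    _ = (X * l2 (Finset.range N) b) ^ 2 := by
        rw [← Finset.mul_sum, mul_pow, l2_sq]
        ring

/-- A sequence dominated by the response, through the kernel `h`, to an initial value `C` and to the
inputs `d`: its Euclidean norm is at most `X = ∑ h` times that of the data. -/
lemma l2_response_le {h u d : ℕ → ℝ} {X C : ℝ} (hh : ∀ n, 0 ≤ h n)
    (hX : ∀ N, ∑ n ∈ Finset.range N, h n ≤ X) (hu : ∀ n, 0 ≤ u n) (hC : 0 ≤ C)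
    (hud : ∀ n, u n ≤ h n * C + ∑ t ∈ Finset.range n, h (n - 1 - t) * d t) (N : ℕ) :
    l2 (Finset.range (N + 1)) u ≤ X * (C + l2 (Finset.range N) d) := by
  have hX0 : 0 ≤ X := by simpa using hX 0
  -- the initial value is treated as an additional input at the first step
  let b : ℕ → ℝ := fun n => Nat.casesOn n C d
  have h1 : l2 (Finset.range (N + 1)) u ≤
      l2 (Finset.range (N + 1)) (fun n => ∑ t ∈ Finset.range (n + 1), h (n - t) * b t) := by
    refine l2_mono (fun n _ => hu n) fun n _ => (hud n).trans (le_of_eq ?_)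
    rw [Finset.sum_range_succ', add_comm]
    refine congrArg₂ (· + ·) (Finset.sum_congr rfl fun t _ => ?_) rfl
    rw [Nat.sub_sub, Nat.add_comm 1 t]
  refine (h1.trans (l2_convolution_le hh _ hX)).trans (mul_le_mul_of_nonneg_left ?_ hX0)
  refine Real.sqrt_le_iff.2 ⟨add_nonneg hC l2_nonneg, ?_⟩
  rw [Finset.sum_range_succ']
  have : ∑ k ∈ Finset.range N, b (k + 1) ^ 2 = l2 (Finset.range N) d ^ 2 := l2_sq.symm
  rw [this]
  change _ + C ^ 2 ≤ _
  nlinarith [l2_nonneg (s := Finset.range N) (u := d)]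

/-- The solution of `u (n + 1) = r * u n + d n`, `u 0 = C`. -/
noncomputable def geomResponse (r C : ℝ) (d : ℕ → ℝ) : ℕ → ℝ
  | 0 => C
  | n + 1 => r * geomResponse r C d n + d n

lemma geomResponse_eq (r C : ℝ) (d : ℕ → ℝ) (n : ℕ) :
    geomResponse r C d n = r ^ n * C + ∑ t ∈ Finset.range n, r ^ (n - 1 - t) * d t := by
  induction n with
  | zero => simp [geomResponse]
  | succ n ih =>
    rw [geomResponse, ih, Finset.sum_range_succ, mul_add, Finset.mul_sum]
    simp only [Nat.add_sub_cancel, Nat.sub_self, pow_zero, one_mul]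
    rw [pow_succ', mul_assoc, ← add_assoc]
    congr 2
    refine Finset.sum_congr rfl fun t ht => ?_
    have : n - t = (n - 1 - t) + 1 := by
      have := Finset.mem_range.1 ht
      omega
    rw [this, pow_succ', mul_assoc]

lemma geomResponse_nonneg {r C : ℝ} {d : ℕ → ℝ} (hr : 0 ≤ r) (hC : 0 ≤ C) (hd : ∀ n, 0 ≤ d n)
    (n : ℕ) : 0 ≤ geomResponse r C d n := by
  induction n with
  | zero => exact hC
  | succ n ih => exact add_nonneg (mul_nonneg hr ih) (hd n)

lemma le_geomResponse {h u d d' : ℕ → ℝ} {r C G : ℝ} (hG : ∀ n, h n ≤ G * r ^ n)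
    (hr : 0 ≤ r) (hG0 : 0 ≤ G) (hC : 0 ≤ C) (hd : ∀ n, 0 ≤ d n) (hdd : ∀ n, d n ≤ d' n)
    (hud : ∀ n, u n ≤ h n * C + ∑ t ∈ Finset.range n, h (n - 1 - t) * d t) (n : ℕ) :
    u n ≤ G * geomResponse r C d' n := by
  refine (hud n).trans ?_
  rw [geomResponse_eq, mul_add, Finset.mul_sum, ← mul_assoc]
  refine add_le_add (mul_le_mul_of_nonneg_right (hG n) hC) (Finset.sum_le_sum fun t _ => ?_)
  rw [← mul_assoc]
  exact mul_le_mul (hG _) (hdd t) (hd t) (by positivity)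

lemma summable_sq_of_l2_bounded {u : ℕ → ℝ} {C : ℝ} (h : ∀ N, l2 (Finset.range N) u ≤ C) :
    Summable fun n => u n ^ 2 := by
  refine summable_of_sum_range_le (c := C ^ 2) (fun n => sq_nonneg _) fun N => ?_
  rw [← l2_sq]
  exact pow_le_pow_left₀ l2_nonneg (h N) 2

lemma l2_range_le_of_summable {u : ℕ → ℝ} (h : Summable fun n => u n ^ 2) (N : ℕ) :
    l2 (Finset.range N) u ≤ √(∑' n, u n ^ 2) :=
  Real.sqrt_le_sqrt (h.sum_le_tsum _ fun _ _ => sq_nonneg _)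

lemma geomResponse_summable_sq {r C : ℝ} {d : ℕ → ℝ} (hr : 0 ≤ r) (hr1 : r < 1) (hC : 0 ≤ C)
    (hd : ∀ n, 0 ≤ d n) (hs : Summable fun n => d n ^ 2) :
    Summable fun n => geomResponse r C d n ^ 2 := by
  have hX : ∀ N, ∑ n ∈ Finset.range N, r ^ n ≤ (1 - r)⁻¹ := fun N => by
    rw [← tsum_geometric_of_lt_one hr hr1]
    exact (summable_geometric_of_lt_one hr hr1).sum_le_tsum _ fun n _ => pow_nonneg hr n
  have h0 : 0 ≤ (1 - r)⁻¹ := inv_nonneg.2 (by linarith)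
  refine summable_sq_of_l2_bounded (C := (1 - r)⁻¹ * (C + √(∑' n, d n ^ 2))) fun N => ?_
  refine (l2_mono_set (t := Finset.range (N + 1)) (Finset.range_subset_range.2 N.le_succ)).trans ?_
  refine (l2_response_le (fun n => pow_nonneg hr n) hX (geomResponse_nonneg hr hC hd) hC
    (fun n => (geomResponse_eq r C d n).le) N).trans ?_
  exact mul_le_mul_of_nonneg_left (add_le_add_right (l2_range_le_of_summable hs N) C) h0

/-! ### Block-geometric kernels -/

lemma sum_block_geometric_le {ρ : ℝ} {b : ℕ} (hb : 0 < b) (h0 : 0 ≤ ρ) (h1 : ρ < 1) (N : ℕ) :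
    ∑ s ∈ Finset.range N, ρ ^ (s / b) ≤ b / (1 - ρ) := by
  have hn : ∀ s : ℕ, 0 ≤ ρ ^ (s / b) := fun s => pow_nonneg h0 _
  have hshift : ∑ s ∈ Finset.range (N + b), ρ ^ (s / b)
      = ρ * ∑ s ∈ Finset.range N, ρ ^ (s / b) + b := by
    rw [add_comm N b, Finset.sum_range_add, add_comm, Finset.mul_sum]
    congr 1
    · refine Finset.sum_congr rfl fun s _ => ?_
      rw [Nat.add_div_left s hb, pow_succ']
    · rw [Finset.sum_congr rfl fun s hs => by
        rw [Nat.div_eq_of_lt (Finset.mem_range.1 hs), pow_zero]]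
      simp
  have hle : ∑ s ∈ Finset.range N, ρ ^ (s / b) ≤ ∑ s ∈ Finset.range (N + b), ρ ^ (s / b) :=
    Finset.sum_le_sum_of_subset_of_nonneg (Finset.range_subset_range.2 (Nat.le_add_right _ _))
      fun s _ _ => hn s
  rw [le_div_iff₀ (by linarith)]
  nlinarith

lemma exists_geometric_bound {ρ : ℝ} {b : ℕ} (hb : 0 < b) (h0 : 0 ≤ ρ) (h1 : ρ < 1) :
    ∃ r G : ℝ, 0 < r ∧ r < 1 ∧ 0 ≤ G ∧ ∀ s : ℕ, ρ ^ (s / b) ≤ G * r ^ s := by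
  have hb' : (1 : ℝ) ≤ b := by exact_mod_cast hb
  have hb0 : (0 : ℝ) < 2 * b := by linarith
  have hq : (1 - ρ) / (2 * b) < 1 := by
    rw [div_lt_one hb0]
    linarith
  have hq0 : 0 < (1 - ρ) / (2 * b) := div_pos (by linarith) hb0
  -- Bernoulli's inequality gives `ρ ≤ r ^ b`
  obtain ⟨r, hr⟩ : ∃ r, r = 1 - (1 - ρ) / (2 * b) := ⟨_, rfl⟩
  have hr0 : 0 < r := by linarith
  have hr1 : r < 1 := by linarith
  have hber : ρ ≤ r ^ b := by
    have h := one_add_mul_le_pow (a := -((1 - ρ) / (2 * b))) (by linarith) b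
    have e : (b : ℝ) * -((1 - ρ) / (2 * b)) = -((1 - ρ) / 2) := by
      have : (b : ℝ) ≠ 0 := by linarith
      field_simp
    rw [e, ← sub_eq_add_neg 1 ((1 - ρ) / (2 * b)), ← hr] at h
    linarith
  refine ⟨r, (r ^ b)⁻¹, hr0, hr1, by positivity, fun s => ?_⟩
  rw [inv_mul_eq_div, le_div_iff₀ (by positivity)]
  calc ρ ^ (s / b) * r ^ b ≤ (r ^ b) ^ (s / b) * r ^ b :=
        mul_le_mul_of_nonneg_right (pow_le_pow_left₀ h0 hber _) (by positivity)
    _ = r ^ (b * (s / b) + b) := by rw [← pow_mul, ← pow_add]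
    _ ≤ r ^ s := by
        refine pow_le_pow_of_le_one hr0.le hr1.le ?_
        have h2 := Nat.div_add_mod s b
        have h3 := Nat.mod_lt s hb
        omega

/-! ### Quasi-monotone sequences -/

lemma exists_tendsto_of_quasi_antitone {q g : ℕ → ℝ} (hq : ∀ n, 0 ≤ q n) (hg : ∀ n, 0 ≤ g n)
    (hs : Summable g) (h : ∀ n, q (n + 1) ≤ q n + g n) : ∃ l, 0 ≤ l ∧ Tendsto q atTop (𝓝 l) := by
  have hanti : Antitone fun n => q n - ∑ t ∈ Finset.range n, g t := by
    refine antitone_nat_of_succ_le fun n => ?_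
    rw [Finset.sum_range_succ]
    linarith [h n]
  have hbdd : BddBelow (Set.range fun n => q n - ∑ t ∈ Finset.range n, g t) := by
    refine ⟨-∑' t, g t, ?_⟩
    rintro _ ⟨n, rfl⟩
    have := hs.sum_le_tsum (Finset.range n) fun t _ => hg t
    simp only
    linarith [hq n]
  have ht := (tendsto_atTop_ciInf hanti hbdd).add hs.hasSum.tendsto_sum_nat
  simp only [sub_add_cancel] at ht
  exact ⟨_, ge_of_tendsto' ht hq, ht⟩

/-- A sequence that grows at most by the factors `1 + C * α n` and is square-summable with respect
to weights `α` of infinite total mass tends to zero. -/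
lemma tendsto_zero_of_growth {Q α : ℕ → ℝ} {C : ℝ} (hC : 0 ≤ C) (hQ : ∀ n, 0 ≤ Q n)
    (hα : ∀ n, 0 < α n ∧ α n ≤ 1) (hdiv : ¬ Summable α)
    (hgrow : ∀ n, Q (n + 1) ≤ Q n + C * α n * Q n) (hsum : Summable fun n => α n * Q n ^ 2) :
    Tendsto Q atTop (𝓝 0) := by
  have hstep : ∀ n, Q (n + 1) ^ 2 ≤ Q n ^ 2 + (2 * C + C ^ 2) * (α n * Q n ^ 2) := fun n => by
    have h1 := pow_le_pow_left₀ (hQ (n + 1)) (hgrow n) 2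
    have h2 : α n ^ 2 ≤ α n := by nlinarith [hα n]
    have h3 := mul_le_mul_of_nonneg_left h2 (mul_nonneg (sq_nonneg C) (sq_nonneg (Q n)))
    nlinarith
  obtain ⟨l, hl0, hl⟩ := exists_tendsto_of_quasi_antitone (fun n => sq_nonneg (Q n))
    (fun n => mul_nonneg (by positivity) (mul_nonneg (hα n).1.le (sq_nonneg _)))
    (hsum.mul_left (2 * C + C ^ 2)) hstep
  have hl' : l = 0 := by
    by_contra hne
    have hlp : 0 < l := lt_of_le_of_ne hl0 (Ne.symm hne)
    have hev : ∀ᶠ n in atTop, l / 2 < Q n ^ 2 := hl.eventually_const_lt (by linarith)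
    refine hdiv ?_
    have h2 : Summable fun n => 2 / l * (α n * Q n ^ 2) := hsum.mul_left _
    refine Summable.of_norm_bounded_eventually_nat h2 ?_
    filter_upwards [hev] with n hn
    rw [Real.norm_of_nonneg (hα n).1.le, div_mul_eq_mul_div, le_div_iff₀ hlp]
    nlinarith [hα n]
  rw [hl'] at hl
  have := (Real.continuous_sqrt.tendsto 0).comp hl
  simpa [Function.comp_def, Real.sqrt_sq (hQ _)] using this

/-! ### The interconnection of descent, consensus and tracking -/

/-- Small-gain argument. The steps `a n = α n * δ n` drive the consensus error `ex` through the
kernel `h`; both drive the tracking error `ey`; and the errors perturb the descent of `V`. In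
Euclidean norm the perturbation is at most a multiple of `∑ (α n * δ n) ^ 2`, which the descent
absorbs when the step-sizes are small. -/
lemma summable_of_small_gain {α δ ex ey V h : ℕ → ℝ} {X C₀ C₁ Ly s A Bq P c lb ε : ℝ}
    (hα : ∀ n, 0 < α n ∧ α n ≤ 1) (hδ : ∀ n, 0 ≤ δ n) (hex : ∀ n, 0 ≤ ex n) (hey : ∀ n, 0 ≤ ey n)
    (hh : ∀ n, 0 ≤ h n) (hX : ∀ N, ∑ n ∈ Finset.range N, h n ≤ X)
    (hC₀ : 0 ≤ C₀) (hC₁ : 0 ≤ C₁) (hLy : 0 ≤ Ly) (hs : 0 ≤ s) (hBq : 0 ≤ Bq) (hP : 0 ≤ P)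
    (hc : 0 ≤ c)
    (hx : ∀ n, ex n ≤ h n * C₀ + ∑ t ∈ Finset.range n, h (n - 1 - t) * (α t * δ t))
    (hy : ∀ n, ey n ≤ h n * C₁ + ∑ t ∈ Finset.range n,
      h (n - 1 - t) * (Ly * (ex (t + 1) + ex t + s * (α t * δ t))))
    (hV : ∀ n, V (n + 1) ≤ V n - A * (α n * δ n ^ 2) + Bq * (α n * δ n) ^ 2
      + P * ((c * ex n + ey n) * (α n * δ n)))
    (hlb : ∀ n, lb ≤ V n) (hε : 0 < ε)
    (hsmall : ∀ᶠ n in atTop, α n * (Bq + P * (c * X + Ly * X * (2 * X + s))) ≤ A - ε) :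
    Summable fun n => α n * δ n ^ 2 := by
  have hX0 : 0 ≤ X := by simpa using hX 0
  obtain ⟨a, ha⟩ : ∃ a : ℕ → ℝ, a = fun n => α n * δ n := ⟨_, rfl⟩
  have ha' : ∀ n, α n * δ n = a n := fun n => by rw [ha]
  have ha0 : ∀ n, 0 ≤ a n := fun n => by rw [← ha']; exact mul_nonneg (hα n).1.le (hδ n)
  simp only [ha'] at hx hy hV
  obtain ⟨K, hK⟩ : ∃ K, K = Bq + P * (c * X + Ly * X * (2 * X + s)) := ⟨_, rfl⟩
  rw [← hK] at hsmall
  have hK0 : 0 ≤ K := by rw [hK]; positivity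
  obtain ⟨n₀, hn₀⟩ := eventually_atTop.1 hsmall
  obtain ⟨S, hS⟩ : ∃ S : ℕ → ℝ, S = fun N => l2 (Finset.range N) a := ⟨_, rfl⟩
  have hS0 : ∀ N, 0 ≤ S N := fun N => by rw [hS]; exact l2_nonneg
  have hxN : ∀ N, l2 (Finset.range N) ex ≤ X * (C₀ + S N) := fun N => by
    rw [hS]
    exact (l2_mono_set (Finset.range_subset_range.2 N.le_succ)).trans
      (l2_response_le hh hX hex hC₀ hx N)
  have hxN' : ∀ N, l2 (Finset.range N) (fun n => ex (n + 1)) ≤ X * (C₀ + S N) := fun N => by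
    rw [hS]
    refine le_trans (Real.sqrt_le_sqrt ?_) (l2_response_le hh hX hex hC₀ hx N)
    rw [Finset.sum_range_succ' (fun n => ex n ^ 2)]
    exact le_add_of_nonneg_right (sq_nonneg _)
  have hdy : ∀ N, l2 (Finset.range N) (fun t => Ly * (ex (t + 1) + ex t + s * a t))
      ≤ Ly * (2 * (X * (C₀ + S N)) + s * S N) := fun N => by
    rw [l2_const_mul hLy]
    refine mul_le_mul_of_nonneg_left ?_ hLy
    refine l2_add_le.trans ?_
    rw [l2_const_mul hs, two_mul]
    have : l2 (Finset.range N) a = S N := by rw [hS]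
    rw [this]
    exact add_le_add_left (l2_add_le.trans (add_le_add (hxN' N) (hxN N))) _
  have hyN : ∀ N, l2 (Finset.range N) ey
      ≤ X * (C₁ + Ly * (2 * (X * (C₀ + S N)) + s * S N)) := fun N => by
    refine (l2_mono_set (Finset.range_subset_range.2 N.le_succ)).trans
      ((l2_response_le hh hX hey hC₁ hy N).trans ?_)
    exact mul_le_mul_of_nonneg_left (add_le_add_right (hdy N) _) hX0
  have hVN : ∀ N, V N ≤ V 0 - A * ∑ n ∈ Finset.range N, α n * δ n ^ 2
      + Bq * ∑ n ∈ Finset.range N, a n ^ 2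
      + P * ∑ n ∈ Finset.range N, (c * ex n + ey n) * a n := fun N => by
    induction N with
    | zero => simp
    | succ N ih =>
      simp only [Finset.sum_range_succ]
      linarith [hV N]
  obtain ⟨K₀, hK₀⟩ : ∃ K₀, K₀ = P * (c * X * C₀ + X * (C₁ + Ly * (2 * (X * C₀)))) := ⟨_, rfl⟩
  have hK₀0 : 0 ≤ K₀ := by rw [hK₀]; positivity
  have hcross : ∀ N, Bq * ∑ n ∈ Finset.range N, a n ^ 2
      + P * ∑ n ∈ Finset.range N, (c * ex n + ey n) * a n ≤ K * S N ^ 2 + K₀ * S N := fun N => by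
    have h1 : ∑ n ∈ Finset.range N, (c * ex n + ey n) * a n
        ≤ (c * (X * (C₀ + S N)) + X * (C₁ + Ly * (2 * (X * (C₀ + S N)) + s * S N))) * S N := by
      refine (sum_mul_le_l2 (u := fun n => c * ex n + ey n) (v := a)).trans ?_
      have : l2 (Finset.range N) a = S N := by rw [hS]
      rw [this]
      refine mul_le_mul_of_nonneg_right (l2_add_le.trans (add_le_add ?_ (hyN N))) (hS0 N)
      rw [l2_const_mul hc]
      exact mul_le_mul_of_nonneg_left (hxN N) hc
    have h2 := mul_le_mul_of_nonneg_left h1 hP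
    have h3 : ∑ n ∈ Finset.range N, a n ^ 2 = S N ^ 2 := by rw [hS]; exact l2_sq.symm
    rw [h3]
    refine (add_le_add_right h2 _).trans (le_of_eq ?_)
    rw [hK, hK₀]
    ring
  -- the quadratic perturbation is dominated by the descent, up to finitely many terms
  obtain ⟨C₂, hC₂⟩ : ∃ C₂, C₂ = ∑ n ∈ Finset.range n₀, K * a n ^ 2 + |A - ε| *
    ∑ n ∈ Finset.range n₀, α n * δ n ^ 2 := ⟨_, rfl⟩
  have hterm : ∀ n, 0 ≤ α n * δ n ^ 2 := fun n => mul_nonneg (hα n).1.le (sq_nonneg _)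
  have hquad : ∀ N, K * S N ^ 2 ≤ C₂ + (A - ε) * ∑ n ∈ Finset.range N, α n * δ n ^ 2 := by
    intro N
    have h1 : K * S N ^ 2 = ∑ n ∈ Finset.range N, K * a n ^ 2 := by
      rw [hS, l2_sq, Finset.mul_sum]
    have h2 : ∑ n ∈ Finset.range N, (K * a n ^ 2 - (A - ε) * (α n * δ n ^ 2))
        ≤ ∑ n ∈ Finset.range n₀, (K * a n ^ 2 + |A - ε| * (α n * δ n ^ 2)) := by
      have h3 : ∑ n ∈ Finset.range N, (K * a n ^ 2 - (A - ε) * (α n * δ n ^ 2))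
          ≤ ∑ n ∈ Finset.range N,
            if n < n₀ then (K * a n ^ 2 + |A - ε| * (α n * δ n ^ 2)) else 0 := by
        refine Finset.sum_le_sum fun n _ => ?_
        split_ifs with hn
        · nlinarith [neg_abs_le (A - ε), hterm n]
        · have h4 := hn₀ n (not_lt.1 hn)
          have h5 := mul_le_mul_of_nonneg_right h4 (hterm n)
          rw [← ha']
          nlinarith
      refine h3.trans ?_
      rw [← Finset.sum_filter]
      refine Finset.sum_le_sum_of_subset_of_nonneg ?_ fun n _ _ => ?_
      · intro n hn
        exact Finset.mem_range.2 (Finset.mem_filter.1 hn).2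
      · have := hterm n
        positivity
    rw [Finset.sum_sub_distrib, Finset.sum_add_distrib, ← Finset.mul_sum (a := A - ε),
      ← Finset.mul_sum (a := |A - ε|)] at h2
    rw [h1, hC₂]
    linarith
  have hST : ∀ N, S N ^ 2 ≤ ∑ n ∈ Finset.range N, α n * δ n ^ 2 := fun N => by
    rw [hS, l2_sq]
    refine Finset.sum_le_sum fun n _ => ?_
    rw [← ha', mul_pow]
    exact mul_le_mul_of_nonneg_right (by nlinarith [hα n]) (sq_nonneg _)
  refine summable_of_sum_range_le (c := 2 / ε * (V 0 - lb + C₂ + K₀ ^ 2 / (2 * ε))) hterm fun N => ?_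
  have h1 := hVN N
  have h2 := hcross N
  have h3 := hquad N
  have h4 := hST N
  have h5 := hlb N
  have h6 : K₀ * S N ≤ ε / 2 * S N ^ 2 + K₀ ^ 2 / (2 * ε) := by
    have h7 : 0 ≤ (ε * S N - K₀) ^ 2 / (2 * ε) := by positivity
    have h8 : (ε * S N - K₀) ^ 2 / (2 * ε) = ε / 2 * S N ^ 2 + K₀ ^ 2 / (2 * ε) - K₀ * S N := by
      field_simp
      ring
    linarith
  have h9 : ε / 2 * ∑ n ∈ Finset.range N, α n * δ n ^ 2
      ≤ V 0 - lb + C₂ + K₀ ^ 2 / (2 * ε) := by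
    have := mul_le_mul_of_nonneg_left h4 (half_pos hε).le
    linarith
  rw [div_mul_eq_mul_div, le_div_iff₀ hε]
  linarith

/-- Once `α n * δ n ^ 2` is summable, the errors and the steps tend to zero: a positive combination
of `δ` and of geometric majorants of `ex` and `ey` grows at most by the factors `1 + C * α n`. -/
lemma tendsto_zero_of_summable {α δ ex ey h : ℕ → ℝ} {r G C₀ C₁ Ly s C : ℝ}
    (hα : ∀ n, 0 < α n ∧ α n ≤ 1) (hdiv : ¬ Summable α)
    (hδ : ∀ n, 0 ≤ δ n) (hex : ∀ n, 0 ≤ ex n) (hey : ∀ n, 0 ≤ ey n)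
    (hr : 0 < r) (hr1 : r < 1) (hG : 0 ≤ G) (hhG : ∀ n, h n ≤ G * r ^ n)
    (hC₀ : 0 ≤ C₀) (hC₁ : 0 ≤ C₁) (hLy : 0 ≤ Ly) (hs : 0 ≤ s) (hC : 0 ≤ C)
    (hx : ∀ n, ex n ≤ h n * C₀ + ∑ t ∈ Finset.range n, h (n - 1 - t) * (α t * δ t))
    (hy : ∀ n, ey n ≤ h n * C₁ + ∑ t ∈ Finset.range n,
      h (n - 1 - t) * (Ly * (ex (t + 1) + ex t + s * (α t * δ t))))
    (hstep : ∀ n, δ (n + 1) ≤ δ n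
      + C * (ex n + ex (n + 1) + ey n + ey (n + 1) + α n * δ n))
    (hsum : Summable fun n => α n * δ n ^ 2) :
    Tendsto δ atTop (𝓝 0) ∧ Tendsto ex atTop (𝓝 0) ∧ Tendsto ey atTop (𝓝 0) := by
  obtain ⟨a, ha⟩ : ∃ a : ℕ → ℝ, a = fun n => α n * δ n := ⟨_, rfl⟩
  have ha' : ∀ n, α n * δ n = a n := fun n => by rw [ha]
  have ha0 : ∀ n, 0 ≤ a n := fun n => by rw [← ha']; exact mul_nonneg (hα n).1.le (hδ n)
  simp only [ha'] at hx hy hstep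
  have hasum : Summable fun n => a n ^ 2 := by
    refine Summable.of_nonneg_of_le (fun n => sq_nonneg _) (fun n => ?_) hsum
    rw [← ha', mul_pow]
    exact mul_le_mul_of_nonneg_right (by nlinarith [hα n]) (sq_nonneg _)
  obtain ⟨bx, hbx⟩ : ∃ bx, bx = geomResponse r C₀ a := ⟨_, rfl⟩
  have hbx0 : ∀ n, 0 ≤ bx n := by rw [hbx]; exact geomResponse_nonneg hr.le hC₀ ha0
  have hbxs : ∀ n, bx (n + 1) = r * bx n + a n := fun n => by rw [hbx]; rfl
  have hxb : ∀ n, ex n ≤ G * bx n := by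
    rw [hbx]
    exact le_geomResponse hhG hr.le hG hC₀ ha0 (fun _ => le_rfl) hx
  have hbxsum : Summable fun n => bx n ^ 2 := by
    rw [hbx]
    exact geomResponse_summable_sq hr.le hr1 hC₀ ha0 hasum
  obtain ⟨d, hd⟩ : ∃ d : ℕ → ℝ, d = fun n => Ly * (2 * G * bx n + (G + s) * a n) := ⟨_, rfl⟩
  have hd0 : ∀ n, 0 ≤ d n := fun n => by
    rw [hd]
    have := ha0 n
    have := hbx0 n
    positivity
  have hxx : ∀ n, ex (n + 1) ≤ G * bx n + G * a n := fun n => by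
    refine (hxb (n + 1)).trans ?_
    rw [hbxs, ← mul_add]
    refine mul_le_mul_of_nonneg_left ?_ hG
    nlinarith [hbx0 n]
  have hdd : ∀ n, Ly * (ex (n + 1) + ex n + s * a n) ≤ d n := fun n => by
    rw [hd]
    refine mul_le_mul_of_nonneg_left ?_ hLy
    linarith [hxx n, hxb n]
  have hdsum : Summable fun n => d n ^ 2 := by
    refine Summable.of_nonneg_of_le (fun n => sq_nonneg _) (fun n => ?_)
      ((hbxsum.mul_left (2 * (Ly * (2 * G)) ^ 2)).add
        (hasum.mul_left (2 * (Ly * (G + s)) ^ 2)))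
    rw [hd]
    nlinarith [sq_nonneg (Ly * (2 * G) * bx n - Ly * (G + s) * a n)]
  obtain ⟨bY, hbY⟩ : ∃ bY, bY = geomResponse r C₁ d := ⟨_, rfl⟩
  have hby0 : ∀ n, 0 ≤ bY n := by rw [hbY]; exact geomResponse_nonneg hr.le hC₁ hd0
  have hbys : ∀ n, bY (n + 1) = r * bY n + d n := fun n => by rw [hbY]; rfl
  have hyb : ∀ n, ey n ≤ G * bY n := by
    rw [hbY]
    refine le_geomResponse hhG hr.le hG hC₁ (fun n => ?_) hdd hy
    have := hex n
    have := hex (n + 1)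
    have := ha0 n
    positivity
  have hbysum : Summable fun n => bY n ^ 2 := by
    rw [hbY]
    exact geomResponse_summable_sq hr.le hr1 hC₁ hd0 hdsum
  have hyy : ∀ n, ey (n + 1) ≤ G * bY n + G * d n := fun n => by
    refine (hyb (n + 1)).trans ?_
    rw [hbys, ← mul_add]
    refine mul_le_mul_of_nonneg_left ?_ hG
    nlinarith [hby0 n]
  have h1r : 0 < 1 - r := by linarith
  -- the weights solve the triangular system that makes the errors absorb their own growth
  obtain ⟨M₂, hM₂⟩ : ∃ M₂, M₂ = C * (2 * G) / (1 - r) := ⟨_, rfl⟩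
  have hM₂0 : 0 ≤ M₂ := by rw [hM₂]; positivity
  have hM₂e : C * (2 * G) + M₂ * r = M₂ := by
    rw [hM₂]
    field_simp
    ring
  obtain ⟨M₁, hM₁⟩ : ∃ M₁, M₁ = (C * (2 * G + G * (Ly * (2 * G))) + M₂ * (Ly * (2 * G))) / (1 - r) :=
    ⟨_, rfl⟩
  have hM₁0 : 0 ≤ M₁ := by rw [hM₁]; positivity
  have hM₁e : C * (2 * G + G * (Ly * (2 * G))) + M₂ * (Ly * (2 * G)) + M₁ * r = M₁ := by
    rw [hM₁]
    field_simp
    ring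
  obtain ⟨S, hS⟩ : ∃ S, S = C * (G + G * (Ly * (G + s)) + 1) + M₁ + M₂ * (Ly * (G + s)) := ⟨_, rfl⟩
  have hS0 : 0 ≤ S := by rw [hS]; positivity
  obtain ⟨Q, hQ⟩ : ∃ Q : ℕ → ℝ, Q = fun n => δ n + M₁ * bx n + M₂ * bY n := ⟨_, rfl⟩
  have hQn : ∀ n, Q n = δ n + M₁ * bx n + M₂ * bY n := fun n => by rw [hQ]
  have hQ0 : ∀ n, 0 ≤ Q n := fun n => by
    have := hδ n
    have := hbx0 n
    have := hby0 n
    rw [hQn]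
    positivity
  have hδQ : ∀ n, δ n ≤ Q n := fun n => by
    rw [hQn]
    nlinarith [hbx0 n, hby0 n, mul_nonneg hM₁0 (hbx0 n), mul_nonneg hM₂0 (hby0 n)]
  have hgrow : ∀ n, Q (n + 1) ≤ Q n + S * α n * Q n := fun n => by
    have h1 : Q (n + 1) ≤ Q n + S * a n := by
      have hsum4 : ex n + ex (n + 1) + ey n + ey (n + 1) + a n
          ≤ G * bx n + (G * bx n + G * a n) + G * bY n + (G * bY n + G * d n) + a n := by
        linarith [hxb n, hxx n, hyb n, hyy n]
      have h2 := (hstep n).trans (add_le_add_right (mul_le_mul_of_nonneg_left hsum4 hC) _)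
      have hdn : d n = Ly * (2 * G * bx n + (G + s) * a n) := by rw [hd]
      rw [hQn, hQn, hbxs, hbys]
      rw [hdn] at h2 ⊢
      have e1 : (C * (2 * G + G * (Ly * (2 * G))) + M₂ * (Ly * (2 * G)) + M₁ * r) * bx n
        = M₁ * bx n := by rw [hM₁e]
      have e2 : (C * (2 * G) + M₂ * r) * bY n = M₂ * bY n := by rw [hM₂e]
      rw [hS]
      linear_combination h2 + e1 + e2
    refine h1.trans ?_
    rw [← ha', ← mul_assoc]
    exact add_le_add_right (mul_le_mul_of_nonneg_left (hδQ n) (mul_nonneg hS0 (hα n).1.le)) _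
  have hQsum : Summable fun n => α n * Q n ^ 2 := by
    refine Summable.of_nonneg_of_le (fun n => mul_nonneg (hα n).1.le (sq_nonneg _)) (fun n => ?_)
      (((hsum.mul_left 3).add (hbxsum.mul_left (3 * M₁ ^ 2))).add
        (hbysum.mul_left (3 * M₂ ^ 2)))
    have h1 : Q n ^ 2 ≤ 3 * δ n ^ 2 + 3 * M₁ ^ 2 * bx n ^ 2 + 3 * M₂ ^ 2 * bY n ^ 2 := by
      rw [hQn]
      nlinarith [sq_nonneg (δ n - M₁ * bx n), sq_nonneg (δ n - M₂ * bY n),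
        sq_nonneg (M₁ * bx n - M₂ * bY n)]
    have h2 := mul_le_mul_of_nonneg_left h1 (hα n).1.le
    have h3 : α n * (3 * M₁ ^ 2 * bx n ^ 2 + 3 * M₂ ^ 2 * bY n ^ 2)
        ≤ 3 * M₁ ^ 2 * bx n ^ 2 + 3 * M₂ ^ 2 * bY n ^ 2 :=
      mul_le_of_le_one_left (by positivity) (hα n).2
    linarith
  have hQt := tendsto_zero_of_growth hS0 hQ0 hα hdiv hgrow hQsum
  have hsq : ∀ {u : ℕ → ℝ}, (∀ n, 0 ≤ u n) → (Summable fun n => u n ^ 2) →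
      Tendsto u atTop (𝓝 0) := fun hu hsu => by
    have := (Real.continuous_sqrt.tendsto 0).comp hsu.tendsto_atTop_zero
    simpa [Function.comp_def, Real.sqrt_sq (hu _)] using this
  refine ⟨squeeze_zero hδ hδQ hQt, squeeze_zero hex hxb ?_, squeeze_zero hey hyb ?_⟩
  · simpa using (hsq hbx0 hbxsum).const_mul G
  · simpa using (hsq hby0 hbysum).const_mul G

/-! ### Convex analysis over a closed convex set -/

section Convex

variable {E : Type*} [NormedAddCommGroup E] [InnerProductSpace ℝ E] {K : Set E}

lemma segment_mem (hK : Convex ℝ K) {a b : E} (ha : a ∈ K) (hb : b ∈ K) {t : ℝ}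
    (ht : t ∈ Set.Icc (0 : ℝ) 1) : a + t • (b - a) ∈ K :=
  hK.add_smul_sub_mem ha hb ht

lemma hasDerivWithinAt_segment [CompleteSpace E] (hK : Convex ℝ K) {a b p : E} (ha : a ∈ K)
    (hb : b ∈ K) {g : E → ℝ} {t : ℝ} (hg : HasGradientWithinAt g p K (a + t • (b - a))) :
    HasDerivWithinAt (fun t : ℝ => g (a + t • (b - a))) ⟪p, b - a⟫_ℝ (Set.Icc 0 1) t := by
  have h1 : HasDerivWithinAt (fun t : ℝ => a + t • (b - a)) (b - a) (Set.Icc 0 1) t := by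
    simpa using (((hasDerivAt_id t).smul_const (b - a)).const_add a).hasDerivWithinAt
  have h2 := hg.hasFDerivWithinAt.comp_hasDerivWithinAt t h1
    (fun s hs => segment_mem hK ha hb hs)
  exact h2.congr_deriv (by simp)

lemma tendsto_diffQuot [CompleteSpace E] (hK : Convex ℝ K) {a b p : E} (ha : a ∈ K) (hb : b ∈ K)
    {g : E → ℝ} (hg : HasGradientWithinAt g p K a) :
    Tendsto (fun t : ℝ => (g (a + t • (b - a)) - g a) / t) (𝓝[Set.Ioc 0 1] 0)
      (𝓝 ⟪p, b - a⟫_ℝ) := by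
  have h := hasDerivWithinAt_segment hK ha hb (t := 0) (by simpa using hg)
  rw [hasDerivWithinAt_iff_tendsto_slope] at h
  have hset : Set.Icc (0 : ℝ) 1 \ {0} = Set.Ioc 0 1 := by
    ext t
    simp only [Set.mem_sdiff, Set.mem_Icc, Set.mem_singleton_iff, Set.mem_Ioc]
    constructor
    · rintro ⟨⟨h1, h2⟩, h3⟩
      exact ⟨lt_of_le_of_ne h1 (Ne.symm h3), h2⟩
    · rintro ⟨h1, h2⟩
      exact ⟨⟨h1.le, h2⟩, h1.ne'⟩
  rw [hset] at h
  refine h.congr fun t => ?_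
  simp [slope_def_field]

instance neBot_nhdsWithin_Ioc : (𝓝[Set.Ioc (0 : ℝ) 1] 0).NeBot := by
  rw [nhdsWithin_Ioc_eq_nhdsGT one_pos]
  infer_instance

/-- The variational inequality of a minimizer of a sum of a differentiable and a convex
function. -/
lemma variational_inequality [CompleteSpace E] (hK : Convex ℝ K) {g G : E → ℝ} {z p : E}
    (hz : z ∈ K) (hmin : ∀ w ∈ K, g z + G z ≤ g w + G w) (hg : HasGradientWithinAt g p K z)
    (hG : ConvexOn ℝ K G) {w : E} (hw : w ∈ K) : 0 ≤ ⟪p, w - z⟫_ℝ + G w - G z := by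
  have h := tendsto_diffQuot hK hz hw hg
  have hge : G z - G w ≤ ⟪p, w - z⟫_ℝ := by
    refine ge_of_tendsto h ?_
    filter_upwards [self_mem_nhdsWithin] with t ht
    have ht' : t ∈ Set.Icc (0 : ℝ) 1 := ⟨ht.1.le, ht.2⟩
    have h1 := hmin _ (segment_mem hK hz hw ht')
    have h2 := hG.2 hz hw (by linarith [ht.2] : 0 ≤ 1 - t) ht.1.le (by ring)
    have e : (1 - t) • z + t • w = z + t • (w - z) := by module
    rw [e] at h2
    simp only [smul_eq_mul] at h2
    rw [le_div_iff₀ ht.1]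
    linarith
  linarith

lemma gradient_inequality_of_strongConvexOn [CompleteSpace E] {g : E → ℝ} {τ : ℝ}
    (hg : StrongConvexOn K τ g) {a b p : E} (ha : a ∈ K) (hb : b ∈ K)
    (hp : HasGradientWithinAt g p K a) :
    g a + ⟪p, b - a⟫_ℝ + τ / 2 * ‖b - a‖ ^ 2 ≤ g b := by
  have h := tendsto_diffQuot hg.1 ha hb hp
  have h' : Tendsto (fun t : ℝ => g b - g a - (1 - t) * (τ / 2 * ‖b - a‖ ^ 2))
      (𝓝[Set.Ioc 0 1] 0) (𝓝 (g b - g a - (1 - 0) * (τ / 2 * ‖b - a‖ ^ 2))) := by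
    refine Tendsto.mono_left ?_ nhdsWithin_le_nhds
    exact Continuous.tendsto (by fun_prop) 0
  have := le_of_tendsto_of_tendsto h h' (by
    filter_upwards [self_mem_nhdsWithin] with t ht
    have h2 := hg.2 ha hb (by linarith [ht.2] : 0 ≤ 1 - t) ht.1.le (by ring)
    have e : (1 - t) • a + t • b = a + t • (b - a) := by module
    rw [e, norm_sub_rev] at h2
    simp only [smul_eq_mul] at h2
    rw [div_le_iff₀ ht.1]
    linarith)
  linarith

lemma strongly_monotone_of_strongConvexOn [CompleteSpace E] {g : E → ℝ} {τ : ℝ}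
    (hg : StrongConvexOn K τ g) {a b p q : E} (ha : a ∈ K) (hb : b ∈ K)
    (hp : HasGradientWithinAt g p K a) (hq : HasGradientWithinAt g q K b) :
    τ * ‖b - a‖ ^ 2 ≤ ⟪q - p, b - a⟫_ℝ := by
  have h1 := gradient_inequality_of_strongConvexOn hg ha hb hp
  have h2 := gradient_inequality_of_strongConvexOn hg hb ha hq
  rw [norm_sub_rev, ← neg_sub b a, inner_neg_right] at h2
  rw [inner_sub_left]
  linarith

/-- The descent lemma. -/
lemma descent_inequality [CompleteSpace E] (hK : Convex ℝ K) {g : E → ℝ} {g' : E → E} {L : ℝ}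
    (hg : ∀ x ∈ K, HasGradientWithinAt g (g' x) K x)
    (hL : ∀ x ∈ K, ∀ y ∈ K, ‖g' x - g' y‖ ≤ L * ‖x - y‖) {a b : E} (ha : a ∈ K) (hb : b ∈ K) :
    g b ≤ g a + ⟪g' a, b - a⟫_ℝ + L / 2 * ‖b - a‖ ^ 2 := by
  have hd : ∀ t ∈ Set.Icc (0 : ℝ) 1, HasDerivWithinAt
      (fun t : ℝ => g (a + t • (b - a)) - t * ⟪g' a, b - a⟫_ℝ - t ^ 2 * (L / 2 * ‖b - a‖ ^ 2))
      (⟪g' (a + t • (b - a)), b - a⟫_ℝ - ⟪g' a, b - a⟫_ℝ - 2 * t * (L / 2 * ‖b - a‖ ^ 2))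
      (Set.Icc 0 1) t := fun t ht => by
    have h1 := hasDerivWithinAt_segment hK ha hb (hg _ (segment_mem hK ha hb ht))
    have h2 := ((hasDerivAt_id t).mul_const ⟪g' a, b - a⟫_ℝ).hasDerivWithinAt
      (s := Set.Icc (0 : ℝ) 1)
    have h3 := ((hasDerivAt_pow 2 t).mul_const (L / 2 * ‖b - a‖ ^ 2)).hasDerivWithinAt
      (s := Set.Icc (0 : ℝ) 1)
    exact ((h1.sub h2).sub h3).congr_deriv (by simp)
  have hanti := antitoneOn_of_hasDerivWithinAt_nonpos (convex_Icc (0 : ℝ) 1)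
    (fun t ht => (hd t ht).continuousWithinAt)
    (fun t ht => (hd t (interior_subset ht)).mono interior_subset)
    (fun t ht => by
      have ht' := interior_subset ht
      have h1 : ⟪g' (a + t • (b - a)) - g' a, b - a⟫_ℝ ≤ L * t * ‖b - a‖ ^ 2 := by
        refine (real_inner_le_norm _ _).trans ?_
        have := hL _ (segment_mem hK ha hb ht') _ ha
        rw [add_sub_cancel_left, norm_smul, Real.norm_of_nonneg ht'.1] at this
        have := mul_le_mul_of_nonneg_right this (norm_nonneg (b - a))
        linarith
      rw [inner_sub_left] at h1
      linarith)
  have := hanti (Set.left_mem_Icc.2 zero_le_one) (Set.right_mem_Icc.2 zero_le_one) zero_le_one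
  simp only [one_smul, zero_smul, add_zero, add_sub_cancel] at this
  linarith

/-- A convex lower semicontinuous function on a closed convex set of a finite-dimensional space
decreases at most linearly: it is bounded below on a ball, and convexity propagates the bound along
rays. -/
lemma exists_linear_lower_bound [FiniteDimensional ℝ E] (hKc : IsClosed K) {G : E → ℝ}
    (hG : ConvexOn ℝ K G) (hlsc : LowerSemicontinuousOn G K) {x₀ : E} (hx₀ : x₀ ∈ K) :
    ∃ C, 0 ≤ C ∧ ∀ z ∈ K, -C * (1 + ‖z - x₀‖) ≤ G z := by
  have hcomp : IsCompact (K ∩ Metric.closedBall x₀ 1) :=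
    (isCompact_closedBall x₀ 1).inter_left hKc
  obtain ⟨y, hy, hmin⟩ := (hlsc.mono Set.inter_subset_left).exists_isMinOn
    ⟨x₀, Set.mem_inter hx₀ (Metric.mem_closedBall_self zero_le_one)⟩ hcomp
  refine ⟨|G y| + |G x₀|, by positivity, fun z hz => ?_⟩
  have hn := norm_nonneg (z - x₀)
  by_cases h1 : ‖z - x₀‖ ≤ 1
  · have h2 := hmin (show z ∈ K ∩ Metric.closedBall x₀ 1 from
      ⟨hz, by rwa [Metric.mem_closedBall, dist_eq_norm]⟩)
    have h2' : G y ≤ G z := h2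
    nlinarith [neg_abs_le (G y), abs_nonneg (G y), abs_nonneg (G x₀)]
  · have hr : 1 < ‖z - x₀‖ := not_le.1 h1
    have hr0 : 0 < ‖z - x₀‖ := by linarith
    have ht : ‖z - x₀‖⁻¹ ∈ Set.Icc (0 : ℝ) 1 := ⟨by positivity, inv_le_one_of_one_le₀ hr.le⟩
    have hw : x₀ + ‖z - x₀‖⁻¹ • (z - x₀) ∈ K ∩ Metric.closedBall x₀ 1 := by
      refine ⟨segment_mem hG.1 hx₀ hz ht, ?_⟩
      rw [Metric.mem_closedBall, dist_eq_norm, add_sub_cancel_left, norm_smul, norm_inv, norm_norm,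
        inv_mul_cancel₀ hr0.ne']
    have h2 : G y ≤ G (x₀ + ‖z - x₀‖⁻¹ • (z - x₀)) := hmin hw
    have h3 := hG.2 hx₀ hz (by linarith [ht.2] : 0 ≤ 1 - ‖z - x₀‖⁻¹) ht.1 (by ring)
    have e : (1 - ‖z - x₀‖⁻¹) • x₀ + ‖z - x₀‖⁻¹ • z = x₀ + ‖z - x₀‖⁻¹ • (z - x₀) := by module
    rw [e] at h3
    simp only [smul_eq_mul] at h3
    have h4 := mul_le_mul_of_nonneg_left (h2.trans h3) hr0.le
    have e2 : ‖z - x₀‖ * ((1 - ‖z - x₀‖⁻¹) * G x₀ + ‖z - x₀‖⁻¹ * G z)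
        = (‖z - x₀‖ - 1) * G x₀ + G z := by
      field_simp
    rw [e2] at h4
    have h5 : (‖z - x₀‖ - 1) * G x₀ ≤ ‖z - x₀‖ * |G x₀| := by
      nlinarith [le_abs_self (G x₀), neg_abs_le (G x₀), abs_nonneg (G x₀)]
    nlinarith [neg_abs_le (G y), abs_nonneg (G y), abs_nonneg (G x₀)]

/-- Existence of the proximal minimizer: the quadratic term dominates the at most linear decrease of
`G`, so a sublevel set is compact. -/
lemma exists_prox_minimizer [FiniteDimensional ℝ E] (hKc : IsClosed K) {G : E → ℝ}
    (hG : ConvexOn ℝ K G) (hlsc : LowerSemicontinuousOn G K) (p : E) {v : E} (hv : v ∈ K) :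
    ∃ z ∈ K, ∀ w ∈ K, ⟪p, z - v⟫_ℝ + 1 / 2 * ‖z - v‖ ^ 2 + G z
      ≤ ⟪p, w - v⟫_ℝ + 1 / 2 * ‖w - v‖ ^ 2 + G w := by
  obtain ⟨C, hC0, hC⟩ := exists_linear_lower_bound hKc hG hlsc hv
  obtain ⟨R, hR⟩ : ∃ R, R = 2 * (‖p‖ + C + 1) + |G v| + C := ⟨_, rfl⟩
  have hR0 : 0 ≤ R := by rw [hR]; positivity
  have hcomp : IsCompact (K ∩ Metric.closedBall v R) := (isCompact_closedBall v R).inter_left hKc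
  have hl : LowerSemicontinuousOn (fun z => ⟪p, z - v⟫_ℝ + 1 / 2 * ‖z - v‖ ^ 2 + G z)
      (K ∩ Metric.closedBall v R) := by
    refine LowerSemicontinuousOn.add ?_ (hlsc.mono Set.inter_subset_left)
    exact (Continuous.lowerSemicontinuous (by fun_prop)).lowerSemicontinuousOn _
  obtain ⟨z, hz, hmin⟩ := hl.exists_isMinOn
    ⟨v, Set.mem_inter hv (Metric.mem_closedBall_self hR0)⟩ hcomp
  refine ⟨z, hz.1, fun w hw => ?_⟩
  by_cases hwR : w ∈ Metric.closedBall v R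
  · exact hmin ⟨hw, hwR⟩
  · have h1 : ⟪p, z - v⟫_ℝ + 1 / 2 * ‖z - v‖ ^ 2 + G z
        ≤ ⟪p, v - v⟫_ℝ + 1 / 2 * ‖v - v‖ ^ 2 + G v :=
      hmin ⟨hv, Metric.mem_closedBall_self hR0⟩
    simp only [sub_self, inner_zero_right, norm_zero] at h1
    rw [Metric.mem_closedBall, dist_eq_norm, not_le] at hwR
    have h2 := hC w hw
    have h3 := neg_le_of_abs_le (abs_real_inner_le_norm p (w - v))
    have h4 : (2 * (‖p‖ + C + 1) + |G v| + C) * ‖w - v‖ ≤ ‖w - v‖ ^ 2 := by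
      rw [← hR, pow_two]
      exact mul_le_mul_of_nonneg_right hwR.le (norm_nonneg _)
    have h5 : |G v| + C + 2 ≤ ‖w - v‖ := by
      have := norm_nonneg p
      linarith
    have h6 := le_abs_self (G v)
    have h7 := abs_nonneg (G v)
    nlinarith [mul_nonneg (add_nonneg h7 hC0) (norm_nonneg (w - v))]

/-- Uniqueness of the proximal minimizer, by averaging two minimizers. -/
lemma prox_minimizer_unique {G : E → ℝ} (hG : ConvexOn ℝ K G) {p v z z' : E} (hz : z ∈ K)
    (hz' : z' ∈ K)
    (h : ∀ w ∈ K, ⟪p, z - v⟫_ℝ + 1 / 2 * ‖z - v‖ ^ 2 + G z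
      ≤ ⟪p, w - v⟫_ℝ + 1 / 2 * ‖w - v‖ ^ 2 + G w)
    (h' : ∀ w ∈ K, ⟪p, z' - v⟫_ℝ + 1 / 2 * ‖z' - v‖ ^ 2 + G z'
      ≤ ⟪p, w - v⟫_ℝ + 1 / 2 * ‖w - v‖ ^ 2 + G w) : z = z' := by
  have hm := hG.1 hz hz' (by norm_num : (0 : ℝ) ≤ 1 / 2) (by norm_num : (0 : ℝ) ≤ 1 / 2)
    (by norm_num)
  have hc := hG.2 hz hz' (by norm_num : (0 : ℝ) ≤ 1 / 2) (by norm_num : (0 : ℝ) ≤ 1 / 2)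
    (by norm_num)
  have h1 := h _ hm
  have h2 := h' _ hm
  have e : (1 / 2 : ℝ) • z + (1 / 2 : ℝ) • z' - v
      = (1 / 2 : ℝ) • (z - v) + (1 / 2 : ℝ) • (z' - v) := by module
  rw [e] at h1 h2
  have e2 : ‖(1 / 2 : ℝ) • (z - v) + (1 / 2 : ℝ) • (z' - v)‖ ^ 2
      = 1 / 2 * ‖z - v‖ ^ 2 + 1 / 2 * ‖z' - v‖ ^ 2 - 1 / 4 * ‖z - z'‖ ^ 2 := by
    have e3 : z - z' = (z - v) - (z' - v) := by abel
    rw [e3]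
    generalize z - v = a
    generalize z' - v = b
    rw [norm_add_sq_real, norm_sub_sq_real, norm_smul, norm_smul, real_inner_smul_left,
      real_inner_smul_right]
    norm_num
    ring
  rw [e2, inner_add_right, real_inner_smul_right, real_inner_smul_right] at h1 h2
  simp only [smul_eq_mul] at hc
  have h3 : ‖z - z'‖ ^ 2 ≤ 0 := by linarith
  exact sub_eq_zero.1 (norm_eq_zero.1 (pow_eq_zero_iff two_ne_zero |>.1
    (le_antisymm h3 (sq_nonneg _))))

end Convex

/-! ### Products of nonnegative matrices over a time-varying network -/

/-- The transition matrix `X (n + s - 1) * ... * X n` over `s` steps, starting at time `n`. -/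
noncomputable def prodMat {I : ℕ} (X : ℕ → Matrix (Fin I) (Fin I) ℝ) (n : ℕ) :
    ℕ → Matrix (Fin I) (Fin I) ℝ
  | 0 => 1
  | s + 1 => X (n + s) * prodMat X n s

section Network

variable {I : ℕ} {X : ℕ → Matrix (Fin I) (Fin I) ℝ}

lemma prodMat_add (n s t : ℕ) : prodMat X n (s + t) = prodMat X (n + s) t * prodMat X n s := by
  induction t with
  | zero => simp [prodMat]
  | succ t ih => rw [← add_assoc, prodMat, ih, prodMat, Matrix.mul_assoc, add_assoc]

lemma prodMat_one (n : ℕ) : prodMat X n 1 = X n := by simp [prodMat]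

lemma prodMat_succ' (n s : ℕ) : prodMat X n (s + 1) = prodMat X (n + 1) s * X n := by
  rw [add_comm, prodMat_add, prodMat_one]

lemma prodMat_mem {S : Submonoid (Matrix (Fin I) (Fin I) ℝ)} (h : ∀ n, X n ∈ S) (n s : ℕ) :
    prodMat X n s ∈ S := by
  induction s with
  | zero => exact S.one_mem
  | succ s ih => exact S.mul_mem (h _) ih

lemma prodMat_nonneg (h : ∀ n i j, 0 ≤ X n i j) (n s : ℕ) (i j : Fin I) :
    0 ≤ prodMat X n s i j := by
  induction s generalizing i with
  | zero =>
    rw [prodMat, Matrix.one_apply]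
    split_ifs <;> norm_num
  | succ s ih =>
    rw [prodMat, Matrix.mul_apply]
    exact Finset.sum_nonneg fun k _ => mul_nonneg (h _ _ _) (ih k)

lemma prodMat_step_ge {β : ℝ} (hβ : 0 ≤ β) (h : ∀ n i j, 0 ≤ X n i j) {n s : ℕ}
    {i k j : Fin I} (hX : β ≤ X (n + s) i k) (hk : β ^ s ≤ prodMat X n s k j) :
    β ^ (s + 1) ≤ prodMat X n (s + 1) i j := by
  rw [prodMat, Matrix.mul_apply, pow_succ']
  refine (mul_le_mul hX hk (pow_nonneg hβ s) (h _ _ _)).trans ?_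
  exact Finset.single_le_sum (f := fun k => X (n + s) i k * prodMat X n s k j)
    (fun k _ => mul_nonneg (h _ _ _) (prodMat_nonneg h _ _ _ _)) (Finset.mem_univ k)

/-- A set of nodes that can be left by a path of links can be left by a single link. -/
lemma exists_crossing {α : Type*} {r : α → α → Prop} {S : Set α} {a b : α}
    (h : Relation.ReflTransGen r a b) (ha : a ∈ S) (hb : b ∉ S) :
    ∃ c d, c ∈ S ∧ d ∉ S ∧ r c d := by
  induction h with
  | refl => exact absurd ha hb
  | @tail c d hac hcd ih =>
    by_cases hc : c ∈ S
    · exact ⟨c, d, hc, hb, hcd⟩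
    · exact ih hc

/-- After `(I - 1) * B` steps every agent has heard from every other: the set of agents reached by a
given one grows in every window of length `B` until it contains everybody. -/
lemma prodMat_entries_ge {𝒢 : ℕ → Digraph (Fin I)} {B : ℕ} (hG : BStronglyConnected 𝒢 B)
    {β : ℝ} (hβ : 0 ≤ β) (h : ∀ n i j, 0 ≤ X n i j) (hdiag : ∀ n i, β ≤ X n i i)
    (hedge : ∀ n i j, (𝒢 n).Adj j i → β ≤ X n i j) (n : ℕ) {s : ℕ} (hs : (I - 1) * B ≤ s)
    (i j : Fin I) : β ^ s ≤ prodMat X n s i j := by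
  classical
  obtain ⟨R, hR⟩ : ∃ R : ℕ → Finset (Fin I),
      R = fun s => Finset.univ.filter fun i => β ^ s ≤ prodMat X n s i j := ⟨_, rfl⟩
  have hmem : ∀ s i, i ∈ R s ↔ β ^ s ≤ prodMat X n s i j := fun s i => by simp [hR]
  have hmono : Monotone R := monotone_nat_of_le_succ fun s i hi => by
    rw [hmem] at hi ⊢
    exact prodMat_step_ge hβ h (hdiag _ _) hi
  have hj : ∀ s, j ∈ R s := fun s => hmono (Nat.zero_le s) (by
    rw [hmem, prodMat, Matrix.one_apply_eq, pow_zero])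
  have hgrow : ∀ s, R s ≠ Finset.univ → (R s).card < (R (s + B)).card := fun s hne => by
    obtain ⟨b, hb⟩ : ∃ b, b ∉ R s := by
      by_contra! hcon
      exact hne (Finset.eq_univ_iff_forall.2 hcon)
    obtain ⟨c, d, hc, hd, t, ht, htB, hadj⟩ :=
      exists_crossing (S := (R s : Set (Fin I))) (hG.2 (n + s) j b) (hj s) hb
    refine Finset.card_lt_card ⟨hmono (Nat.le_add_right _ _), fun hsub => hd (hsub ?_)⟩
    obtain ⟨u, rfl⟩ : ∃ u, t = n + u := ⟨t - n, by omega⟩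
    have hcu : c ∈ R u := hmono (by omega) hc
    refine hmono (by omega : u + 1 ≤ s + B) ?_
    rw [hmem] at hcu ⊢
    exact prodMat_step_ge hβ h (hedge _ _ _ hadj) hcu
  have hcard : ∀ q, min I (q + 1) ≤ (R (q * B)).card := fun q => by
    induction q with
    | zero =>
      exact (min_le_right _ _).trans (Finset.card_pos.2 ⟨j, hj _⟩)
    | succ q ih =>
      by_cases hu : R (q * B) = Finset.univ
      · have h1 : R ((q + 1) * B) = Finset.univ := by
          refine Finset.univ_subset_iff.1 (hu ▸ hmono ?_)
          exact Nat.mul_le_mul_right _ q.le_succ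
        rw [h1, Finset.card_univ, Fintype.card_fin]
        exact min_le_left _ _
      · have h1 := hgrow _ hu
        rw [add_mul, one_mul]
        omega
  have huniv : R ((I - 1) * B) = Finset.univ := by
    refine Finset.eq_univ_of_card _ (le_antisymm (Finset.card_le_univ _) ?_)
    rw [Fintype.card_fin]
    have := hcard (I - 1)
    omega
  have hi : i ∈ R s := hmono hs (huniv ▸ Finset.mem_univ i)
  exact (hmem s i).1 hi

/-! ### Action on families of vectors -/

/-- The action of a matrix on a family of vectors, each agent combining the vectors of all. -/
noncomputable def act {E : Type*} [AddCommGroup E] [Module ℝ E] (M : Matrix (Fin I) (Fin I) ℝ)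
    (v : Fin I → E) : Fin I → E := fun i => ∑ j, M i j • v j

section act

variable {E : Type*} [AddCommGroup E] [Module ℝ E]

lemma act_mul (M N : Matrix (Fin I) (Fin I) ℝ) (v : Fin I → E) :
    act (M * N) v = act M (act N v) := by
  funext i
  simp only [act, Matrix.mul_apply, Finset.sum_smul, Finset.smul_sum, smul_smul]
  exact Finset.sum_comm

lemma act_add (M : Matrix (Fin I) (Fin I) ℝ) (v w : Fin I → E) :
    act M (v + w) = act M v + act M w := by
  funext i
  simp [act, smul_add, Finset.sum_add_distrib]

end act

/-- The Euclidean norm of a stacked family of vectors. -/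
noncomputable def stackNorm {E : Type*} [NormedAddCommGroup E] (v : Fin I → E) : ℝ :=
  l2 Finset.univ fun i => ‖v i‖

section stackNorm

variable {E : Type*} [NormedAddCommGroup E]

lemma stackNorm_nonneg {v : Fin I → E} : 0 ≤ stackNorm v := l2_nonneg

lemma norm_le_stackNorm (v : Fin I → E) (i : Fin I) : ‖v i‖ ≤ stackNorm v :=
  le_l2 (u := fun i => ‖v i‖) (Finset.mem_univ i)

lemma stackNorm_mono {F : Type*} [NormedAddCommGroup F] {v : Fin I → E} {w : Fin I → F} {c : ℝ}
    (hc : 0 ≤ c) (h : ∀ i, ‖v i‖ ≤ c * ‖w i‖) : stackNorm v ≤ c * stackNorm w := by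
  unfold stackNorm
  rw [← l2_const_mul hc]
  exact l2_mono (fun i _ => norm_nonneg _) fun i _ => h i

lemma stackNorm_add_le (v w : Fin I → E) : stackNorm (v + w) ≤ stackNorm v + stackNorm w :=
  (l2_mono (fun _ _ => norm_nonneg _) fun i _ => norm_add_le (v i) (w i)).trans l2_add_le

lemma stackNorm_neg (v : Fin I → E) : stackNorm (-v) = stackNorm v := by
  simp [stackNorm]

lemma stackNorm_sub_le (v w : Fin I → E) : stackNorm (v - w) ≤ stackNorm v + stackNorm w := by
  rw [sub_eq_add_neg, ← stackNorm_neg w]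
  exact stackNorm_add_le _ _

lemma stackNorm_smul [NormedSpace ℝ E] {c : ℝ} (hc : 0 ≤ c) (v : Fin I → E) :
    stackNorm (c • v) = c * stackNorm v := by
  unfold stackNorm
  rw [← l2_const_mul hc]
  simp [norm_smul, abs_of_nonneg hc]

lemma stackNorm_const (e : E) : stackNorm (fun _ : Fin I => e) = √I * ‖e‖ := by
  simp [stackNorm, l2, Real.sqrt_sq]

lemma sum_norm_le_stackNorm (v : Fin I → E) : ∑ i, ‖v i‖ ≤ √I * stackNorm v := by
  have := sum_mul_le_l2 (s := Finset.univ) (u := fun _ : Fin I => (1 : ℝ)) (v := fun i => ‖v i‖)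
  simpa [l2, stackNorm] using this

lemma stackNorm_act_le_of_entries [NormedSpace ℝ E] {M : Matrix (Fin I) (Fin I) ℝ} {μ : ℝ} (hμ : 0 ≤ μ)
    (h : ∀ i j, |M i j| ≤ μ) (v : Fin I → E) : stackNorm (act M v) ≤ I * μ * stackNorm v := by
  have h1 : ∀ i, ‖act M v i‖ ≤ 1 * ‖μ * (√I * stackNorm v)‖ := fun i => by
    rw [one_mul, Real.norm_of_nonneg (mul_nonneg hμ (mul_nonneg (Real.sqrt_nonneg _)
      stackNorm_nonneg))]
    refine (norm_sum_le _ _).trans ((Finset.sum_le_sum (g := fun j => μ * ‖v j‖) fun j _ => ?_).trans ?_)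
    · rw [norm_smul, Real.norm_eq_abs]
      exact mul_le_mul_of_nonneg_right (h i j) (norm_nonneg _)
    · rw [← Finset.mul_sum]
      exact mul_le_mul_of_nonneg_left (sum_norm_le_stackNorm v) hμ
  refine (stackNorm_mono zero_le_one (w := fun _ => μ * (√I * stackNorm v)) h1).trans ?_
  rw [stackNorm_const, Real.norm_of_nonneg (mul_nonneg hμ (mul_nonneg (Real.sqrt_nonneg _)
      stackNorm_nonneg)), one_mul]
  refine le_of_eq ?_
  have : √(I : ℝ) * √I = I := Real.mul_self_sqrt (Nat.cast_nonneg _)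
  linear_combination μ * stackNorm v * this

end stackNorm

/-! ### Deviation from the weighted average -/

/-- The difference between the transition matrix of `W` over `s` steps from time `n` and the
projection on consensus with weights `φ n / I`. -/
noncomputable def deviation (W : ℕ → Matrix (Fin I) (Fin I) ℝ) (φ : ℕ → Fin I → ℝ) (n s : ℕ) :
    Matrix (Fin I) (Fin I) ℝ := prodMat W n s - Matrix.of fun _ j => φ n j / I

/-- Row-stochastic mixing matrices `W n`, together with positive weights `φ n` of total mass `I`
that they transport backwards: `φ (n + 1)` pulled back along `W n` is `φ n`. -/
structure Mixing (W : ℕ → Matrix (Fin I) (Fin I) ℝ) (φ : ℕ → Fin I → ℝ) : Prop where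
  nonneg : ∀ n i j, 0 ≤ W n i j
  row : ∀ n i, ∑ j, W n i j = 1
  pos : ∀ n i, 0 < φ n i
  mass : ∀ n, ∑ i, φ n i = I
  transport : ∀ n j, ∑ i, φ (n + 1) i * W n i j = φ n j

lemma natCast_pos_of_fin (i : Fin I) : (0 : ℝ) < I := by
  have : 0 < I := Fin.pos i
  exact_mod_cast this

/-- A row-stochastic matrix with entries at least `η` shrinks the oscillation of a vector by the
factor `1 - η`. -/
lemma oscillation_mulVec_le {P : Matrix (Fin I) (Fin I) ℝ} {η δ : ℝ} (hη : 0 ≤ η)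
    (hP : ∀ i j, η ≤ P i j) (hrow : ∀ i, ∑ j, P i j = 1) {v : Fin I → ℝ}
    (hv : ∀ i k, v i - v k ≤ δ) (i k : Fin I) : P.mulVec v i - P.mulVec v k ≤ (1 - η) * δ := by
  have : Nonempty (Fin I) := ⟨i⟩
  obtain ⟨j₀, hj₀⟩ := Finite.exists_min v
  have hδ : 0 ≤ δ := by simpa using hv i i
  have hdev : ∀ i, P.mulVec v i = v j₀ + ∑ j, P i j * (v j - v j₀) := fun i => by
    simp only [mul_sub, Finset.sum_sub_distrib, ← Finset.sum_mul, hrow, one_mul, Matrix.mulVec,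
      dotProduct]
    ring
  have hlow : v j₀ ≤ P.mulVec v k := by
    rw [hdev k]
    refine le_add_of_nonneg_right (Finset.sum_nonneg fun j _ => ?_)
    exact mul_nonneg (hη.trans (hP _ _)) (sub_nonneg.2 (hj₀ j))
  have hup : ∑ j, P i j * (v j - v j₀) ≤ (1 - η) * δ := by
    have h1 : ∑ j, P i j * (v j - v j₀) ≤ ∑ j, (P i j * δ - if j = j₀ then η * δ else 0) := by
      refine Finset.sum_le_sum fun j _ => ?_
      split_ifs with hj
      · rw [hj, sub_self, mul_zero, ← sub_mul]
        exact mul_nonneg (sub_nonneg.2 (hP _ _)) hδ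
      · rw [sub_zero]
        exact mul_le_mul_of_nonneg_left (hv _ _) (hη.trans (hP _ _))
    refine h1.trans (le_of_eq ?_)
    rw [Finset.sum_sub_distrib, ← Finset.sum_mul, hrow, Finset.sum_ite_eq' Finset.univ j₀]
    simp
    ring
  rw [hdev i]
  linarith

namespace Mixing

variable {W : ℕ → Matrix (Fin I) (Fin I) ℝ} {φ : ℕ → Fin I → ℝ}

lemma row_prod (hW : Mixing W φ) (n s : ℕ) (i : Fin I) : ∑ j, prodMat W n s i j = 1 := by
  induction s generalizing i with
  | zero => simp [prodMat, Matrix.one_apply]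
  | succ s ih =>
    simp only [prodMat, Matrix.mul_apply]
    rw [Finset.sum_comm]
    simp only [← Finset.mul_sum, ih, mul_one, hW.row]

lemma transport_prod (hW : Mixing W φ) (n s : ℕ) (j : Fin I) :
    ∑ i, φ (n + s) i * prodMat W n s i j = φ n j := by
  induction s with
  | zero => simp [prodMat, Matrix.one_apply]
  | succ s ih =>
    simp only [prodMat, Matrix.mul_apply, Finset.mul_sum]
    rw [Finset.sum_comm, ← ih]
    refine Finset.sum_congr rfl fun k _ => ?_
    rw [← hW.transport (n + s) k, Finset.sum_mul]
    exact Finset.sum_congr rfl fun i _ => by rw [add_assoc]; ring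

lemma deviation_add (hW : Mixing W φ) (n s t : ℕ) :
    deviation W φ n (s + t) = deviation W φ (n + s) t * deviation W φ n s := by
  ext i j
  have hI : (I : ℝ) ≠ 0 := (natCast_pos_of_fin i).ne'
  simp only [deviation, Matrix.mul_apply, Matrix.sub_apply, Matrix.of_apply, sub_mul, mul_sub,
    Finset.sum_sub_distrib]
  rw [← Finset.sum_mul, hW.row_prod, ← Finset.sum_mul, ← Finset.sum_div, hW.mass, div_self hI,
    prodMat_add, Matrix.mul_apply]
  have : ∑ x, φ (n + s) x / I * prodMat W n s x j = φ n j / I := by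
    rw [← hW.transport_prod n s j, Finset.sum_div]
    exact Finset.sum_congr rfl fun k _ => by ring
  rw [this]
  ring

lemma deviation_succ (hW : Mixing W φ) (n s : ℕ) :
    deviation W φ n (s + 1) = deviation W φ (n + 1) s * W n := by
  ext i j
  simp only [deviation, Matrix.mul_apply, Matrix.sub_apply, Matrix.of_apply, sub_mul,
    Finset.sum_sub_distrib]
  rw [prodMat_succ', Matrix.mul_apply]
  congr 1
  rw [← hW.transport n j, Finset.sum_div]
  exact Finset.sum_congr rfl fun k _ => by ring

/-- Contraction over blocks of length `b` yields block-geometric decay. -/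
lemma geometric_decay {E : Type*} [NormedAddCommGroup E] [NormedSpace ℝ E] (hW : Mixing W φ)
    {c ρ : ℝ} {b : ℕ} (hb : 0 < b) (hρ0 : 0 ≤ ρ)
    (hc : ∀ n s (v : Fin I → E), stackNorm (act (deviation W φ n s) v) ≤ c * stackNorm v)
    (hρ : ∀ n (v : Fin I → E), stackNorm (act (deviation W φ n b) v) ≤ ρ * stackNorm v)
    (hc0 : 0 ≤ c) (n s : ℕ) (v : Fin I → E) :
    stackNorm (act (deviation W φ n s) v) ≤ c * ρ ^ (s / b) * stackNorm v := by
  induction s using Nat.strong_induction_on generalizing n v with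
  | _ s ih =>
    rcases lt_or_ge s b with hs | hs
    · rw [Nat.div_eq_of_lt hs, pow_zero, mul_one]
      exact hc n s v
    · obtain ⟨t, rfl⟩ := Nat.exists_eq_add_of_le hs
      rw [hW.deviation_add, act_mul, Nat.add_div_left t hb, pow_succ]
      refine (ih t (by omega) _ _).trans ?_
      have := mul_le_mul_of_nonneg_left (hρ n v) (mul_nonneg hc0 (pow_nonneg hρ0 (t / b)))
      linarith

lemma oscillation_prod_le (hW : Mixing W φ) {η : ℝ} {T : ℕ} (hη : 0 ≤ η) (hT : 0 < T)
    (h : ∀ n i j, η ≤ prodMat W n T i j) (n s : ℕ) {v : Fin I → ℝ} {δ : ℝ}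
    (hv : ∀ i k, v i - v k ≤ δ) (i k : Fin I) :
    (prodMat W n s).mulVec v i - (prodMat W n s).mulVec v k ≤ (1 - η) ^ (s / T) * δ := by
  induction s using Nat.strong_induction_on generalizing n v δ with
  | _ s ih =>
    rcases lt_or_ge s T with hs | hs
    · rw [Nat.div_eq_of_lt hs, pow_zero, one_mul]
      simpa using oscillation_mulVec_le le_rfl (prodMat_nonneg hW.nonneg n s) (hW.row_prod n s) hv i k
    · obtain ⟨t, rfl⟩ := Nat.exists_eq_add_of_le hs
      rw [prodMat_add, ← Matrix.mulVec_mulVec, Nat.add_div_left t hT, pow_succ, mul_assoc]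
      exact ih t (by omega) _ fun i k => oscillation_mulVec_le hη (h n) (hW.row_prod n T) hv i k

lemma abs_deviation_le (hW : Mixing W φ) {η : ℝ} {T : ℕ} (hη : 0 ≤ η) (hT : 0 < T)
    (h : ∀ n i j, η ≤ prodMat W n T i j) (n s : ℕ) (i j : Fin I) :
    |deviation W φ n s i j| ≤ (1 - η) ^ (s / T) := by
  have hI : (0 : ℝ) < I := natCast_pos_of_fin i
  have hosc : ∀ i k, prodMat W n s i j - prodMat W n s k j ≤ (1 - η) ^ (s / T) := fun i k => by
    have := hW.oscillation_prod_le hη hT h n s (v := Pi.single j 1) (δ := 1) (fun a b => by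
      simp only [Pi.single_apply]
      split_ifs <;> norm_num) i k
    simpa using this
  -- `φ n j / I` is a weighted average of the entries of the `j`-th column
  have havg : deviation W φ n s i j
      = ∑ k, φ (n + s) k / I * (prodMat W n s i j - prodMat W n s k j) := by
    simp only [mul_sub, Finset.sum_sub_distrib, ← Finset.sum_mul, ← Finset.sum_div, hW.mass,
      div_self hI.ne', one_mul, deviation, Matrix.sub_apply, Matrix.of_apply]
    rw [← hW.transport_prod n s j, Finset.sum_div]
    congr 1
    exact Finset.sum_congr rfl fun k _ => by ring
  have hw : ∑ k, φ (n + s) k / I * (1 - η) ^ (s / T) = (1 - η) ^ (s / T) := by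
    rw [← Finset.sum_mul, ← Finset.sum_div, hW.mass, div_self hI.ne', one_mul]
  rw [havg, ← hw]
  refine (Finset.abs_sum_le_sum_abs _ _).trans (Finset.sum_le_sum fun k _ => ?_)
  have hk : 0 ≤ φ (n + s) k / I := div_nonneg (hW.pos _ _).le hI.le
  rw [abs_mul, abs_of_nonneg hk]
  refine mul_le_mul_of_nonneg_left (abs_le.2 ⟨?_, hosc i k⟩) hk
  linarith [hosc k i]

end Mixing

/-! ### Push-sum weights -/

/-- Weights `φ`, started at one and propagated by column-stochastic matrices compliant with a
strongly connected sequence of digraphs. -/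
structure PushSum (𝒢 : ℕ → Digraph (Fin I)) (B : ℕ) (A : ℕ → Matrix (Fin I) (Fin I) ℝ) (κ : ℝ)
    (φ : ℕ → Fin I → ℝ) : Prop where
  connected : BStronglyConnected 𝒢 B
  compliant : Compliant 𝒢 A κ
  column : ColumnStochastic A
  init : ∀ i, φ 0 i = 1
  step : ∀ n i, φ (n + 1) i = ∑ j, A n i j * φ n j

/-- The row-stochastic matrices that the push-sum weights make of column-stochastic ones. -/
noncomputable def pushSumMatrix (A : ℕ → Matrix (Fin I) (Fin I) ℝ) (φ : ℕ → Fin I → ℝ) (n : ℕ) :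
    Matrix (Fin I) (Fin I) ℝ := Matrix.of fun i j => (φ (n + 1) i)⁻¹ * (A n i j * φ n j)

namespace PushSum

variable {𝒢 : ℕ → Digraph (Fin I)} {B : ℕ} {A : ℕ → Matrix (Fin I) (Fin I) ℝ} {κ : ℝ}
  {φ : ℕ → Fin I → ℝ}

lemma entry_nonneg (h : PushSum 𝒢 B A κ φ) (n : ℕ) (i j : Fin I) : 0 ≤ A n i j := by
  by_cases hij : i = j
  · rw [hij]
    exact h.compliant.pos.le.trans (h.compliant.diag n j)
  · by_cases hadj : (𝒢 n).Adj j i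
    · exact h.compliant.pos.le.trans (h.compliant.edge n i j hadj)
    · exact (h.compliant.nonedge n i j hij hadj).ge

lemma kappa_le_one (h : PushSum 𝒢 B A κ φ) (i : Fin I) : κ ≤ 1 := by
  rw [← h.column 0 i]
  exact (h.compliant.diag 0 i).trans (Finset.single_le_sum (f := fun k => A 0 k i)
    (fun k _ => h.entry_nonneg 0 k i) (Finset.mem_univ i))

lemma mass (h : PushSum 𝒢 B A κ φ) (n : ℕ) : ∑ i, φ n i = I := by
  induction n with
  | zero => simp [h.init]
  | succ n ih =>
    simp only [h.step]
    rw [Finset.sum_comm]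
    have hc : ∀ j, ∑ i, A n i j = 1 := h.column n
    simp only [← Finset.sum_mul, hc, one_mul, ih]

lemma phi_add (h : PushSum 𝒢 B A κ φ) (n s : ℕ) (i : Fin I) :
    φ (n + s) i = ∑ j, prodMat A n s i j * φ n j := by
  induction s generalizing i with
  | zero => simp [prodMat, Matrix.one_apply]
  | succ s ih =>
    rw [← add_assoc, h.step]
    simp only [ih, prodMat, Matrix.mul_apply, Finset.mul_sum, Finset.sum_mul]
    rw [Finset.sum_comm]
    exact Finset.sum_congr rfl fun j _ => Finset.sum_congr rfl fun k _ => by ring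

lemma phi_nonneg (h : PushSum 𝒢 B A κ φ) (n : ℕ) (i : Fin I) : 0 ≤ φ n i := by
  induction n generalizing i with
  | zero => rw [h.init]; exact zero_le_one
  | succ n ih =>
    rw [h.step]
    exact Finset.sum_nonneg fun j _ => mul_nonneg (h.entry_nonneg n i j) (ih j)

lemma phiLb_pos (h : PushSum 𝒢 B A κ φ) : 0 < phiLb I B κ := pow_pos h.compliant.pos _

lemma phiLb_le (h : PushSum 𝒢 B A κ φ) (n : ℕ) (i : Fin I) : phiLb I B κ ≤ φ n i := by
  have hκ := h.compliant.pos
  have hκ1 := h.kappa_le_one i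
  have hT : κ ^ (2 * (I - 1) * B) ≤ κ ^ ((I - 1) * B) := by
    refine pow_le_pow_of_le_one hκ.le hκ1 (Nat.mul_le_mul_right _ ?_)
    omega
  refine hT.trans ?_
  rcases le_total ((I - 1) * B) n with hn | hn
  · obtain ⟨k, rfl⟩ := Nat.exists_eq_add_of_le' hn
    rw [h.phi_add]
    have h1 : ∑ j, κ ^ ((I - 1) * B) * φ k j ≤ ∑ j, prodMat A k ((I - 1) * B) i j * φ k j :=
      Finset.sum_le_sum fun j _ => mul_le_mul_of_nonneg_right
        (prodMat_entries_ge h.connected hκ.le h.entry_nonneg h.compliant.diag h.compliant.edge k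
          le_rfl i j) (h.phi_nonneg k j)
    rw [← Finset.mul_sum, h.mass] at h1
    refine le_trans (le_mul_of_one_le_right (by positivity) ?_) h1
    have : 1 ≤ I := Fin.pos i
    exact_mod_cast this
  · have h1 : ∀ n, κ ^ n ≤ φ n i := fun n => by
      induction n with
      | zero => rw [h.init, pow_zero]
      | succ n ih =>
        rw [h.step, pow_succ']
        refine (mul_le_mul (h.compliant.diag n i) ih (by positivity) (h.entry_nonneg _ _ _)).trans ?_
        exact Finset.single_le_sum (f := fun j => A n i j * φ n j)
          (fun j _ => mul_nonneg (h.entry_nonneg _ _ _) (h.phi_nonneg _ _)) (Finset.mem_univ i)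
    exact (pow_le_pow_of_le_one hκ.le hκ1 hn).trans (h1 n)

lemma phi_pos (h : PushSum 𝒢 B A κ φ) (n : ℕ) (i : Fin I) : 0 < φ n i :=
  h.phiLb_pos.trans_le (h.phiLb_le n i)

lemma phi_le (h : PushSum 𝒢 B A κ φ) (n : ℕ) (i : Fin I) : φ n i ≤ I := by
  rw [← h.mass n]
  exact Finset.single_le_sum (f := φ n) (fun j _ => h.phi_nonneg n j) (Finset.mem_univ i)

lemma phi_le_phiUb (h : PushSum 𝒢 B A κ φ) (hI : 2 ≤ I) (n : ℕ) (i : Fin I) :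
    φ n i ≤ phiUb I B κ := by
  have : Nontrivial (Fin I) := Fin.nontrivial_iff_two_le.2 hI
  obtain ⟨j, hj⟩ := exists_ne i
  have h1 : ∑ k ∈ {i, j}, φ n k ≤ ∑ k, φ n k :=
    Finset.sum_le_sum_of_subset_of_nonneg (Finset.subset_univ _) fun k _ _ => h.phi_nonneg n k
  rw [Finset.sum_pair hj.symm, h.mass] at h1
  have h2 : κ ^ (2 * (I - 1) * B) ≤ φ n j := h.phiLb_le n j
  unfold phiUb
  linarith

lemma mixing (h : PushSum 𝒢 B A κ φ) : Mixing (pushSumMatrix A φ) φ where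
  nonneg n i j := mul_nonneg (inv_nonneg.2 (h.phi_nonneg _ _))
    (mul_nonneg (h.entry_nonneg _ _ _) (h.phi_nonneg _ _))
  row n i := by
    simp only [pushSumMatrix, Matrix.of_apply, ← Finset.mul_sum]
    rw [← h.step, inv_mul_cancel₀ (h.phi_pos _ _).ne']
  pos := h.phi_pos
  mass := h.mass
  transport n j := by
    simp only [pushSumMatrix, Matrix.of_apply]
    have hc : ∑ i, A n i j = 1 := h.column n j
    simp only [mul_inv_cancel_left₀ (h.phi_pos _ _).ne', ← Finset.sum_mul, hc, one_mul]

lemma kappaTilde_pos (h : PushSum 𝒢 B A κ φ) (i : Fin I) : 0 < kappaTilde I B κ :=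
  div_pos (pow_pos h.compliant.pos _) (natCast_pos_of_fin i)

lemma kappaTilde_le_one (h : PushSum 𝒢 B A κ φ) (i : Fin I) : kappaTilde I B κ ≤ 1 := by
  have h1 : (1 : ℝ) ≤ I := by
    have : 1 ≤ I := Fin.pos i
    exact_mod_cast this
  exact div_le_one_of_le₀ ((pow_le_one₀ h.compliant.pos.le (h.kappa_le_one i)).trans h1)
    (by linarith)

/-- The positive entries of the row-stochastic matrices are at least `κ * φlb / I`. -/
lemma kappaTilde_le_entry (h : PushSum 𝒢 B A κ φ) {n : ℕ} {i j : Fin I} (hA : κ ≤ A n i j) :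
    kappaTilde I B κ ≤ pushSumMatrix A φ n i j := by
  have h1 := h.phi_pos (n + 1) i
  have h2 : κ ^ (2 * (I - 1) * B) ≤ φ n j := h.phiLb_le n j
  have hκ := h.compliant.pos
  rw [kappaTilde, pushSumMatrix, Matrix.of_apply, inv_mul_eq_div, pow_succ']
  exact div_le_div₀ (mul_nonneg (h.entry_nonneg _ _ _) (h.phi_nonneg _ _))
    (mul_le_mul hA h2 (by positivity) (h.entry_nonneg _ _ _)) h1 (h.phi_le _ _)

lemma prod_entries_ge (h : PushSum 𝒢 B A κ φ) {T : ℕ} (hT : (I - 1) * B ≤ T) (n : ℕ)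
    (i j : Fin I) : kappaTilde I B κ ^ T ≤ prodMat (pushSumMatrix A φ) n T i j :=
  prodMat_entries_ge h.connected (h.kappaTilde_pos i).le h.mixing.nonneg
    (fun n i => h.kappaTilde_le_entry (h.compliant.diag n i))
    (fun n i j hij => h.kappaTilde_le_entry (h.compliant.edge n i j hij)) n hT i j

/-- Consensus contraction for column-stochastic weights. -/
lemma stackNorm_deviation_le {E : Type*} [NormedAddCommGroup E] [NormedSpace ℝ E]
    (h : PushSum 𝒢 B A κ φ) (i₀ : Fin I) {T : ℕ} (hT : (I - 1) * B ≤ T) (hT0 : 0 < T) (n s : ℕ)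
    (v : Fin I → E) : stackNorm (act (deviation (pushSumMatrix A φ) φ n s) v)
      ≤ I * (1 - kappaTilde I B κ ^ T) ^ (s / T) * stackNorm v := by
  have h0 := (h.kappaTilde_pos i₀).le
  have h1 : kappaTilde I B κ ^ T ≤ 1 := pow_le_one₀ h0 (h.kappaTilde_le_one i₀)
  exact stackNorm_act_le_of_entries (pow_nonneg (by linarith) _)
    (h.mixing.abs_deviation_le (pow_nonneg h0 T) hT0 (h.prod_entries_ge hT) n s) v

end PushSum

end Network

/-! ### Doubly stochastic weights -/

section DoublyStochastic

variable {I : ℕ}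

/-- The decrease of the sum of squares under a doubly stochastic matrix. -/
lemma sum_sq_sub_sum_sq_mulVec {P : Matrix (Fin I) (Fin I) ℝ} (hrow : ∀ i, ∑ j, P i j = 1)
    (hcol : ∀ j, ∑ i, P i j = 1) (u : Fin I → ℝ) :
    ∑ i, u i ^ 2 - ∑ k, P.mulVec u k ^ 2
      = 1 / 2 * ∑ k, ∑ i, ∑ j, P k i * P k j * (u i - u j) ^ 2 := by
  have h1 : ∀ k, ∑ i, ∑ j, P k i * P k j * (u i - u j) ^ 2
      = 2 * ∑ i, P k i * u i ^ 2 - 2 * P.mulVec u k ^ 2 := fun k => by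
    have e : ∀ i, ∑ j, P k i * P k j * (u i - u j) ^ 2
        = P k i * u i ^ 2 - 2 * (P k i * u i * P.mulVec u k) + P k i * ∑ j, P k j * u j ^ 2 := by
      intro i
      have : P k i * u i ^ 2 = P k i * u i ^ 2 * ∑ j, P k j := by rw [hrow, mul_one]
      rw [this, Matrix.mulVec, dotProduct, Finset.mul_sum, Finset.mul_sum, Finset.mul_sum,
        Finset.mul_sum, ← Finset.sum_sub_distrib, ← Finset.sum_add_distrib]
      exact Finset.sum_congr rfl fun j _ => by ring
    simp only [e, Finset.sum_add_distrib, Finset.sum_sub_distrib, ← Finset.mul_sum,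
      ← Finset.sum_mul, hrow]
    rw [show ∑ i, P k i * u i = P.mulVec u k from rfl]
    ring
  have h2 : ∑ k, ∑ i, P k i * u i ^ 2 = ∑ i, u i ^ 2 := by
    rw [Finset.sum_comm]
    simp only [← Finset.sum_mul, hcol, one_mul]
  simp only [h1, Finset.sum_sub_distrib, ← Finset.mul_sum, h2]
  ring

/-- If a weight at least `κ` crosses the cut `(S, Sᶜ)`, the two-step weight `Pᵀ P` across the cut is
at least `κ / 2`. Either some row of `S` puts less than half of its mass on `S`, and its own diagonal
weight suffices; or the outflow of `S`, which equals the inflow and is at least `κ`, loses at most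
half. -/
lemma cut_weight_ge {P : Matrix (Fin I) (Fin I) ℝ} (h0 : ∀ i j, 0 ≤ P i j)
    (hrow : ∀ i, ∑ j, P i j = 1) (hcol : ∀ j, ∑ i, P i j = 1) {κ : ℝ}
    (hdiag : ∀ i, κ ≤ P i i) (S : Finset (Fin I))
    (hcross : ∃ i ∈ S, ∃ j ∈ Sᶜ, κ ≤ P i j ∨ κ ≤ P j i) :
    κ / 2 ≤ ∑ k, (∑ i ∈ S, P k i) * ∑ j ∈ Sᶜ, P k j := by
  obtain ⟨s, hs⟩ : ∃ s : Fin I → ℝ, s = fun k => ∑ i ∈ S, P k i := ⟨_, rfl⟩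
  obtain ⟨c, hc⟩ : ∃ c : Fin I → ℝ, c = fun k => ∑ j ∈ Sᶜ, P k j := ⟨_, rfl⟩
  have hs0 : ∀ k, 0 ≤ s k := fun k => by rw [hs]; exact Finset.sum_nonneg fun i _ => h0 k i
  have hc0 : ∀ k, 0 ≤ c k := fun k => by rw [hc]; exact Finset.sum_nonneg fun i _ => h0 k i
  have hsc : ∀ k, s k + c k = 1 := fun k => by
    rw [hs, hc]
    exact (Finset.sum_add_sum_compl S _).trans (hrow k)
  have hflow : ∑ k ∈ S, c k = ∑ k ∈ Sᶜ, s k := by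
    have h1 : ∑ k, s k = S.card := by
      have h2 : ∑ k, s k = ∑ i ∈ S, ∑ k, P k i := by
        rw [hs]
        exact Finset.sum_comm
      simp [h2, hcol]
    have h2 : ∑ k ∈ S, (s k + c k) = S.card := by simp [hsc]
    rw [← Finset.sum_add_sum_compl S] at h1
    rw [Finset.sum_add_distrib] at h2
    linarith
  have hout : κ ≤ ∑ k ∈ S, c k := by
    obtain ⟨i, hi, j, hj, h | h⟩ := hcross
    · have h1 : P i j ≤ c i := by
        rw [hc]
        exact Finset.single_le_sum (f := fun j => P i j) (fun j _ => h0 i j) hj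
      exact h.trans (h1.trans (Finset.single_le_sum (fun k _ => hc0 k) hi))
    · have h1 : P j i ≤ s j := by
        rw [hs]
        exact Finset.single_le_sum (f := fun i => P j i) (fun i _ => h0 j i) hi
      rw [hflow]
      exact h.trans (h1.trans (Finset.single_le_sum (fun k _ => hs0 k) hj))
  have hgoal : ∑ k, (∑ i ∈ S, P k i) * ∑ j ∈ Sᶜ, P k j = ∑ k, s k * c k := by rw [hs, hc]
  rw [hgoal]
  have hterm : ∀ k, 0 ≤ s k * c k := fun k => mul_nonneg (hs0 k) (hc0 k)
  by_cases hhalf : ∃ k ∈ S, s k < 1 / 2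
  · obtain ⟨k, hk, hk2⟩ := hhalf
    have h1 : κ ≤ s k := by
      refine (hdiag k).trans ?_
      rw [hs]
      exact Finset.single_le_sum (f := fun i => P k i) (fun i _ => h0 k i) hk
    refine le_trans ?_ (Finset.single_le_sum (fun k _ => hterm k) (Finset.mem_univ k))
    have h2 := hsc k
    nlinarith [hs0 k]
  · push Not at hhalf
    refine le_trans ?_ (Finset.sum_le_sum_of_subset_of_nonneg (Finset.subset_univ S)
      fun k _ _ => hterm k)
    calc κ / 2 ≤ ∑ k ∈ S, 1 / 2 * c k := by rw [← Finset.mul_sum]; linarith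
      _ ≤ ∑ k ∈ S, s k * c k :=
        Finset.sum_le_sum fun k hk => mul_le_mul_of_nonneg_right (hhalf k hk) (hc0 k)

/-- The values of a vector in increasing order, with the position of each index. -/
lemma exists_sorted (v : Fin I → ℝ) : ∃ (w : ℕ → ℝ) (rank : Fin I → ℕ), Monotone w ∧
    (∀ i, v i = w (rank i)) ∧ (∀ i, rank i < I) ∧ ∀ d < I, ∃ i, rank i = d := by
  rcases Nat.eq_zero_or_pos I with rfl | hI
  · exact ⟨fun _ => 0, fun i => i.elim0, monotone_const, fun i => i.elim0, fun i => i.elim0,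
      fun d hd => absurd hd (Nat.not_lt_zero d)⟩
  · have hlt : ∀ d, min d (I - 1) < I := fun d => by omega
    refine ⟨fun d => v (Tuple.sort v ⟨min d (I - 1), hlt d⟩), fun i => (Tuple.sort v).symm i,
      fun a b hab => ?_, fun i => ?_, fun i => ((Tuple.sort v).symm i).2, fun d hd => ?_⟩
    · refine Tuple.monotone_sort v (Fin.mk_le_mk.2 ?_)
      exact min_le_min_right _ hab
    · have h1 : (⟨min ((Tuple.sort v).symm i : ℕ) (I - 1), hlt _⟩ : Fin I)
          = (Tuple.sort v).symm i := by
        ext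
        have := ((Tuple.sort v).symm i).2
        simp only
        omega
      simp only [h1, Equiv.apply_symm_apply]
    · exact ⟨Tuple.sort v ⟨d, hd⟩, by simp⟩

/-- The squared difference of two values dominates the squares of disjoint gaps between them. -/
lemma sum_gap_sq_le {w : ℕ → ℝ} (hw : Monotone w) (F : Finset ℕ) {a b : ℝ}
    (ha : ∀ d ∈ F, a ≤ w d) (hb : ∀ d ∈ F, w (d + 1) ≤ b) :
    ∑ d ∈ F, (w (d + 1) - w d) ^ 2 ≤ (b - a) ^ 2 := by
  have hgap : ∀ d, 0 ≤ w (d + 1) - w d := fun d => sub_nonneg.2 (hw d.le_succ)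
  rcases F.eq_empty_or_nonempty with rfl | hF
  · simpa using sq_nonneg (b - a)
  · refine (Finset.sum_sq_le_sq_sum_of_nonneg fun d _ => hgap d).trans ?_
    refine pow_le_pow_left₀ (Finset.sum_nonneg fun d _ => hgap d) ?_ 2
    have hsub : F ⊆ Finset.Ico (F.min' hF) (F.max' hF + 1) := fun d hd =>
      Finset.mem_Ico.2 ⟨F.min'_le d hd, Nat.lt_succ_of_le (F.le_max' d hd)⟩
    refine (Finset.sum_le_sum_of_subset_of_nonneg hsub fun d _ _ => hgap d).trans ?_
    rw [Finset.sum_Ico_sub w ((F.min'_le _ (F.max'_mem hF)).trans (Nat.le_succ _))]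
    linarith [ha _ (F.min'_mem hF), hb _ (F.max'_mem hF)]

/-- The sum of squared deviations from the mean is at most `I ^ 2` times the sum of the squared gaps
between consecutive values. -/
lemma sum_sq_dev_le_gaps {v : Fin I → ℝ} {w : ℕ → ℝ} {rank : Fin I → ℕ} (hw : Monotone w)
    (hv : ∀ i, v i = w (rank i)) (hrank : ∀ i, rank i < I) :
    ∑ i, (v i - (∑ j, v j) / I) ^ 2
      ≤ (I : ℝ) ^ 2 * ∑ d ∈ Finset.range (I - 1), (w (d + 1) - w d) ^ 2 := by
  rcases Nat.eq_zero_or_pos I with rfl | hI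
  · simp
  have hI0 : (I : ℝ) ≠ 0 := by exact_mod_cast hI.ne'
  have h1 : ∑ i, (v i - (∑ j, v j) / I) ^ 2 ≤ ∑ i, (v i - w 0) ^ 2 := by
    have e : ∀ c : ℝ, ∑ i, (v i - c) ^ 2 = ∑ i, v i ^ 2 - 2 * c * ∑ i, v i + I * c ^ 2 := by
      intro c
      simp only [sub_sq, Finset.sum_add_distrib, Finset.sum_sub_distrib, Finset.mul_sum]
      simp only [Finset.sum_const, Finset.card_univ, Fintype.card_fin, nsmul_eq_mul]
      congr 2
      exact Finset.sum_congr rfl fun i _ => by ring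
    rw [e, e]
    obtain ⟨s, hs⟩ : ∃ s, s = ∑ j, v j := ⟨_, rfl⟩
    rw [← hs]
    have h2 : 0 ≤ (I : ℝ) * (s / I - w 0) ^ 2 := by positivity
    have h3 : (I : ℝ) * (s / I - w 0) ^ 2 = I * w 0 ^ 2 - 2 * w 0 * s - (I * (s / I) ^ 2 -
        2 * (s / I) * s) := by
      field_simp
      ring
    linarith
  have hspan : (w (I - 1) - w 0) ^ 2
      ≤ ((I - 1 : ℕ) : ℝ) * ∑ d ∈ Finset.range (I - 1), (w (d + 1) - w d) ^ 2 := by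
    have := sq_sum_le_card_mul_sum_sq (s := Finset.range (I - 1)) (f := fun d => w (d + 1) - w d)
    rwa [Finset.sum_range_sub, Finset.card_range] at this
  have hI1 : ((I - 1 : ℕ) : ℝ) ≤ I := by exact_mod_cast Nat.sub_le I 1
  have hg0 : 0 ≤ ∑ d ∈ Finset.range (I - 1), (w (d + 1) - w d) ^ 2 :=
    Finset.sum_nonneg fun d _ => sq_nonneg _
  calc _ ≤ ∑ i, (v i - w 0) ^ 2 := h1
    _ ≤ ∑ _i : Fin I, (w (I - 1) - w 0) ^ 2 := by
        refine Finset.sum_le_sum fun i _ => ?_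
        have h2 : w 0 ≤ v i := hv i ▸ hw (Nat.zero_le _)
        have h3 : v i ≤ w (I - 1) := hv i ▸ hw (by have := hrank i; omega)
        exact pow_le_pow_left₀ (by linarith) (by linarith) 2
    _ = I * (w (I - 1) - w 0) ^ 2 := by simp
    _ ≤ I * (I * ∑ d ∈ Finset.range (I - 1), (w (d + 1) - w d) ^ 2) :=
        mul_le_mul_of_nonneg_left (hspan.trans (mul_le_mul_of_nonneg_right hI1 hg0))
          (Nat.cast_nonneg _)
    _ = _ := by ring

/-- One step with a doubly stochastic matrix: if every cut `{rank ≤ d}`, `d ∈ F`, is crossed by a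
weight at least `κ`, and each still separates the values of `u` by the gap `w (d + 1) - w d`, then
the sum of squares drops by `κ / 2` times the squares of these gaps. -/
lemma sum_sq_mulVec_le {P : Matrix (Fin I) (Fin I) ℝ} (h0 : ∀ i j, 0 ≤ P i j)
    (hrow : ∀ i, ∑ j, P i j = 1) (hcol : ∀ j, ∑ i, P i j = 1) {κ : ℝ}
    (hdiag : ∀ i, κ ≤ P i i) {u : Fin I → ℝ} {w : ℕ → ℝ} (hw : Monotone w) (rank : Fin I → ℕ)
    (F : Finset ℕ)
    (hcross : ∀ d ∈ F, ∃ i, rank i ≤ d ∧ ∃ j, d < rank j ∧ (κ ≤ P i j ∨ κ ≤ P j i))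
    (hlow : ∀ d ∈ F, ∀ i, rank i ≤ d → u i ≤ w d)
    (hup : ∀ d ∈ F, ∀ i, d < rank i → w (d + 1) ≤ u i) :
    κ / 2 * ∑ d ∈ F, (w (d + 1) - w d) ^ 2 ≤ ∑ i, u i ^ 2 - ∑ k, P.mulVec u k ^ 2 := by
  classical
  obtain ⟨ind, hind⟩ : ∃ ind : ℕ → Fin I → Fin I → ℝ,
      ind = fun d i j => if rank i ≤ d ∧ d < rank j then 1 else 0 := ⟨_, rfl⟩
  have hord : ∀ i j, ∑ d ∈ F, ind d i j * (w (d + 1) - w d) ^ 2 ≤ (u i - u j) ^ 2 := by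
    intro i j
    have e : ∑ d ∈ F, ind d i j * (w (d + 1) - w d) ^ 2
        = ∑ d ∈ F.filter (fun d => rank i ≤ d ∧ d < rank j), (w (d + 1) - w d) ^ 2 := by
      rw [Finset.sum_filter, hind]
      exact Finset.sum_congr rfl fun d _ => by simp
    rw [e, ← neg_sub (u j), neg_sq]
    refine sum_gap_sq_le hw _ (fun d hd => ?_) (fun d hd => ?_)
    · obtain ⟨h1, h2, h3⟩ := Finset.mem_filter.1 hd
      exact hlow d h1 i h2
    · obtain ⟨h1, h2, h3⟩ := Finset.mem_filter.1 hd
      exact hup d h1 j h3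
  have hzero : ∀ i j, rank i ≤ rank j → ∑ d ∈ F, ind d j i * (w (d + 1) - w d) ^ 2 = 0 := by
    intro i j hij
    refine Finset.sum_eq_zero fun d _ => ?_
    have : ¬ (rank j ≤ d ∧ d < rank i) := by omega
    rw [hind]
    simp [this]
  have hpair : ∀ i j, ∑ d ∈ F, ind d i j * (w (d + 1) - w d) ^ 2
      + ∑ d ∈ F, ind d j i * (w (d + 1) - w d) ^ 2 ≤ (u i - u j) ^ 2 := by
    intro i j
    rcases le_total (rank i) (rank j) with hij | hij
    · rw [hzero i j hij, add_zero]
      exact hord i j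
    · rw [hzero j i hij, zero_add, ← neg_sub (u j), neg_sq]
      exact hord j i
  have hcut : ∀ d, ∑ k, ∑ i, ∑ j, P k i * P k j * ind d i j
      = ∑ k, (∑ i ∈ Finset.univ.filter (fun i => rank i ≤ d), P k i)
        * ∑ j ∈ (Finset.univ.filter (fun i => rank i ≤ d))ᶜ, P k j := by
    intro d
    refine Finset.sum_congr rfl fun k _ => ?_
    rw [Finset.compl_filter, Finset.sum_filter, Finset.sum_filter, Finset.sum_mul_sum]
    refine Finset.sum_congr rfl fun i _ => Finset.sum_congr rfl fun j _ => ?_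
    rw [hind]
    by_cases h1 : rank i ≤ d <;> by_cases h2 : d < rank j <;> simp [h1, h2]
  have hswap : ∀ d, ∑ k, ∑ i, ∑ j, P k i * P k j * ind d j i
      = ∑ k, ∑ i, ∑ j, P k i * P k j * ind d i j := by
    intro d
    refine Finset.sum_congr rfl fun k _ => ?_
    rw [Finset.sum_comm]
    exact Finset.sum_congr rfl fun i _ => Finset.sum_congr rfl fun j _ => by ring
  have hcutge : ∀ d ∈ F, κ / 2 ≤ ∑ k, ∑ i, ∑ j, P k i * P k j * ind d i j := by
    intro d hd
    rw [hcut]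
    refine cut_weight_ge h0 hrow hcol hdiag _ ?_
    obtain ⟨i, hi, j, hj, hij⟩ := hcross d hd
    exact ⟨i, by simpa using hi, j, by simpa using hj, hij⟩
  rw [sum_sq_sub_sum_sq_mulVec hrow hcol, Finset.mul_sum]
  have hsplit : ∀ (J : ℕ → Fin I → Fin I → ℝ),
      ∑ k, ∑ i, ∑ j, P k i * P k j * ∑ d ∈ F, J d i j * (w (d + 1) - w d) ^ 2
        = ∑ d ∈ F, (∑ k, ∑ i, ∑ j, P k i * P k j * J d i j) * (w (d + 1) - w d) ^ 2 := by
    intro J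
    simp only [Finset.mul_sum, Finset.sum_mul]
    symm
    rw [Finset.sum_comm]
    refine Finset.sum_congr rfl fun k _ => ?_
    rw [Finset.sum_comm]
    refine Finset.sum_congr rfl fun i _ => ?_
    rw [Finset.sum_comm]
    exact Finset.sum_congr rfl fun j _ => Finset.sum_congr rfl fun d _ => by ring
  calc ∑ d ∈ F, κ / 2 * (w (d + 1) - w d) ^ 2
      ≤ ∑ d ∈ F, (∑ k, ∑ i, ∑ j, P k i * P k j * ind d i j) * (w (d + 1) - w d) ^ 2 :=
        Finset.sum_le_sum fun d hd => mul_le_mul_of_nonneg_right (hcutge d hd) (sq_nonneg _)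
    _ = 1 / 2 * (∑ k, ∑ i, ∑ j, P k i * P k j * ∑ d ∈ F, ind d i j * (w (d + 1) - w d) ^ 2
        + ∑ k, ∑ i, ∑ j, P k i * P k j * ∑ d ∈ F, ind d j i * (w (d + 1) - w d) ^ 2) := by
        rw [hsplit ind, hsplit fun d i j => ind d j i]
        simp only [hswap]
        ring
    _ ≤ _ := by
        refine mul_le_mul_of_nonneg_left ?_ (by norm_num)
        simp only [← Finset.sum_add_distrib, ← mul_add]
        refine Finset.sum_le_sum fun k _ => Finset.sum_le_sum fun i _ =>
          Finset.sum_le_sum fun j _ => mul_le_mul_of_nonneg_left ?_ (mul_nonneg (h0 _ _) (h0 _ _))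
        rw [Finset.sum_add_distrib]
        exact hpair i j

variable {𝒢 : ℕ → Digraph (Fin I)} {B : ℕ} {A : ℕ → Matrix (Fin I) (Fin I) ℝ} {κ : ℝ}

/-- As long as no link has crossed the cut `{rank ≤ d}`, the values on its two sides stay separated
by the initial gap. -/
lemma separated_of_no_crossing (hA : Compliant 𝒢 A κ) (h0 : ∀ n i j, 0 ≤ A n i j)
    (hrow : RowStochastic A) {v : Fin I → ℝ} {w : ℕ → ℝ} {rank : Fin I → ℕ} (hw : Monotone w)
    (hv : ∀ i, v i = w (rank i)) (n d t : ℕ)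
    (hno : ∀ s < t, ∀ i j, rank i ≤ d → d < rank j →
      ¬ (𝒢 (n + s)).Adj i j ∧ ¬ (𝒢 (n + s)).Adj j i) :
    (∀ i, rank i ≤ d → (prodMat A n t).mulVec v i ≤ w d) ∧
      ∀ i, d < rank i → w (d + 1) ≤ (prodMat A n t).mulVec v i := by
  induction t with
  | zero =>
    simp only [prodMat, Matrix.one_mulVec, hv]
    exact ⟨fun i hi => hw hi, fun i hi => hw hi⟩
  | succ t ih =>
    obtain ⟨ih1, ih2⟩ := ih fun s hs => hno s (by omega)
    rw [prodMat, ← Matrix.mulVec_mulVec]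
    generalize (prodMat A n t).mulVec v = u at ih1 ih2
    constructor
    · intro i hi
      have h1 : ∑ j, A (n + t) i j * u j ≤ ∑ j, A (n + t) i j * w d := by
        refine Finset.sum_le_sum fun j _ => ?_
        rcases le_or_gt (rank j) d with hj | hj
        · exact mul_le_mul_of_nonneg_left (ih1 j hj) (h0 _ _ _)
        · rw [hA.nonedge _ _ _ (by rintro rfl; omega) (hno t (by omega) i j hi hj).2]
          simp
      rwa [← Finset.sum_mul, hrow, one_mul] at h1
    · intro i hi
      have h1 : ∑ j, A (n + t) i j * w (d + 1) ≤ ∑ j, A (n + t) i j * u j := by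
        refine Finset.sum_le_sum fun j _ => ?_
        rcases le_or_gt (rank j) d with hj | hj
        · rw [hA.nonedge _ _ _ (by rintro rfl; omega) (hno t (by omega) j i hj hi).1]
          simp
        · exact mul_le_mul_of_nonneg_left (ih2 j hj) (h0 _ _ _)
      rwa [← Finset.sum_mul, hrow, one_mul] at h1

/-- Over a window in which the union of the digraphs is strongly connected, each cut between
consecutive values is charged to the first time at which a link crosses it. -/
lemma sum_sq_prod_mulVec_le (hG : BStronglyConnected 𝒢 B) (hA : Compliant 𝒢 A κ)
    (h0 : ∀ n i j, 0 ≤ A n i j) (hrow : RowStochastic A) (hcol : ColumnStochastic A) (n : ℕ)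
    (v : Fin I → ℝ) :
    ∑ i, (prodMat A n B).mulVec v i ^ 2
      ≤ ∑ i, v i ^ 2 - κ / (2 * (I : ℝ) ^ 2) * ∑ i, (v i - (∑ j, v j) / I) ^ 2 := by
  classical
  rcases Nat.eq_zero_or_pos I with rfl | hI
  · simp
  obtain ⟨w, rank, hw, hv, hrank, hsurj⟩ := exists_sorted v
  let cross : ℕ → ℕ → Prop := fun d t => ∃ i, rank i ≤ d ∧ ∃ j, d < rank j ∧
    ((𝒢 (n + t)).Adj i j ∨ (𝒢 (n + t)).Adj j i)
  have hex : ∀ d, ∃ t, d < I - 1 → t < B ∧ cross d t ∧ ∀ s < t, ¬ cross d s := by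
    intro d
    by_cases hd : d < I - 1
    · obtain ⟨a, ha⟩ := hsurj d (by omega)
      obtain ⟨b, hb⟩ := hsurj (d + 1) (by omega)
      obtain ⟨i, j, hi, hj, t, ht, htB, hadj⟩ := exists_crossing (S := {i | rank i ≤ d})
        (hG.2 n a b) ha.le (by simp [hb])
      obtain ⟨u, rfl⟩ : ∃ u, t = n + u := ⟨t - n, by omega⟩
      have hcu : ∃ t, cross d t := ⟨u, i, hi, j, not_le.1 hj, Or.inl hadj⟩
      refine ⟨Nat.find hcu, fun _ => ⟨?_, Nat.find_spec hcu, fun s hs => Nat.find_min hcu hs⟩⟩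
      have : Nat.find hcu ≤ u := Nat.find_min' hcu ⟨i, hi, j, not_le.1 hj, Or.inl hadj⟩
      omega
    · exact ⟨0, fun h => absurd h hd⟩
  choose τ hτ using hex
  have hstep : ∀ t, κ / 2 * ∑ d ∈ (Finset.range (I - 1)).filter (fun d => τ d = t),
        (w (d + 1) - w d) ^ 2
      ≤ ∑ i, (prodMat A n t).mulVec v i ^ 2 - ∑ i, (prodMat A n (t + 1)).mulVec v i ^ 2 := by
    intro t
    rw [prodMat, ← Matrix.mulVec_mulVec]
    have hsep : ∀ d ∈ (Finset.range (I - 1)).filter (fun d => τ d = t),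
        (∀ i, rank i ≤ d → (prodMat A n t).mulVec v i ≤ w d) ∧
          ∀ i, d < rank i → w (d + 1) ≤ (prodMat A n t).mulVec v i := by
      intro d hd
      obtain ⟨hd1, rfl⟩ := Finset.mem_filter.1 hd
      refine separated_of_no_crossing hA h0 hrow hw hv n d _ fun s hs i j hi hj => ?_
      have := (hτ d (Finset.mem_range.1 hd1)).2.2 s hs
      exact ⟨fun h => this ⟨i, hi, j, hj, Or.inl h⟩, fun h => this ⟨i, hi, j, hj, Or.inr h⟩⟩
    refine sum_sq_mulVec_le (h0 _) (hrow _) (hcol _) (hA.diag _) hw rank _ (fun d hd => ?_)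
      (fun d hd => (hsep d hd).1) (fun d hd => (hsep d hd).2)
    obtain ⟨hd1, rfl⟩ := Finset.mem_filter.1 hd
    obtain ⟨i, hi, j, hj, hadj⟩ := (hτ d (Finset.mem_range.1 hd1)).2.1
    exact ⟨i, hi, j, hj, hadj.symm.imp (hA.edge _ _ _) (hA.edge _ _ _)⟩
  have htot : κ / 2 * ∑ d ∈ Finset.range (I - 1), (w (d + 1) - w d) ^ 2
      ≤ ∑ i, v i ^ 2 - ∑ i, (prodMat A n B).mulVec v i ^ 2 := by
    have h1 := Finset.sum_le_sum fun t (_ : t ∈ Finset.range B) => hstep t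
    rw [← Finset.mul_sum, Finset.sum_fiberwise_of_maps_to (t := Finset.range B) (fun d hd =>
      Finset.mem_range.2 (hτ d (Finset.mem_range.1 hd)).1), Finset.sum_range_sub'] at h1
    simpa [prodMat] using h1
  have hdev := sum_sq_dev_le_gaps hw hv hrank
  have hI0 : (0 : ℝ) < I := by exact_mod_cast hI
  have h2 : κ / (2 * (I : ℝ) ^ 2) * ∑ i, (v i - (∑ j, v j) / I) ^ 2
      ≤ κ / 2 * ∑ d ∈ Finset.range (I - 1), (w (d + 1) - w d) ^ 2 := by
    have hκ := hA.pos
    refine (mul_le_mul_of_nonneg_left hdev (by positivity)).trans (le_of_eq ?_)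
    field_simp
  linarith

/-- Lifting of a bound on the squared norm from scalars to vectors, coordinate by coordinate. -/
lemma stackNorm_act_le_of_scalar {m : ℕ} {M : Matrix (Fin I) (Fin I) ℝ} {q : ℝ}
    (hM : ∀ v : Fin I → ℝ, ∑ i, M.mulVec v i ^ 2 ≤ q * ∑ i, v i ^ 2) (v : Fin I → Vec m) :
    stackNorm (act M v) ≤ √q * stackNorm v := by
  have hcoord : ∀ i k, act M v i k = M.mulVec (fun j => v j k) i := fun i k => by
    simp [act, Matrix.mulVec, dotProduct]
  have hnorm : ∀ v : Fin I → Vec m, stackNorm v = √(∑ k, ∑ i, v i k ^ 2) := fun v => by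
    rw [Finset.sum_comm, stackNorm, l2]
    simp only [EuclideanSpace.norm_sq_eq, Real.norm_eq_abs, sq_abs]
  rw [hnorm, hnorm, ← Real.sqrt_mul' _ (Finset.sum_nonneg fun k _ =>
    Finset.sum_nonneg fun i _ => sq_nonneg _), Finset.mul_sum]
  refine Real.sqrt_le_sqrt (Finset.sum_le_sum fun k _ => ?_)
  simp only [hcoord]
  exact hM _

namespace PushSum

variable {φ : ℕ → Fin I → ℝ}

lemma phi_eq_one (h : PushSum 𝒢 B A κ φ) (hrow : RowStochastic A) (n : ℕ) (i : Fin I) :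
    φ n i = 1 := by
  induction n generalizing i with
  | zero => exact h.init i
  | succ n ih =>
    rw [h.step]
    simp only [ih, mul_one]
    exact hrow n i

lemma pushSumMatrix_eq (h : PushSum 𝒢 B A κ φ) (hrow : RowStochastic A) :
    pushSumMatrix A φ = A := by
  funext n
  ext i j
  simp [pushSumMatrix, h.phi_eq_one hrow]

lemma sum_prodMat_mulVec (h : PushSum 𝒢 B A κ φ) (n s : ℕ) (v : Fin I → ℝ) :
    ∑ i, (prodMat A n s).mulVec v i = ∑ i, v i := by
  have hc : ∀ j, ∑ i, prodMat A n s i j = 1 := by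
    have hmem : prodMat A n s ∈ Matrix.colStochastic ℝ (Fin I) :=
      prodMat_mem (fun n => Matrix.mem_colStochastic_iff_sum.2
        ⟨h.entry_nonneg n, h.column n⟩) n s
    exact (Matrix.mem_colStochastic_iff_sum.1 hmem).2
  simp only [Matrix.mulVec, dotProduct]
  rw [Finset.sum_comm]
  simp only [← Finset.sum_mul, hc, one_mul]

lemma sum_sq_deviation_mulVec (h : PushSum 𝒢 B A κ φ) (hrow : RowStochastic A) (n s : ℕ)
    (v : Fin I → ℝ) : ∑ i, (deviation A φ n s).mulVec v i ^ 2
      = ∑ i, (prodMat A n s).mulVec v i ^ 2 - I * ((∑ j, v j) / I) ^ 2 := by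
  rcases Nat.eq_zero_or_pos I with rfl | hI
  · simp
  have hI0 : (I : ℝ) ≠ 0 := by exact_mod_cast hI.ne'
  have e : ∀ i, (deviation A φ n s).mulVec v i
      = (prodMat A n s).mulVec v i - (∑ j, v j) / I := fun i => by
    rw [deviation, Matrix.sub_mulVec, Pi.sub_apply]
    congr 1
    simp only [Matrix.mulVec, dotProduct, Matrix.of_apply, h.phi_eq_one hrow, Finset.sum_div]
    exact Finset.sum_congr rfl fun j _ => by ring
  simp only [e, sub_sq, Finset.sum_add_distrib, Finset.sum_sub_distrib, ← Finset.sum_mul,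
    ← Finset.mul_sum, h.sum_prodMat_mulVec, Finset.sum_const, Finset.card_univ, Fintype.card_fin,
    nsmul_eq_mul]
  field_simp
  ring

lemma stackNorm_deviation_le_self {m : ℕ} (h : PushSum 𝒢 B A κ φ) (hrow : RowStochastic A)
    (n s : ℕ) (v : Fin I → Vec m) : stackNorm (act (deviation A φ n s) v) ≤ 1 * stackNorm v := by
  rw [← Real.sqrt_one]
  refine stackNorm_act_le_of_scalar (fun v => ?_) v
  rw [h.sum_sq_deviation_mulVec hrow, one_mul]
  have h1 : ∑ i, (prodMat A n s).mulVec v i ^ 2 ≤ ∑ i, v i ^ 2 := by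
    induction s with
    | zero => simp [prodMat]
    | succ s ih =>
      refine le_trans ?_ ih
      rw [prodMat, ← Matrix.mulVec_mulVec]
      have h2 := sum_sq_sub_sum_sq_mulVec (hrow (n + s)) (h.column (n + s))
        ((prodMat A n s).mulVec v)
      have h3 : 0 ≤ ∑ k, ∑ i, ∑ j, A (n + s) k i * A (n + s) k j *
          ((prodMat A n s).mulVec v i - (prodMat A n s).mulVec v j) ^ 2 :=
        Finset.sum_nonneg fun k _ => Finset.sum_nonneg fun i _ => Finset.sum_nonneg fun j _ =>
          mul_nonneg (mul_nonneg (h.entry_nonneg _ _ _) (h.entry_nonneg _ _ _)) (sq_nonneg _)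
      linarith
  have h2 : (0 : ℝ) ≤ I * ((∑ j, v j) / I) ^ 2 := by positivity
  linarith

/-- Consensus contraction for doubly stochastic weights over one window of connectivity. -/
lemma stackNorm_deviation_le_sqrt {m : ℕ} (h : PushSum 𝒢 B A κ φ) (hrow : RowStochastic A)
    (n : ℕ) (v : Fin I → Vec m) : stackNorm (act (deviation A φ n B) v)
      ≤ √(1 - κ / (2 * (I : ℝ) ^ 2)) * stackNorm v := by
  refine stackNorm_act_le_of_scalar (fun v => ?_) v
  rcases Nat.eq_zero_or_pos I with rfl | hI
  · simp
  have hI1 : (1 : ℝ) ≤ I := by exact_mod_cast hI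
  have h1 := sum_sq_prod_mulVec_le h.connected h.compliant h.entry_nonneg hrow h.column n v
  have h2 : ∑ i, (v i - (∑ j, v j) / I) ^ 2 = ∑ i, v i ^ 2 - I * ((∑ j, v j) / I) ^ 2 := by
    have h3 := h.sum_sq_deviation_mulVec hrow n 0 v
    simp only [prodMat, Matrix.one_mulVec] at h3
    rw [← h3]
    refine Finset.sum_congr rfl fun i _ => ?_
    congr 1
    simp only [deviation, prodMat, Matrix.sub_mulVec, Matrix.one_mulVec, Pi.sub_apply]
    congr 1
    simp only [Matrix.mulVec, dotProduct, Matrix.of_apply, h.phi_eq_one hrow, Finset.sum_div]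
    exact Finset.sum_congr rfl fun j _ => by ring
  rw [h.sum_sq_deviation_mulVec hrow]
  have hκ1 := h.kappa_le_one ⟨0, hI⟩
  have hκ0 := h.compliant.pos
  have h4 : κ / (2 * (I : ℝ) ^ 2) ≤ 1 := by
    rw [div_le_one (by positivity)]
    nlinarith
  have h5 : (0 : ℝ) ≤ I * ((∑ j, v j) / I) ^ 2 := by positivity
  rw [h2] at h1
  nlinarith

end PushSum

end DoublyStochastic

/-! ### Weighted averages and perturbed consensus -/

section Consensus

variable {I : ℕ} {E : Type*} [NormedAddCommGroup E] [InnerProductSpace ℝ E]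

/-- The average of the vectors `v i` with weights `w i / I`. -/
noncomputable def wavg (w : Fin I → ℝ) (v : Fin I → E) : E := (I : ℝ)⁻¹ • ∑ i, w i • v i

lemma act_deviation_zero (W : ℕ → Matrix (Fin I) (Fin I) ℝ) (φ : ℕ → Fin I → ℝ) (n : ℕ)
    (v : Fin I → E) : act (deviation W φ n 0) v = fun i => v i - wavg (φ n) v := by
  funext i
  simp only [act, deviation, prodMat, Matrix.sub_apply, Matrix.of_apply, Matrix.one_apply, sub_smul,
    Finset.sum_sub_distrib, ite_smul, one_smul, zero_smul, Finset.sum_ite_eq, Finset.mem_univ,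
    if_true, wavg, Finset.smul_sum, smul_smul]
  congr 1
  exact Finset.sum_congr rfl fun j _ => by rw [div_eq_inv_mul]

lemma wavg_add (w : Fin I → ℝ) (v v' : Fin I → E) : wavg w (v + v') = wavg w v + wavg w v' := by
  simp [wavg, smul_add, Finset.sum_add_distrib]

lemma wavg_smul (w : Fin I → ℝ) (c : ℝ) (v : Fin I → E) : wavg w (c • v) = c • wavg w v := by
  simp only [wavg, Pi.smul_apply, Finset.smul_sum, smul_smul]
  exact Finset.sum_congr rfl fun i _ => by congr 1; ring

lemma wavg_eq_sum (w : Fin I → ℝ) (v : Fin I → E) : wavg w v = ∑ i, (w i / I) • v i := by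
  simp only [wavg, Finset.smul_sum, smul_smul, div_eq_inv_mul]

variable {W : ℕ → Matrix (Fin I) (Fin I) ℝ} {φ : ℕ → Fin I → ℝ}

lemma Mixing.wavg_act (hW : Mixing W φ) (n : ℕ) (v : Fin I → E) :
    wavg (φ (n + 1)) (act (W n) v) = wavg (φ n) v := by
  simp only [wavg, act, Finset.smul_sum, smul_smul]
  rw [Finset.sum_comm]
  refine Finset.sum_congr rfl fun j _ => ?_
  rw [← Finset.sum_smul, ← hW.transport n j, Finset.mul_sum]

lemma Mixing.norm_sq_wavg_le (hW : Mixing W φ) (n : ℕ) (v : Fin I → E) :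
    ‖wavg (φ n) v‖ ^ 2 ≤ (I : ℝ)⁻¹ * ∑ i, φ n i * ‖v i‖ ^ 2 := by
  rcases Nat.eq_zero_or_pos I with rfl | hI
  · simp [wavg]
  have hI0 : (0 : ℝ) < I := by exact_mod_cast hI
  have h1 : ‖∑ i, φ n i • v i‖ ^ 2 ≤ I * ∑ i, φ n i * ‖v i‖ ^ 2 := by
    have h2 : ‖∑ i, φ n i • v i‖ ≤ ∑ i, φ n i * ‖v i‖ := by
      refine (norm_sum_le _ _).trans (le_of_eq (Finset.sum_congr rfl fun i _ => ?_))
      rw [norm_smul, Real.norm_of_nonneg (hW.pos n i).le]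
    have h3 := Finset.sum_mul_sq_le_sq_mul_sq Finset.univ (fun i => √(φ n i))
      (fun i => √(φ n i) * ‖v i‖)
    have e1 : ∀ i, √(φ n i) * (√(φ n i) * ‖v i‖) = φ n i * ‖v i‖ := fun i => by
      rw [← mul_assoc, Real.mul_self_sqrt (hW.pos n i).le]
    have e2 : ∀ i, (√(φ n i) * ‖v i‖) ^ 2 = φ n i * ‖v i‖ ^ 2 := fun i => by
      rw [mul_pow, Real.sq_sqrt (hW.pos n i).le]
    simp only [e1, e2, Real.sq_sqrt (hW.pos n _).le, hW.mass] at h3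
    exact (pow_le_pow_left₀ (norm_nonneg _) h2 2).trans h3
  rw [wavg, norm_smul, mul_pow, norm_inv, Real.norm_of_nonneg hI0.le]
  have h4 := mul_le_mul_of_nonneg_left h1 (by positivity : (0 : ℝ) ≤ (I : ℝ)⁻¹ ^ 2)
  refine h4.trans (le_of_eq ?_)
  field_simp

lemma Mixing.norm_sq_wavg_le_stackNorm (hW : Mixing W φ) {ub : ℝ} (hub : ∀ n i, φ n i ≤ ub)
    (n : ℕ) (v : Fin I → E) : ‖wavg (φ n) v‖ ^ 2 ≤ ub / I * stackNorm v ^ 2 := by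
  refine (hW.norm_sq_wavg_le n v).trans ?_
  rw [div_eq_inv_mul, mul_assoc]
  refine mul_le_mul_of_nonneg_left ?_ (by positivity)
  rw [stackNorm, l2_sq, Finset.mul_sum]
  exact Finset.sum_le_sum fun i _ => mul_le_mul_of_nonneg_right (hub n i) (sq_nonneg _)

lemma Mixing.sqrt_mul_norm_wavg_le (hW : Mixing W φ) {ub : ℝ} (hub : ∀ n i, φ n i ≤ ub)
    (hub0 : 0 ≤ ub) (n : ℕ) (v : Fin I → E) : √I * ‖wavg (φ n) v‖ ≤ √ub * stackNorm v := by
  rcases Nat.eq_zero_or_pos I with rfl | hI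
  · simpa using mul_nonneg (Real.sqrt_nonneg ub) (stackNorm_nonneg (v := v))
  have hI0 : (0 : ℝ) < I := by exact_mod_cast hI
  refine le_of_sq_le_sq ?_ (mul_nonneg (Real.sqrt_nonneg ub) stackNorm_nonneg)
  rw [mul_pow, mul_pow, Real.sq_sqrt hI0.le, Real.sq_sqrt hub0]
  refine (mul_le_mul_of_nonneg_left (hW.norm_sq_wavg_le_stackNorm hub n v) hI0.le).trans
    (le_of_eq ?_)
  field_simp

/-- The disagreement of a consensus iteration with perturbations `p` before and `u` after the mixing
step. -/
lemma Mixing.disagreement_le (hW : Mixing W φ) {h : ℕ → ℝ} (hh : Antitone h)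
    (hdev : ∀ n s (v : Fin I → E), stackNorm (act (deviation W φ n s) v) ≤ h s * stackNorm v)
    {z p u : ℕ → Fin I → E} (hz : ∀ n, z (n + 1) = act (W n) (z n + p n) + u n) {d : ℕ → ℝ}
    (hh0 : ∀ s, 0 ≤ h s) (hd : ∀ n, stackNorm (p n) + stackNorm (u n) ≤ d n) (n : ℕ) :
    stackNorm (fun i => z n i - wavg (φ n) (z n))
      ≤ h n * stackNorm (z 0) + ∑ t ∈ Finset.range n, h (n - 1 - t) * d t := by
  have key : ∀ n s, stackNorm (act (deviation W φ n s) (z n))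
      ≤ h (n + s) * stackNorm (z 0) + ∑ t ∈ Finset.range n, h (n + s - 1 - t) * d t := by
    intro n
    induction n with
    | zero => intro s; simpa using hdev 0 s (z 0)
    | succ n ih =>
      intro s
      have e : act (deviation W φ (n + 1) s) (z (n + 1))
          = act (deviation W φ n (s + 1)) (z n) + act (deviation W φ n (s + 1)) (p n)
            + act (deviation W φ (n + 1) s) (u n) := by
        rw [hz, act_add, ← act_mul, ← hW.deviation_succ, act_add]
      rw [e, Finset.sum_range_succ]
      have h1 := ih (s + 1)
      have h2 := (hdev n (s + 1) (p n)).trans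
        (mul_le_mul_of_nonneg_right (hh s.le_succ) stackNorm_nonneg)
      have h3 := hdev (n + 1) s (u n)
      have h4 := mul_le_mul_of_nonneg_left (hd n) (hh0 s)
      have e1 : n + (s + 1) = n + 1 + s := by omega
      have e2 : n + 1 + s - 1 - n = s := by omega
      rw [e1] at h1
      rw [e2]
      refine (stackNorm_add_le _ _).trans ?_
      have h5 := stackNorm_add_le (act (deviation W φ n (s + 1)) (z n))
        (act (deviation W φ n (s + 1)) (p n))
      linarith
  have := key n 0
  rwa [act_deviation_zero, add_zero] at this

end Consensus

/-! ### Smooth and convex parts of the problem -/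

section Problem

variable {m I : ℕ} {K O : Set (Vec m)} {f : Fin I → Vec m → ℝ} {Gp Gm : Vec m → ℝ}
  {L : Fin I → ℝ≥0} {LG : ℝ≥0}

/-- The gradient of the smooth part `∑ i, f i - Gm` of the objective, written as a combination of
gradients. -/
noncomputable def smoothGrad (f : Fin I → Vec m → ℝ) (Gm : Vec m → ℝ) (x : Vec m) : Vec m :=
  ∑ i, gradient (f i) x - gradient Gm x

namespace ProblemAssumptions

lemma hasGradientAt_f (hP : ProblemAssumptions K O f Gp Gm L LG) (i : Fin I) {x : Vec m}
    (hx : x ∈ K) : HasGradientAt (f i) (gradient (f i) x) x :=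
  (((hP.f_C1 i).differentiableOn one_ne_zero).differentiableAt
    (hP.isOpen.mem_nhds (hP.subset hx))).hasGradientAt

lemma hasGradientAt_Gm (hP : ProblemAssumptions K O f Gp Gm L LG) {x : Vec m}
    (hx : x ∈ K) : HasGradientAt Gm (gradient Gm x) x :=
  ((hP.Gm_C1.differentiableOn one_ne_zero).differentiableAt
    (hP.isOpen.mem_nhds (hP.subset hx))).hasGradientAt

lemma hasGradientAt_sum (hP : ProblemAssumptions K O f Gp Gm L LG) {x : Vec m} (hx : x ∈ K) :
    HasGradientAt (fun w => ∑ i, f i w) (∑ i, gradient (f i) x) x := by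
  rw [hasGradientAt_iff_hasFDerivAt, map_sum]
  exact HasFDerivAt.fun_sum fun i _ => (hP.hasGradientAt_f i hx).hasFDerivAt

lemma hasGradientWithinAt_smooth (hP : ProblemAssumptions K O f Gp Gm L LG) {x : Vec m}
    (hx : x ∈ K) :
    HasGradientWithinAt (fun w => ∑ i, f i w - Gm w) (smoothGrad f Gm x) K x := by
  have h : HasGradientAt (fun w => ∑ i, f i w - Gm w) (smoothGrad f Gm x) x := by
    rw [hasGradientAt_iff_hasFDerivAt, smoothGrad, map_sub]
    exact (hP.hasGradientAt_sum hx).hasFDerivAt.fun_sub (hP.hasGradientAt_Gm hx).hasFDerivAt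
  exact h.hasFDerivAt.hasFDerivWithinAt

lemma norm_gradient_f_sub_le (hP : ProblemAssumptions K O f Gp Gm L LG) (i : Fin I) {x y : Vec m}
    (hx : x ∈ K) (hy : y ∈ K) : ‖gradient (f i) x - gradient (f i) y‖ ≤ L i * ‖x - y‖ := by
  simpa [dist_eq_norm] using (hP.f_lip i).dist_le_mul x hx y hy

lemma norm_gradient_Gm_sub_le (hP : ProblemAssumptions K O f Gp Gm L LG) {x y : Vec m}
    (hx : x ∈ K) (hy : y ∈ K) : ‖gradient Gm x - gradient Gm y‖ ≤ LG * ‖x - y‖ := by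
  simpa [dist_eq_norm] using hP.Gm_lip.dist_le_mul x hx y hy

lemma norm_smoothGrad_sub_le (hP : ProblemAssumptions K O f Gp Gm L LG) (x : Vec m) (hx : x ∈ K)
    (y : Vec m) (hy : y ∈ K) :
    ‖smoothGrad f Gm x - smoothGrad f Gm y‖ ≤ (LSum L + LG) * ‖x - y‖ := by
  have e : smoothGrad f Gm x - smoothGrad f Gm y
      = ∑ i, (gradient (f i) x - gradient (f i) y) - (gradient Gm x - gradient Gm y) := by
    rw [smoothGrad, smoothGrad, Finset.sum_sub_distrib]
    abel
  rw [e, LSum, add_mul, Finset.sum_mul]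
  refine (norm_sub_le _ _).trans (add_le_add ((norm_sum_le _ _).trans ?_)
    (hP.norm_gradient_Gm_sub_le hx hy))
  exact Finset.sum_le_sum fun i _ => hP.norm_gradient_f_sub_le i hx hy

lemma existsUnique_proxModel (hP : ProblemAssumptions K O f Gp Gm L LG) {v : Vec m} (hv : v ∈ K) :
    ∃! z, IsArgmin K (proxModel f Gp Gm v) z := by
  obtain ⟨z, hz, hmin⟩ := exists_prox_minimizer hP.closed hP.Gp_convex hP.Gp_lsc
    (gradient (fun w => ∑ i, f i w) v - gradient Gm v) hv
  exact ⟨z, ⟨hz, hmin⟩, fun z' hz' => prox_minimizer_unique hP.Gp_convex hz'.1 hz hz'.2 hmin⟩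

/-- The variational inequality of the proximal point. -/
lemma prox_variational (hP : ProblemAssumptions K O f Gp Gm L LG) {v : Vec m} (hv : v ∈ K) :
    proxPoint K f Gp Gm v ∈ K ∧ ∀ w ∈ K,
      0 ≤ ⟪smoothGrad f Gm v + (proxPoint K f Gp Gm v - v), w - proxPoint K f Gp Gm v⟫_ℝ
        + Gp w - Gp (proxPoint K f Gp Gm v) := by
  have hz : IsArgmin K (proxModel f Gp Gm v) (proxPoint K f Gp Gm v) :=
    Classical.epsilon_spec (hP.existsUnique_proxModel hv).exists
  generalize proxPoint K f Gp Gm v = z at hz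
  refine ⟨hz.1, fun w hw => ?_⟩
  have hgrad : gradient (fun w => ∑ i, f i w) v - gradient Gm v = smoothGrad f Gm v := by
    rw [smoothGrad, (hP.hasGradientAt_sum hv).gradient]
  refine variational_inequality (g := fun z => ⟪smoothGrad f Gm v, z - v⟫_ℝ + 1 / 2 * ‖z - v‖ ^ 2)
    hP.convex hz.1 (fun w hw => ?_) ?_ hP.Gp_convex hw
  · have := hz.2 w hw
    simp only [proxModel, hgrad] at this
    exact this
  · have h1 : HasFDerivAt (fun z => ⟪smoothGrad f Gm v, z - v⟫_ℝ)
        (innerSL ℝ (smoothGrad f Gm v)) z :=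
      (innerSL ℝ (smoothGrad f Gm v)).hasFDerivAt.comp z ((hasFDerivAt_id z).sub_const v)
    have h2 : HasFDerivAt (fun z : Vec m => 1 / 2 * ‖z - v‖ ^ 2) (innerSL ℝ (z - v)) z := by
      have h3 := (((hasFDerivAt_id z).sub_const v).norm_sq).const_mul (1 / 2 : ℝ)
      refine h3.congr_fderiv ?_
      ext w
      simp
    refine HasFDerivAt.hasFDerivWithinAt ((h1.add h2).congr_fderiv ?_)
    ext w
    simp

end ProblemAssumptions

end Problem

/-! ### Estimates along a run -/

/-- A sequence generated by SONATA under all the assumptions, with step-sizes in `(0, 1]` and with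
bounds `lb`, `ub` for the push-sum weights. -/
structure Run {m I : ℕ} (K O : Set (Vec m)) (f : Fin I → Vec m → ℝ) (Gp Gm : Vec m → ℝ)
    (L : Fin I → ℝ≥0) (LG : ℝ≥0) (𝒢 : ℕ → Digraph (Fin I)) (B : ℕ)
    (A : ℕ → Matrix (Fin I) (Fin I) ℝ) (κ : ℝ) (ft : Fin I → Vec m → Vec m → ℝ)
    (dft : Fin I → Vec m → Vec m → Vec m) (τ : Fin I → ℝ) (Lt : Fin I → ℝ≥0)
    (α : ℕ → ℝ) (φ : ℕ → Fin I → ℝ) (x xt y : ℕ → Fin I → Vec m) (lb ub : ℝ) : Prop where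
  size : 0 < I
  problem : ProblemAssumptions K O f Gp Gm L LG
  network : PushSum 𝒢 B A κ φ
  surrogate : SurrogateAssumptions K f ft dft τ Lt
  iteration : IsRun K f Gp Gm ft A α φ x xt y
  step : ∀ n, 0 < α n ∧ α n ≤ 1
  lb_pos : 0 < lb
  lb_le : ∀ n i, lb ≤ φ n i
  le_ub : ∀ n i, φ n i ≤ ub

namespace Run

variable {m I : ℕ} {K O : Set (Vec m)} {f : Fin I → Vec m → ℝ} {Gp Gm : Vec m → ℝ}
  {L : Fin I → ℝ≥0} {LG : ℝ≥0} {𝒢 : ℕ → Digraph (Fin I)} {B : ℕ}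
  {A : ℕ → Matrix (Fin I) (Fin I) ℝ} {κ : ℝ} {ft : Fin I → Vec m → Vec m → ℝ}
  {dft : Fin I → Vec m → Vec m → Vec m} {τ : Fin I → ℝ} {Lt : Fin I → ℝ≥0}
  {α : ℕ → ℝ} {φ : ℕ → Fin I → ℝ} {x xt y : ℕ → Fin I → Vec m} {lb ub : ℝ}

lemma ub_pos (h : Run K O f Gp Gm L LG 𝒢 B A κ ft dft τ Lt α φ x xt y lb ub) : 0 < ub :=
  h.lb_pos.trans_le ((h.lb_le 0 ⟨0, h.size⟩).trans (h.le_ub 0 ⟨0, h.size⟩))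

lemma size_pos (h : Run K O f Gp Gm L LG 𝒢 B A κ ft dft τ Lt α φ x xt y lb ub) : (0 : ℝ) < I := by
  exact_mod_cast h.size

lemma mixing (h : Run K O f Gp Gm L LG 𝒢 B A κ ft dft τ Lt α φ x xt y lb ub) :
    Mixing (pushSumMatrix A φ) φ := h.network.mixing

lemma x_succ (h : Run K O f Gp Gm L LG 𝒢 B A κ ft dft τ Lt α φ x xt y lb ub) (n : ℕ) :
    x (n + 1) = act (pushSumMatrix A φ n) (x n + α n • (xt n - x n)) := by
  funext i
  rw [h.iteration.x_step, act, Finset.smul_sum]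
  simp [pushSumMatrix, smul_smul, mul_assoc]

lemma y_succ (h : Run K O f Gp Gm L LG 𝒢 B A κ ft dft τ Lt α φ x xt y lb ub) (n : ℕ) :
    y (n + 1) = act (pushSumMatrix A φ n) (y n) + fun i => (φ (n + 1) i)⁻¹ •
      (gradient (f i) (x (n + 1) i) - gradient (f i) (x n i)) := by
  funext i
  rw [h.iteration.y_step, Pi.add_apply, act, Finset.smul_sum]
  simp [pushSumMatrix, smul_smul]

lemma xt_mem (h : Run K O f Gp Gm L LG 𝒢 B A κ ft dft τ Lt α φ x xt y lb ub) (n : ℕ) (i : Fin I) :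
    xt n i ∈ K := (h.iteration.local_opt n i).1

/-- The points `x n i + α n • (xt n i - x n i)` stay in the segment from `x n i` to `xt n i`. -/
lemma step_mem (h : Run K O f Gp Gm L LG 𝒢 B A κ ft dft τ Lt α φ x xt y lb ub) {n : ℕ}
    {i : Fin I} (hx : x n i ∈ K) : (x n + α n • (xt n - x n)) i ∈ K :=
  segment_mem h.problem.convex hx (h.xt_mem n i) ⟨(h.step n).1.le, (h.step n).2⟩

lemma x_mem (h : Run K O f Gp Gm L LG 𝒢 B A κ ft dft τ Lt α φ x xt y lb ub) (n : ℕ) (i : Fin I) :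
    x n i ∈ K := by
  induction n generalizing i with
  | zero => exact h.iteration.x_init i
  | succ n ih =>
    rw [h.x_succ]
    exact h.problem.convex.sum_mem (fun j _ => h.mixing.nonneg n i j) (h.mixing.row n i)
      fun j _ => h.step_mem (ih j)

lemma weight_sum (h : Run K O f Gp Gm L LG 𝒢 B A κ ft dft τ Lt α φ x xt y lb ub) (n : ℕ) :
    ∑ i, φ n i / I = 1 := by
  rw [← Finset.sum_div, h.network.mass, div_self h.size_pos.ne']

lemma xbar_mem (h : Run K O f Gp Gm L LG 𝒢 B A κ ft dft τ Lt α φ x xt y lb ub) (n : ℕ) :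
    wavg (φ n) (x n) ∈ K := by
  rw [wavg_eq_sum]
  exact h.problem.convex.sum_mem
    (fun i _ => div_nonneg (h.network.phi_nonneg n i) h.size_pos.le) (h.weight_sum n)
    fun i _ => h.x_mem n i

lemma avg_mem (h : Run K O f Gp Gm L LG 𝒢 B A κ ft dft τ Lt α φ x xt y lb ub) (n : ℕ) :
    avg (x n) ∈ K := by
  rw [avg, Finset.smul_sum]
  refine h.problem.convex.sum_mem (fun i _ => by positivity) ?_ fun i _ => h.x_mem n i
  simp [h.size_pos.ne']

lemma xbar_succ (h : Run K O f Gp Gm L LG 𝒢 B A κ ft dft τ Lt α φ x xt y lb ub) (n : ℕ) :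
    wavg (φ (n + 1)) (x (n + 1)) = wavg (φ n) (x n) + α n • wavg (φ n) (xt n - x n) := by
  rw [h.x_succ, h.mixing.wavg_act, wavg_add, wavg_smul]

/-- Gradient tracking: the weighted sum of the tracking variables is the sum of the local
gradients. -/
lemma tracking (h : Run K O f Gp Gm L LG 𝒢 B A κ ft dft τ Lt α φ x xt y lb ub) (n : ℕ) :
    (I : ℝ) • wavg (φ n) (y n) = ∑ i, gradient (f i) (x n i) := by
  induction n with
  | zero =>
    rw [wavg, smul_smul, mul_inv_cancel₀ h.size_pos.ne', one_smul]
    simp [h.iteration.phi_init, h.iteration.y_init]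
  | succ n ih =>
    rw [h.y_succ, wavg_add, h.mixing.wavg_act, smul_add, ih, wavg, smul_smul,
      mul_inv_cancel₀ h.size_pos.ne', one_smul]
    simp only [smul_smul, mul_inv_cancel₀ (h.network.phi_pos _ _).ne', one_smul]
    rw [Finset.sum_sub_distrib]
    abel

/-- The variational inequality of the local subproblems. -/
lemma local_variational (h : Run K O f Gp Gm L LG 𝒢 B A κ ft dft τ Lt α φ x xt y lb ub) (n : ℕ)
    (i : Fin I) {w : Vec m} (hw : w ∈ K) :
    0 ≤ ⟪dft i (xt n i) (x n i) - gradient Gm (x n i)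
        + ((I : ℝ) • y n i - gradient (f i) (x n i)), w - xt n i⟫_ℝ + Gp w - Gp (xt n i) := by
  have hz := h.iteration.local_opt n i
  refine variational_inequality (g := fun z => ft i z (x n i) - ⟪gradient Gm (x n i), z - x n i⟫_ℝ
    + ⟪(I : ℝ) • y n i - gradient (f i) (x n i), z - x n i⟫_ℝ)
    h.problem.convex hz.1 hz.2 ?_ h.problem.Gp_convex hw
  have hlin : ∀ p : Vec m, HasFDerivWithinAt (fun z => ⟪p, z - x n i⟫_ℝ) (innerSL ℝ p) K
      (xt n i) := fun p =>
    ((innerSL ℝ p).hasFDerivAt.comp (xt n i)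
      ((hasFDerivAt_id (xt n i)).sub_const (x n i))).hasFDerivWithinAt
  have h1 := (h.surrogate.hasGradient i _ hz.1 _ (h.x_mem n i)).hasFDerivWithinAt
  refine HasFDerivWithinAt.congr_fderiv ((h1.sub (hlin _)).add (hlin _)) ?_
  ext w
  simp only [add_apply, sub_apply,
    InnerProductSpace.toDual_apply_apply, innerSL_apply_apply, inner_add_left, inner_sub_left]

/-- The local steps are descent directions. -/
lemma local_descent (h : Run K O f Gp Gm L LG 𝒢 B A κ ft dft τ Lt α φ x xt y lb ub) (n : ℕ)
    (i : Fin I) : ⟪(I : ℝ) • y n i - gradient Gm (x n i), xt n i - x n i⟫_ℝ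
      + Gp (xt n i) - Gp (x n i) ≤ -(τ i * ‖xt n i - x n i‖ ^ 2) := by
  have h1 := h.local_variational n i (h.x_mem n i)
  have h2 := strongly_monotone_of_strongConvexOn (h.surrogate.strongConvex i _ (h.x_mem n i))
    (h.x_mem n i) (h.xt_mem n i)
    (h.surrogate.hasGradient i _ (h.x_mem n i) _ (h.x_mem n i))
    (h.surrogate.hasGradient i _ (h.xt_mem n i) _ (h.x_mem n i))
  rw [h.surrogate.consistent i _ (h.x_mem n i)] at h2
  rw [← neg_sub (xt n i) (x n i), inner_neg_right] at h1
  simp only [inner_add_left, inner_sub_left] at h1 h2 ⊢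
  linarith

lemma norm_dft_sub_le (h : Run K O f Gp Gm L LG 𝒢 B A κ ft dft τ Lt α φ x xt y lb ub) (i : Fin I)
    {a b c : Vec m} (ha : a ∈ K) (hb : b ∈ K) (hc : c ∈ K) :
    ‖dft i a b - dft i a c‖ ≤ Lt i * ‖b - c‖ := by
  simpa [dist_eq_norm] using (h.surrogate.lip i a ha).dist_le_mul b hb c hc

/-- The gradient of the surrogate at the solution differs little from the gradient at the base
point. The surrogate need not have a Lipschitz gradient in its first argument: the comparison passes
through the surrogate based at the solution, whose gradient there is the true one. -/
lemma norm_dft_sub_gradient_le (h : Run K O f Gp Gm L LG 𝒢 B A κ ft dft τ Lt α φ x xt y lb ub)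
    (n : ℕ) (i : Fin I) : ‖dft i (xt n i) (x n i) - gradient (f i) (x n i)‖
      ≤ (Lt i + L i) * ‖xt n i - x n i‖ := by
  have h1 := h.norm_dft_sub_le i (h.xt_mem n i) (h.x_mem n i) (h.xt_mem n i)
  rw [h.surrogate.consistent i _ (h.xt_mem n i), norm_sub_rev (x n i)] at h1
  have h2 := h.problem.norm_gradient_f_sub_le i (h.xt_mem n i) (h.x_mem n i)
  have h3 := norm_add_le (dft i (xt n i) (x n i) - gradient (f i) (xt n i))
    (gradient (f i) (xt n i) - gradient (f i) (x n i))
  rw [sub_add_sub_cancel] at h3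
  linarith

/-- The local solutions depend in a Lipschitz way on the local copies and tracking variables. -/
lemma norm_xt_sub_le (h : Run K O f Gp Gm L LG 𝒢 B A κ ft dft τ Lt α φ x xt y lb ub) (n : ℕ)
    (i : Fin I) : τ i * ‖xt (n + 1) i - xt n i‖
      ≤ (Lt i + L i + LG) * ‖x (n + 1) i - x n i‖ + I * ‖y (n + 1) i - y n i‖ := by
  have h1 := h.local_variational n i (h.xt_mem (n + 1) i)
  have h2 := h.local_variational (n + 1) i (h.xt_mem n i)
  have hx := h.x_mem n i
  have hx' := h.x_mem (n + 1) i
  have ht := h.xt_mem n i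
  have ht' := h.xt_mem (n + 1) i
  have h3 := strongly_monotone_of_strongConvexOn (h.surrogate.strongConvex i _ hx) ht ht'
    (h.surrogate.hasGradient i _ ht _ hx) (h.surrogate.hasGradient i _ ht' _ hx)
  have h4 := h.norm_dft_sub_le i ht' hx hx'
  have h5 := h.problem.norm_gradient_f_sub_le i hx hx'
  have h6 := h.problem.norm_gradient_Gm_sub_le hx hx'
  rw [norm_sub_rev (x n i)] at h4 h5 h6
  rw [← neg_sub (xt (n + 1) i) (xt n i), inner_neg_right] at h2
  obtain ⟨e, he⟩ : ∃ e, e = xt (n + 1) i - xt n i := ⟨_, rfl⟩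
  rw [← he] at h1 h2 h3 ⊢
  have h7 : τ i * ‖e‖ ^ 2 ≤ ⟪(dft i (xt (n + 1) i) (x n i) - dft i (xt (n + 1) i) (x (n + 1) i))
      - (gradient (f i) (x n i) - gradient (f i) (x (n + 1) i))
      - (gradient Gm (x n i) - gradient Gm (x (n + 1) i))
      - (I : ℝ) • (y (n + 1) i - y n i), e⟫_ℝ := by
    simp only [inner_add_left, inner_sub_left, smul_sub] at h1 h2 h3 ⊢
    linarith
  have h8 := real_inner_le_norm ((dft i (xt (n + 1) i) (x n i) - dft i (xt (n + 1) i) (x (n + 1) i))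
      - (gradient (f i) (x n i) - gradient (f i) (x (n + 1) i))
      - (gradient Gm (x n i) - gradient Gm (x (n + 1) i))
      - (I : ℝ) • (y (n + 1) i - y n i)) e
  have h9 : ‖(dft i (xt (n + 1) i) (x n i) - dft i (xt (n + 1) i) (x (n + 1) i))
      - (gradient (f i) (x n i) - gradient (f i) (x (n + 1) i))
      - (gradient Gm (x n i) - gradient Gm (x (n + 1) i))
      - (I : ℝ) • (y (n + 1) i - y n i)‖
      ≤ (Lt i + L i + LG) * ‖x (n + 1) i - x n i‖ + I * ‖y (n + 1) i - y n i‖ := by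
    refine (norm_sub_le _ _).trans ?_
    refine (add_le_add_left ((norm_sub_le _ _).trans (add_le_add_left (norm_sub_le _ _) _)) _).trans ?_
    rw [norm_smul, Real.norm_of_nonneg h.size_pos.le]
    linarith
  have h10 := h7.trans (h8.trans (mul_le_mul_of_nonneg_right h9 (norm_nonneg e)))
  rcases eq_or_lt_of_le (norm_nonneg e) with h0 | h0
  · rw [← h0, mul_zero]
    positivity
  · refine le_of_mul_le_mul_right ?_ h0
    linarith

end Run

/-- The distance of the vectors `z n i` from their average with weights `φ n`. -/
noncomputable def disagreement {m I : ℕ} (φ : ℕ → Fin I → ℝ) (z : ℕ → Fin I → Vec m) (n : ℕ) : ℝ :=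
  stackNorm fun i => z n i - wavg (φ n) (z n)

section

variable {m I : ℕ}

lemma stackNorm_succ_sub_le (φ : ℕ → Fin I → ℝ) (z : ℕ → Fin I → Vec m) (n : ℕ) :
    stackNorm (z (n + 1) - z n) ≤ disagreement φ z (n + 1) + disagreement φ z n
      + √I * ‖wavg (φ (n + 1)) (z (n + 1)) - wavg (φ n) (z n)‖ := by
  rw [← stackNorm_const, disagreement, disagreement]
  have e : z (n + 1) - z n = ((fun i => z (n + 1) i - wavg (φ (n + 1)) (z (n + 1)))
      - fun i => z n i - wavg (φ n) (z n))
      + fun _ => wavg (φ (n + 1)) (z (n + 1)) - wavg (φ n) (z n) := by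
    funext i
    simp only [Pi.sub_apply, Pi.add_apply]
    abel
  rw [e]
  exact (stackNorm_add_le _ _).trans (add_le_add_left (stackNorm_sub_le _ _) _)

lemma norm_sub_wavg_le_disagreement (φ : ℕ → Fin I → ℝ) (z : ℕ → Fin I → Vec m) (n : ℕ)
    (i : Fin I) : ‖z n i - wavg (φ n) (z n)‖ ≤ disagreement φ z n :=
  norm_le_stackNorm (fun i => z n i - wavg (φ n) (z n)) i

lemma disagreement_nonneg (φ : ℕ → Fin I → ℝ) (z : ℕ → Fin I → Vec m) (n : ℕ) :
    0 ≤ disagreement φ z n := stackNorm_nonneg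

lemma le_LMax (L : Fin I → ℝ≥0) (i : Fin I) : (L i : ℝ) ≤ LMax L :=
  le_ciSup (f := fun i => (L i : ℝ)) (Set.finite_range _).bddAbove i

lemma LMax_nonneg (L : Fin I → ℝ≥0) : 0 ≤ LMax L :=
  Real.iSup_nonneg fun i => (L i).2

lemma LSum_nonneg (L : Fin I → ℝ≥0) : 0 ≤ LSum L := Finset.sum_nonneg fun i _ => (L i).2

lemma cTau_le (τ : Fin I → ℝ) (i : Fin I) : cTau τ ≤ τ i :=
  ciInf_le (Set.finite_range _).bddBelow i

lemma cTau_pos (hI : 0 < I) {τ : Fin I → ℝ} (hτ : ∀ i, 0 < τ i) : 0 < cTau τ := by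
  have : Nonempty (Fin I) := ⟨⟨0, hI⟩⟩
  obtain ⟨i, hi⟩ := exists_eq_ciInf_of_finite (f := τ)
  rw [cTau, ← hi]
  exact hτ i

end

namespace Run

variable {m I : ℕ} {K O : Set (Vec m)} {f : Fin I → Vec m → ℝ} {Gp Gm : Vec m → ℝ}
  {L : Fin I → ℝ≥0} {LG : ℝ≥0} {𝒢 : ℕ → Digraph (Fin I)} {B : ℕ}
  {A : ℕ → Matrix (Fin I) (Fin I) ℝ} {κ : ℝ} {ft : Fin I → Vec m → Vec m → ℝ}
  {dft : Fin I → Vec m → Vec m → Vec m} {τ : Fin I → ℝ} {Lt : Fin I → ℝ≥0}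
  {α : ℕ → ℝ} {φ : ℕ → Fin I → ℝ} {x xt y : ℕ → Fin I → Vec m} {lb ub : ℝ}

lemma stackNorm_x_succ_sub_le
    (h : Run K O f Gp Gm L LG 𝒢 B A κ ft dft τ Lt α φ x xt y lb ub) (n : ℕ) :
    stackNorm (x (n + 1) - x n) ≤ disagreement φ x (n + 1) + disagreement φ x n
      + √ub * (α n * stackNorm (xt n - x n)) := by
  refine (stackNorm_succ_sub_le φ x n).trans (add_le_add_right ?_ _)
  rw [h.xbar_succ, add_sub_cancel_left, ← wavg_smul, ← stackNorm_smul (h.step n).1.le]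
  exact h.mixing.sqrt_mul_norm_wavg_le h.le_ub h.ub_pos.le n _

lemma stackNorm_gradient_sub_le
    (h : Run K O f Gp Gm L LG 𝒢 B A κ ft dft τ Lt α φ x xt y lb ub) (n : ℕ) :
    stackNorm (fun i => gradient (f i) (x (n + 1) i) - gradient (f i) (x n i))
      ≤ LMax L * stackNorm (x (n + 1) - x n) :=
  stackNorm_mono (LMax_nonneg L) fun i =>
    (h.problem.norm_gradient_f_sub_le i (h.x_mem _ i) (h.x_mem _ i)).trans
      (mul_le_mul_of_nonneg_right (le_LMax L i) (norm_nonneg _))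

lemma stackNorm_tracking_input_le
    (h : Run K O f Gp Gm L LG 𝒢 B A κ ft dft τ Lt α φ x xt y lb ub) (n : ℕ) :
    stackNorm (fun i => (φ (n + 1) i)⁻¹ •
      (gradient (f i) (x (n + 1) i) - gradient (f i) (x n i)))
      ≤ LMax L / lb * (disagreement φ x (n + 1) + disagreement φ x n
        + √ub * (α n * stackNorm (xt n - x n))) := by
  have h1 : stackNorm (fun i => (φ (n + 1) i)⁻¹ •
      (gradient (f i) (x (n + 1) i) - gradient (f i) (x n i)))
      ≤ lb⁻¹ * stackNorm (fun i => gradient (f i) (x (n + 1) i) - gradient (f i) (x n i)) := by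
    refine stackNorm_mono (inv_nonneg.2 h.lb_pos.le) fun i => ?_
    rw [norm_smul, norm_inv, Real.norm_of_nonneg (h.network.phi_nonneg _ _)]
    exact mul_le_mul_of_nonneg_right (inv_anti₀ h.lb_pos (h.lb_le _ _)) (norm_nonneg _)
  refine h1.trans ((mul_le_mul_of_nonneg_left ((h.stackNorm_gradient_sub_le n).trans
    (mul_le_mul_of_nonneg_left (h.stackNorm_x_succ_sub_le n) (LMax_nonneg L)))
    (inv_nonneg.2 h.lb_pos.le)).trans (le_of_eq ?_))
  rw [div_eq_inv_mul, mul_assoc]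

lemma stackNorm_y_succ_sub_le
    (h : Run K O f Gp Gm L LG 𝒢 B A κ ft dft τ Lt α φ x xt y lb ub) (n : ℕ) :
    stackNorm (y (n + 1) - y n) ≤ disagreement φ y (n + 1) + disagreement φ y n
      + LMax L * stackNorm (x (n + 1) - x n) := by
  refine (stackNorm_succ_sub_le φ y n).trans (add_le_add_right ?_ _)
  have h1 : (I : ℝ) * ‖wavg (φ (n + 1)) (y (n + 1)) - wavg (φ n) (y n)‖
      ≤ √I * (LMax L * stackNorm (x (n + 1) - x n)) := by
    have e : (I : ℝ) * ‖wavg (φ (n + 1)) (y (n + 1)) - wavg (φ n) (y n)‖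
        = ‖∑ i, (gradient (f i) (x (n + 1) i) - gradient (f i) (x n i))‖ := by
      rw [Finset.sum_sub_distrib, ← h.tracking, ← h.tracking, ← smul_sub, norm_smul,
        Real.norm_of_nonneg h.size_pos.le]
    rw [e]
    refine (norm_sum_le _ _).trans ((sum_norm_le_stackNorm _).trans ?_)
    exact mul_le_mul_of_nonneg_left (h.stackNorm_gradient_sub_le n) (Real.sqrt_nonneg _)
  have h2 : (0 : ℝ) < √I := Real.sqrt_pos.2 h.size_pos
  refine le_of_mul_le_mul_left ?_ h2
  rwa [← mul_assoc, Real.mul_self_sqrt h.size_pos.le]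

/-- The lengths of the local steps vary slowly. -/
lemma exists_step_growth (h : Run K O f Gp Gm L LG 𝒢 B A κ ft dft τ Lt α φ x xt y lb ub) :
    ∃ C, 0 ≤ C ∧ ∀ n, stackNorm (xt (n + 1) - x (n + 1)) ≤ stackNorm (xt n - x n)
      + C * (disagreement φ x n + disagreement φ x (n + 1) + disagreement φ y n
        + disagreement φ y (n + 1) + α n * stackNorm (xt n - x n)) := by
  obtain ⟨C₁, hC₁⟩ := Finite.exists_le fun i => (τ i)⁻¹ * (Lt i + L i + LG) + 1
  obtain ⟨C₂, hC₂⟩ := Finite.exists_le fun i => (τ i)⁻¹ * (I : ℝ)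
  have hτ := h.surrogate.tau_pos
  have hC₁0 : 0 ≤ C₁ := by
    refine le_trans ?_ (hC₁ ⟨0, h.size⟩)
    have := hτ ⟨0, h.size⟩
    positivity
  have hC₂0 : 0 ≤ C₂ := by
    refine le_trans ?_ (hC₂ ⟨0, h.size⟩)
    have := hτ ⟨0, h.size⟩
    positivity
  have hL := LMax_nonneg L
  have hmain : ∀ n, stackNorm (xt (n + 1) - x (n + 1)) ≤ stackNorm (xt n - x n)
      + (C₁ * stackNorm (x (n + 1) - x n) + C₂ * stackNorm (y (n + 1) - y n)) := by
    intro n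
    have e : xt (n + 1) - x (n + 1)
        = (xt n - x n) + ((xt (n + 1) - x (n + 1)) - (xt n - x n)) := by abel
    rw [e]
    refine (stackNorm_add_le _ _).trans (add_le_add_right ?_ _)
    have h1 : ∀ i, ‖((xt (n + 1) - x (n + 1)) - (xt n - x n)) i‖
        ≤ C₁ * ‖(x (n + 1) - x n) i‖ + C₂ * ‖(y (n + 1) - y n) i‖ := by
      intro i
      simp only [Pi.sub_apply]
      have h2 := h.norm_xt_sub_le n i
      have h3 := mul_le_mul_of_nonneg_left h2 (inv_nonneg.2 (hτ i).le)
      rw [inv_mul_cancel_left₀ (hτ i).ne', mul_add, ← mul_assoc, ← mul_assoc] at h3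
      have e2 : xt (n + 1) i - x (n + 1) i - (xt n i - x n i)
          = (xt (n + 1) i - xt n i) - (x (n + 1) i - x n i) := by abel
      rw [e2]
      have h4 := norm_sub_le (xt (n + 1) i - xt n i) (x (n + 1) i - x n i)
      have h5 := mul_le_mul_of_nonneg_right (hC₁ i) (norm_nonneg (x (n + 1) i - x n i))
      have h6 := mul_le_mul_of_nonneg_right (hC₂ i) (norm_nonneg (y (n + 1) i - y n i))
      linarith
    refine (l2_mono (fun i _ => norm_nonneg _) fun i _ => h1 i).trans (l2_add_le.trans ?_)
    rw [l2_const_mul hC₁0, l2_const_mul hC₂0]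
    exact le_rfl
  obtain ⟨C₃, hC₃⟩ : ∃ C₃, C₃ = C₁ + C₂ * LMax L := ⟨_, rfl⟩
  have hC₃0 : 0 ≤ C₃ := by rw [hC₃]; positivity
  refine ⟨C₃ * (1 + √ub) + C₂, by positivity, fun n => (hmain n).trans (add_le_add_right ?_ _)⟩
  have h1 := h.stackNorm_x_succ_sub_le n
  have h2 := mul_le_mul_of_nonneg_left (h.stackNorm_y_succ_sub_le n) hC₂0
  have h3 := mul_le_mul_of_nonneg_left h1 hC₃0
  have d1 := disagreement_nonneg φ x n
  have d2 := disagreement_nonneg φ x (n + 1)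
  have d3 := disagreement_nonneg φ y n
  have d4 := disagreement_nonneg φ y (n + 1)
  have d5 : 0 ≤ α n * stackNorm (xt n - x n) := mul_nonneg (h.step n).1.le stackNorm_nonneg
  have hs := Real.sqrt_nonneg ub
  generalize disagreement φ x n = a1 at *
  generalize disagreement φ x (n + 1) = a2 at *
  generalize disagreement φ y n = a3 at *
  generalize disagreement φ y (n + 1) = a4 at *
  generalize α n * stackNorm (xt n - x n) = a5 at *
  generalize stackNorm (x (n + 1) - x n) = b1 at *
  generalize stackNorm (y (n + 1) - y n) = b2 at *
  generalize √ub = s at *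
  have h4 : C₁ * b1 + C₂ * b2 ≤ C₃ * (a2 + a1 + s * a5) + C₂ * (a4 + a3) := by
    rw [hC₃] at h3 ⊢
    linarith
  have h5 : 0 ≤ C₃ * (s * (a1 + a2 + a3 + a4) + a3 + a4 + a5) + C₂ * (a1 + a2 + a5) := by positivity
  linarith

/-! ### Descent of the objective -/

/-- The smooth part of the objective at the weighted average, plus the weighted average of the
convex part. The latter is not evaluated at the average because it need not be Lipschitz; by Jensen's
inequality the sum still dominates the objective. -/
noncomputable def lyapunov (f : Fin I → Vec m → ℝ) (Gp Gm : Vec m → ℝ) (φ : ℕ → Fin I → ℝ)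
    (x : ℕ → Fin I → Vec m) (n : ℕ) : ℝ :=
  (∑ i, f i (wavg (φ n) (x n)) - Gm (wavg (φ n) (x n))) + ∑ i, φ n i / I * Gp (x n i)

lemma exists_lyapunov_lower_bound
    (h : Run K O f Gp Gm L LG 𝒢 B A κ ft dft τ Lt α φ x xt y lb ub) :
    ∃ b, ∀ n, b ≤ lyapunov f Gp Gm φ x n := by
  obtain ⟨b, hb⟩ := h.problem.bddBelow
  refine ⟨b, fun n => ?_⟩
  have h1 := hb (Set.mem_image_of_mem _ (h.xbar_mem n))
  have h2 := h.problem.Gp_convex.map_sum_le (t := Finset.univ) (w := fun i => φ n i / I) (p := x n)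
    (fun i _ => div_nonneg (h.network.phi_nonneg n i) h.size_pos.le) (h.weight_sum n)
    fun i _ => h.x_mem n i
  rw [← wavg_eq_sum] at h2
  simp only [smul_eq_mul] at h1 h2
  rw [lyapunov]
  linarith

lemma convex_part_descent (h : Run K O f Gp Gm L LG 𝒢 B A κ ft dft τ Lt α φ x xt y lb ub)
    (n : ℕ) : ∑ i, φ (n + 1) i / I * Gp (x (n + 1) i)
      ≤ ∑ i, φ n i / I * (Gp (x n i) + α n * (Gp (xt n i) - Gp (x n i))) := by
  have hW := h.mixing
  have h1 : ∀ i, Gp (x (n + 1) i)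
      ≤ ∑ j, pushSumMatrix A φ n i j * (Gp (x n j) + α n * (Gp (xt n j) - Gp (x n j))) := by
    intro i
    rw [h.x_succ]
    refine (h.problem.Gp_convex.map_sum_le (t := Finset.univ) (fun j _ => hW.nonneg n i j)
      (hW.row n i) fun j _ => h.step_mem (h.x_mem n j)).trans ?_
    refine Finset.sum_le_sum fun j _ => mul_le_mul_of_nonneg_left ?_ (hW.nonneg n i j)
    have h2 := h.problem.Gp_convex.2 (h.x_mem n j) (h.xt_mem n j)
      (by linarith [(h.step n).2] : 0 ≤ 1 - α n) (h.step n).1.le (by ring)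
    have e : (1 - α n) • x n j + α n • xt n j = (x n + α n • (xt n - x n)) j := by
      simp only [Pi.add_apply, Pi.smul_apply, Pi.sub_apply]
      module
    rw [e] at h2
    simp only [smul_eq_mul] at h2
    linarith
  refine (Finset.sum_le_sum fun i _ => mul_le_mul_of_nonneg_left (h1 i)
    (div_nonneg (h.network.phi_nonneg (n + 1) i) h.size_pos.le)).trans (le_of_eq ?_)
  simp only [Finset.mul_sum]
  rw [Finset.sum_comm]
  refine Finset.sum_congr rfl fun j _ => ?_
  rw [← hW.transport n j, Finset.sum_div, Finset.sum_mul]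
  exact Finset.sum_congr rfl fun i _ => by ring

/-- The direction used by an agent differs from the gradient of the smooth part at the average by
the consensus and tracking errors. -/
lemma norm_direction_error_le (h : Run K O f Gp Gm L LG 𝒢 B A κ ft dft τ Lt α φ x xt y lb ub)
    (n : ℕ) (i : Fin I) {v : Vec m} (hv : v ∈ K) {d : ℝ} (hd : ∀ j, ‖v - x n j‖ ≤ d) :
    ‖smoothGrad f Gm v - ((I : ℝ) • y n i - gradient Gm (x n i))‖
      ≤ LSum L * d + LG * ‖x n i - v‖ + I * ‖y n i - wavg (φ n) (y n)‖ := by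
  have e : smoothGrad f Gm v - ((I : ℝ) • y n i - gradient Gm (x n i))
      = ∑ j, (gradient (f j) v - gradient (f j) (x n j)) + (gradient Gm (x n i) - gradient Gm v)
        - (I : ℝ) • (y n i - wavg (φ n) (y n)) := by
    rw [Finset.sum_sub_distrib, smul_sub, h.tracking, smoothGrad]
    abel
  rw [e]
  refine (norm_sub_le _ _).trans (add_le_add ((norm_add_le _ _).trans (add_le_add ?_
    (h.problem.norm_gradient_Gm_sub_le (h.x_mem n i) hv))) ?_)
  · rw [LSum, Finset.sum_mul]
    refine (norm_sum_le _ _).trans (Finset.sum_le_sum fun j _ => ?_)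
    exact (h.problem.norm_gradient_f_sub_le j hv (h.x_mem n j)).trans
      (mul_le_mul_of_nonneg_left (hd j) (L j).2)
  · rw [norm_smul, Real.norm_of_nonneg h.size_pos.le]

lemma sum_direction_error_le (h : Run K O f Gp Gm L LG 𝒢 B A κ ft dft τ Lt α φ x xt y lb ub)
    (n : ℕ) : ∑ i, φ n i * ⟪smoothGrad f Gm (wavg (φ n) (x n))
        - ((I : ℝ) • y n i - gradient Gm (x n i)), xt n i - x n i⟫_ℝ
      ≤ ub * (((LSum L * √I + LG) * disagreement φ x n + I * disagreement φ y n)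
        * stackNorm (xt n - x n)) := by
  have hL := LSum_nonneg L
  have hex := disagreement_nonneg φ x n
  have h1 : ∀ i, φ n i * ⟪smoothGrad f Gm (wavg (φ n) (x n))
        - ((I : ℝ) • y n i - gradient Gm (x n i)), xt n i - x n i⟫_ℝ
      ≤ ub * (LSum L * disagreement φ x n * ‖(xt n - x n) i‖
        + LG * (‖x n i - wavg (φ n) (x n)‖ * ‖(xt n - x n) i‖)
        + I * (‖y n i - wavg (φ n) (y n)‖ * ‖(xt n - x n) i‖)) := by
    intro i
    have h2 := h.norm_direction_error_le n i (h.xbar_mem n) (d := disagreement φ x n) fun j => by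
      rw [norm_sub_rev]
      exact norm_sub_wavg_le_disagreement φ x n j
    have h3 := (real_inner_le_norm (smoothGrad f Gm (wavg (φ n) (x n))
      - ((I : ℝ) • y n i - gradient Gm (x n i))) (xt n i - x n i)).trans
      (mul_le_mul_of_nonneg_right h2 (norm_nonneg _))
    refine (mul_le_mul_of_nonneg_left h3 (h.network.phi_nonneg n i)).trans ?_
    refine (mul_le_mul_of_nonneg_right (h.le_ub n i) (by positivity)).trans (le_of_eq ?_)
    rw [Pi.sub_apply]
    ring
  refine (Finset.sum_le_sum fun i _ => h1 i).trans ?_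
  rw [← Finset.mul_sum]
  refine mul_le_mul_of_nonneg_left ?_ h.ub_pos.le
  rw [Finset.sum_add_distrib, Finset.sum_add_distrib, ← Finset.mul_sum, ← Finset.mul_sum,
    ← Finset.mul_sum]
  have h4 := mul_le_mul_of_nonneg_left (sum_norm_le_stackNorm (xt n - x n)) (mul_nonneg hL hex)
  have h5 : ∑ i, ‖x n i - wavg (φ n) (x n)‖ * ‖(xt n - x n) i‖
      ≤ disagreement φ x n * stackNorm (xt n - x n) := sum_mul_le_l2
  have h6 : ∑ i, ‖y n i - wavg (φ n) (y n)‖ * ‖(xt n - x n) i‖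
      ≤ disagreement φ y n * stackNorm (xt n - x n) := sum_mul_le_l2
  have h7 := mul_le_mul_of_nonneg_left h5 LG.2
  have h8 := mul_le_mul_of_nonneg_left h6 h.size_pos.le
  simp only [NNReal.val_eq_coe] at h7
  linarith

/-- Descent of the Lyapunov function, up to the consensus and tracking errors. -/
lemma lyapunov_succ_le (h : Run K O f Gp Gm L LG 𝒢 B A κ ft dft τ Lt α φ x xt y lb ub) (n : ℕ) :
    lyapunov f Gp Gm φ x (n + 1) ≤ lyapunov f Gp Gm φ x n
      - cTau τ * lb / I * (α n * stackNorm (xt n - x n) ^ 2)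
      + (LSum L + LG) * ub / (2 * I) * (α n * stackNorm (xt n - x n)) ^ 2
      + ub * (((LSum L * √I + LG) / I * disagreement φ x n + disagreement φ y n)
        * (α n * stackNorm (xt n - x n))) := by
  have hI := h.size_pos
  have hα := (h.step n).1
  have hg := descent_inequality h.problem.convex
    (fun x hx => h.problem.hasGradientWithinAt_smooth hx) h.problem.norm_smoothGrad_sub_le
    (h.xbar_mem n) (h.xbar_mem (n + 1))
  have hstep : wavg (φ (n + 1)) (x (n + 1)) - wavg (φ n) (x n)
      = α n • wavg (φ n) (xt n - x n) := by rw [h.xbar_succ, add_sub_cancel_left]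
  rw [hstep, real_inner_smul_right, norm_smul, Real.norm_of_nonneg hα.le] at hg
  have hquad : (LSum L + LG) / 2 * (α n * ‖wavg (φ n) (xt n - x n)‖) ^ 2
      ≤ (LSum L + LG) * ub / (2 * I) * (α n * stackNorm (xt n - x n)) ^ 2 := by
    have h1 := h.mixing.norm_sq_wavg_le_stackNorm h.le_ub n (xt n - x n)
    have h2 : 0 ≤ (LSum L + LG) / 2 * α n ^ 2 := by
      have := LSum_nonneg L
      positivity
    have h3 := mul_le_mul_of_nonneg_left h1 h2
    refine (le_of_eq ?_).trans (h3.trans (le_of_eq ?_))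
    · ring
    · field_simp
  have hinner : ⟪smoothGrad f Gm (wavg (φ n) (x n)), wavg (φ n) (xt n - x n)⟫_ℝ
      = (I : ℝ)⁻¹ * ∑ i, φ n i * ⟪smoothGrad f Gm (wavg (φ n) (x n)), xt n i - x n i⟫_ℝ := by
    rw [wavg, wavg, real_inner_smul_right, inner_sum]
    simp only [real_inner_smul_right, Pi.sub_apply]
  have hlocal : ∑ i, φ n i * (⟪(I : ℝ) • y n i - gradient Gm (x n i), xt n i - x n i⟫_ℝ
      + Gp (xt n i) - Gp (x n i)) ≤ -(cTau τ * lb * stackNorm (xt n - x n) ^ 2) := by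
    rw [stackNorm, l2_sq, Finset.mul_sum, ← Finset.sum_neg_distrib]
    refine Finset.sum_le_sum fun i _ => ?_
    refine (mul_le_mul_of_nonneg_left (h.local_descent n i) (h.network.phi_nonneg n i)).trans ?_
    rw [mul_neg, neg_le_neg_iff, ← mul_assoc, mul_comm (cTau τ)]
    exact mul_le_mul_of_nonneg_right (mul_le_mul (h.lb_le n i) (cTau_le τ i)
      (cTau_pos h.size h.surrogate.tau_pos).le (h.network.phi_nonneg n i)) (sq_nonneg _)
  have herr := h.sum_direction_error_le n
  have hconv := h.convex_part_descent n
  have hsplit : ∑ i, φ n i / I * (Gp (x n i) + α n * (Gp (xt n i) - Gp (x n i)))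
      = ∑ i, φ n i / I * Gp (x n i)
        + α n * (I : ℝ)⁻¹ * ∑ i, φ n i * (Gp (xt n i) - Gp (x n i)) := by
    rw [Finset.mul_sum, ← Finset.sum_add_distrib]
    exact Finset.sum_congr rfl fun i _ => by ring
  have hcomb : ∑ i, φ n i * ⟪smoothGrad f Gm (wavg (φ n) (x n)), xt n i - x n i⟫_ℝ
      + ∑ i, φ n i * (Gp (xt n i) - Gp (x n i))
      = ∑ i, φ n i * ⟪smoothGrad f Gm (wavg (φ n) (x n))
        - ((I : ℝ) • y n i - gradient Gm (x n i)), xt n i - x n i⟫_ℝ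
        + ∑ i, φ n i * (⟪(I : ℝ) • y n i - gradient Gm (x n i), xt n i - x n i⟫_ℝ
          + Gp (xt n i) - Gp (x n i)) := by
    rw [← Finset.sum_add_distrib, ← Finset.sum_add_distrib]
    refine Finset.sum_congr rfl fun i _ => ?_
    rw [inner_sub_left]
    ring
  have hαI : 0 ≤ α n * (I : ℝ)⁻¹ := by positivity
  have hfinal := mul_le_mul_of_nonneg_left (add_le_add herr hlocal) hαI
  rw [← hcomb] at hfinal
  rw [hinner] at hg
  rw [lyapunov, lyapunov]
  rw [hsplit] at hconv
  have e : α n * (I : ℝ)⁻¹ * (ub * (((LSum L * √I + LG) * disagreement φ x n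
        + I * disagreement φ y n) * stackNorm (xt n - x n))
        + -(cTau τ * lb * stackNorm (xt n - x n) ^ 2))
      = ub * (((LSum L * √I + LG) / I * disagreement φ x n + disagreement φ y n)
        * (α n * stackNorm (xt n - x n)))
        - cTau τ * lb / I * (α n * stackNorm (xt n - x n) ^ 2) := by
    field_simp
    ring
  rw [e] at hfinal
  linarith

end Run

/-! ### Convergence -/

namespace Run

variable {m I : ℕ} {K O : Set (Vec m)} {f : Fin I → Vec m → ℝ} {Gp Gm : Vec m → ℝ}
  {L : Fin I → ℝ≥0} {LG : ℝ≥0} {𝒢 : ℕ → Digraph (Fin I)} {B : ℕ}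
  {A : ℕ → Matrix (Fin I) (Fin I) ℝ} {κ : ℝ} {ft : Fin I → Vec m → Vec m → ℝ}
  {dft : Fin I → Vec m → Vec m → Vec m} {τ : Fin I → ℝ} {Lt : Fin I → ℝ≥0}
  {α : ℕ → ℝ} {φ : ℕ → Fin I → ℝ} {x xt y : ℕ → Fin I → Vec m} {lb ub : ℝ}

/-- If disagreements decay like `c * ρ ^ (s / b)`, so that the total gain of the network is
`X = c * b / (1 - ρ)`, and the step-sizes are eventually small relative to this gain, then the local
steps and the consensus and tracking errors vanish. -/
lemma errors_tendsto_zero (h : Run K O f Gp Gm L LG 𝒢 B A κ ft dft τ Lt α φ x xt y lb ub)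
    {c ρ X ε : ℝ} {b : ℕ} (hb : 0 < b) (hρ0 : 0 ≤ ρ) (hρ1 : ρ < 1) (hc : 0 ≤ c)
    (hdev : ∀ n s (v : Fin I → Vec m),
      stackNorm (act (deviation (pushSumMatrix A φ) φ n s) v) ≤ c * ρ ^ (s / b) * stackNorm v)
    (hdiv : ¬ Summable α) (hε : 0 < ε) (hX : X = c * (b / (1 - ρ)))
    (hsmall : ∀ᶠ n in atTop, α n * ((LSum L + LG) * ub / (2 * I)
      + ub * ((LSum L * √I + LG) / I * X + LMax L / lb * X * (2 * X + √ub)))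
        ≤ cTau τ * lb / I - ε) :
    Tendsto (fun n => stackNorm (xt n - x n)) atTop (𝓝 0) ∧
      Tendsto (disagreement φ x) atTop (𝓝 0) ∧ Tendsto (disagreement φ y) atTop (𝓝 0) := by
  obtain ⟨r, G, hr0, hr1, hG0, hG⟩ := exists_geometric_bound hb hρ0 hρ1
  obtain ⟨C, hC0, hC⟩ := h.exists_step_growth
  obtain ⟨lo, hlo⟩ := h.exists_lyapunov_lower_bound
  obtain ⟨k, hk⟩ : ∃ k : ℕ → ℝ, k = fun s => c * ρ ^ (s / b) := ⟨_, rfl⟩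
  have hk0 : ∀ s, 0 ≤ k s := fun s => by rw [hk]; positivity
  have hkanti : Antitone k := fun s t hst => by
    rw [hk]
    exact mul_le_mul_of_nonneg_left
      (pow_le_pow_of_le_one hρ0 hρ1.le (Nat.div_le_div_right hst)) hc
  have hksum : ∀ N, ∑ n ∈ Finset.range N, k n ≤ X := fun N => by
    rw [hk, hX, ← Finset.mul_sum]
    exact mul_le_mul_of_nonneg_left (sum_block_geometric_le hb hρ0 hρ1 N) hc
  have hkG : ∀ n, k n ≤ c * G * r ^ n := fun n => by
    rw [hk, mul_assoc]
    exact mul_le_mul_of_nonneg_left (hG n) hc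
  have hkdev : ∀ n s (v : Fin I → Vec m),
      stackNorm (act (deviation (pushSumMatrix A φ) φ n s) v) ≤ k s * stackNorm v := by
    rw [hk]
    exact hdev
  have hx : ∀ n, disagreement φ x n ≤ k n * stackNorm (x 0)
      + ∑ t ∈ Finset.range n, k (n - 1 - t) * (α t * stackNorm (xt t - x t)) :=
    h.mixing.disagreement_le hkanti hkdev (p := fun n => α n • (xt n - x n)) (u := fun _ => 0)
      (fun n => by rw [h.x_succ, add_zero]) hk0 fun n => by
        rw [stackNorm_smul (h.step n).1.le]
        simp [stackNorm, l2]
  have hLy : 0 ≤ LMax L / lb := div_nonneg (LMax_nonneg L) h.lb_pos.le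
  have hy : ∀ n, disagreement φ y n ≤ k n * stackNorm (y 0)
      + ∑ t ∈ Finset.range n, k (n - 1 - t) * (LMax L / lb * (disagreement φ x (t + 1)
        + disagreement φ x t + √ub * (α t * stackNorm (xt t - x t)))) :=
    h.mixing.disagreement_le hkanti hkdev (p := fun _ => 0)
      (u := fun n i => (φ (n + 1) i)⁻¹ •
        (gradient (f i) (x (n + 1) i) - gradient (f i) (x n i)))
      (fun n => by simpa only [add_zero] using h.y_succ n) hk0 fun n => by
        refine le_trans (le_of_eq ?_) (h.stackNorm_tracking_input_le n)
        simp [stackNorm, l2]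
  have hL := LSum_nonneg L
  have hub := h.ub_pos.le
  have hsum := summable_of_small_gain (V := lyapunov f Gp Gm φ x) h.step
    (fun n => stackNorm_nonneg (v := xt n - x n))
    (disagreement_nonneg φ x) (disagreement_nonneg φ y) hk0 hksum stackNorm_nonneg
    stackNorm_nonneg hLy (Real.sqrt_nonneg ub) (by positivity) hub (by positivity) hx hy
    h.lyapunov_succ_le hlo hε hsmall
  exact tendsto_zero_of_summable h.step hdiv (fun n => stackNorm_nonneg (v := xt n - x n))
    (disagreement_nonneg φ x) (disagreement_nonneg φ y) hr0 hr1 (by positivity) hkG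
    stackNorm_nonneg stackNorm_nonneg hLy (Real.sqrt_nonneg ub) hC0 hx hy hC hsum

lemma norm_avg_sub_le (h : Run K O f Gp Gm L LG 𝒢 B A κ ft dft τ Lt α φ x xt y lb ub) (n : ℕ)
    (i : Fin I) : ‖avg (x n) - x n i‖ ≤ 2 * disagreement φ x n := by
  have e : avg (x n) - wavg (φ n) (x n)
      = (I : ℝ)⁻¹ • ∑ j, (x n j - wavg (φ n) (x n)) := by
    rw [Finset.sum_sub_distrib, smul_sub, avg]
    simp only [Finset.sum_const, Finset.card_univ, Fintype.card_fin]
    rw [← Nat.cast_smul_eq_nsmul ℝ, smul_smul, inv_mul_cancel₀ h.size_pos.ne', one_smul]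
  have h1 : ‖avg (x n) - wavg (φ n) (x n)‖ ≤ disagreement φ x n := by
    rw [e, norm_smul, norm_inv, Real.norm_of_nonneg h.size_pos.le, inv_mul_le_iff₀ h.size_pos]
    refine (norm_sum_le _ _).trans ((Finset.sum_le_sum fun j _ =>
      norm_sub_wavg_le_disagreement φ x n j).trans (le_of_eq ?_))
    simp
  have h2 := norm_sub_wavg_le_disagreement φ x n i
  rw [norm_sub_rev] at h2
  have h3 := norm_add_le (avg (x n) - wavg (φ n) (x n)) (wavg (φ n) (x n) - x n i)
  rw [sub_add_sub_cancel] at h3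
  linarith

/-- The stationarity measure is controlled by the errors: the variational inequalities of the
proximal point and of one local solution are added up. -/
lemma J_le (h : Run K O f Gp Gm L LG 𝒢 B A κ ft dft τ Lt α φ x xt y lb ub) (n : ℕ) (i : Fin I) :
    J K f Gp Gm (avg (x n)) ≤ (2 * (LSum L + LG) + 4) * disagreement φ x n
      + I * disagreement φ y n + (Lt i + L i + 2) * stackNorm (xt n - x n) := by
  obtain ⟨hz, hvi⟩ := h.problem.prox_variational (h.avg_mem n)
  rw [J]
  generalize proxPoint K f Gp Gm (avg (x n)) = z at hz hvi
  have h1 := hvi _ (h.xt_mem n i)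
  have h2 := h.local_variational n i hz
  have hd := h.norm_avg_sub_le n
  have h3 := h.norm_direction_error_le n i (h.avg_mem n) hd
  have h4 := h.norm_dft_sub_gradient_le n i
  have h5 : ‖xt n i - x n i‖ ≤ stackNorm (xt n - x n) := norm_le_stackNorm (xt n - x n) i
  have h6 := norm_sub_wavg_le_disagreement φ y n i
  have h7 := hd i
  obtain ⟨u, hu⟩ : ∃ u, u = xt n i - z := ⟨_, rfl⟩
  rw [← neg_sub (xt n i) z, inner_neg_right] at h2
  rw [← hu] at h1 h2
  obtain ⟨w, hw⟩ : ∃ w, w = (smoothGrad f Gm (avg (x n)) - ((I : ℝ) • y n i - gradient Gm (x n i)))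
      + (xt n i - avg (x n)) - (dft i (xt n i) (x n i) - gradient (f i) (x n i)) := ⟨_, rfl⟩
  have h8 : ⟪u, u⟫_ℝ ≤ ⟪w, u⟫_ℝ := by
    have e : w - u = (smoothGrad f Gm (avg (x n)) + (z - avg (x n)))
        - (dft i (xt n i) (x n i) - gradient Gm (x n i)
          + ((I : ℝ) • y n i - gradient (f i) (x n i))) := by
      rw [hw, hu]
      abel
    have h9 : 0 ≤ ⟪w - u, u⟫_ℝ := by
      rw [e, inner_sub_left]
      linarith
    rw [inner_sub_left] at h9
    linarith
  have h9 : ‖u‖ ≤ ‖w‖ := by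
    rw [real_inner_self_eq_norm_sq] at h8
    have h10 := h8.trans (real_inner_le_norm w u)
    rcases eq_or_lt_of_le (norm_nonneg u) with h0 | h0
    · rw [← h0]
      exact norm_nonneg w
    · refine le_of_mul_le_mul_right ?_ h0
      rwa [← pow_two]
  have h10 : ‖xt n i - avg (x n)‖ ≤ ‖xt n i - x n i‖ + ‖avg (x n) - x n i‖ := by
    rw [norm_sub_rev (avg (x n))]
    have := norm_add_le (xt n i - x n i) (x n i - avg (x n))
    rwa [sub_add_sub_cancel] at this
  have h11 : ‖w‖ ≤ (LSum L * (2 * disagreement φ x n) + LG * ‖x n i - avg (x n)‖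
      + I * ‖y n i - wavg (φ n) (y n)‖) + (‖xt n i - x n i‖ + ‖avg (x n) - x n i‖)
      + (Lt i + L i) * ‖xt n i - x n i‖ := by
    rw [hw]
    exact (norm_sub_le _ _).trans (add_le_add ((norm_add_le _ _).trans (add_le_add h3 h10)) h4)
  have h12 : ‖avg (x n) - z‖ ≤ ‖avg (x n) - x n i‖ + ‖xt n i - x n i‖ + ‖u‖ := by
    have e : avg (x n) - z = (avg (x n) - x n i) + (x n i - xt n i) + u := by
      rw [hu]
      abel
    rw [e, norm_sub_rev (xt n i)]
    exact norm_add₃_le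
  have h13 := mul_le_mul_of_nonneg_left h7 LG.2
  have h14 := mul_le_mul_of_nonneg_left h6 h.size_pos.le
  have h15 := mul_le_mul_of_nonneg_left h5
    (by positivity : (0 : ℝ) ≤ (Lt i : ℝ) + L i + 2)
  simp only [NNReal.val_eq_coe] at h13
  rw [norm_sub_rev (x n i)] at h11
  linarith

lemma D_le (h : Run K O f Gp Gm L LG 𝒢 B A κ ft dft τ Lt α φ x xt y lb ub) (n : ℕ) :
    D (x n) ≤ √I * (2 * disagreement φ x n) := by
  have h0 : 0 ≤ 2 * disagreement φ x n := mul_nonneg zero_le_two (disagreement_nonneg φ x n)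
  have h1 : stackNorm (fun i => x n i - avg (x n))
      ≤ 1 * stackNorm (fun _ : Fin I => 2 * disagreement φ x n) :=
    stackNorm_mono zero_le_one fun i => by
      rw [one_mul, Real.norm_of_nonneg h0, norm_sub_rev]
      exact h.norm_avg_sub_le n i
  rwa [stackNorm_const, one_mul, Real.norm_of_nonneg h0] at h1

lemma M_tendsto_zero (h : Run K O f Gp Gm L LG 𝒢 B A κ ft dft τ Lt α φ x xt y lb ub)
    (hlim : Tendsto (fun n => stackNorm (xt n - x n)) atTop (𝓝 0) ∧
      Tendsto (disagreement φ x) atTop (𝓝 0) ∧ Tendsto (disagreement φ y) atTop (𝓝 0)) :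
    Tendsto (fun n => M K f Gp Gm (x n)) atTop (𝓝 0) := by
  obtain ⟨h1, h2, h3⟩ := hlim
  have hJ : Tendsto (fun n => J K f Gp Gm (avg (x n))) atTop (𝓝 0) := by
    refine squeeze_zero (fun n => norm_nonneg _) (fun n => h.J_le n ⟨0, h.size⟩) ?_
    simpa using ((h2.const_mul (2 * (LSum L + LG) + 4)).add (h3.const_mul (I : ℝ))).add
      (h1.const_mul ((Lt ⟨0, h.size⟩ : ℝ) + L ⟨0, h.size⟩ + 2))
  have hD : Tendsto (fun n => D (x n)) atTop (𝓝 0) := by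
    refine squeeze_zero (fun n => Real.sqrt_nonneg _) h.D_le ?_
    simpa using (h2.const_mul (2 : ℝ)).const_mul √(I : ℝ)
  simpa [M] using (hJ.pow 2).max (hD.pow 2)

end Run

/-! ### Step-size rules -/

section StepSize

variable {m I : ℕ}

lemma le_LtMax (Lt : Fin I → ℝ≥0) (LG : ℝ≥0) : (LG : ℝ) ≤ LtMax Lt LG := by
  have : 0 ≤ ⨆ i, (Lt i : ℝ) := Real.iSup_nonneg fun i => (Lt i).2
  rw [LtMax]
  linarith

/-- The explicit bound on a constant step-size implies the smallness that the small-gain argument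
needs, strictly: the factors `√(2 / (1 - σ ^ 2))` and `12` leave room, unless all Lipschitz constants
vanish. -/
lemma StepBound.gain_lt {L Lt : Fin I → ℝ≥0} {LG : ℝ≥0} {τ : Fin I → ℝ} {c lb ub ρ σ a X : ℝ}
    {b : ℕ} (h : StepBound L Lt LG τ c b lb ub ρ σ a) (hI : 0 < I) (hτ : ∀ i, 0 < τ i)
    (ha : 0 < a) (hσ0 : 0 < σ) (hσ1 : σ < 1) (hlb : 0 < lb) (hub : 0 < ub)
    (hX0 : 0 ≤ X) (hX : X ≤ c * (b / (1 - ρ))) (hub' : √ub ≤ c * (b / (1 - ρ))) :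
    a * ((LSum L + LG) * ub / (2 * I)
      + ub * ((LSum L * √I + LG) / I * X + LMax L / lb * X * (2 * X + √ub)))
        < cTau τ * lb / I := by
  have hI0 : (0 : ℝ) < I := by exact_mod_cast hI
  have hcτ := cTau_pos hI hτ
  have hpos : 0 < cTau τ * lb / I := by positivity
  have hLS := LSum_nonneg L
  have hLM := LMax_nonneg L
  have hLt := le_LtMax Lt LG
  have hLG : (0 : ℝ) ≤ LG := LG.2
  obtain ⟨Y, hY⟩ : ∃ Y, Y = c * (b / (1 - ρ)) := ⟨_, rfl⟩
  rw [← hY] at hX hub'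
  have hub0 : 0 < √ub := Real.sqrt_pos.2 hub
  have hY0 : 0 < Y := hub0.trans_le hub'
  have hσ2 : 0 < 1 - σ ^ 2 := by nlinarith
  have hq1 : 1 < √(2 / (1 - σ ^ 2)) := by
    rw [Real.lt_sqrt zero_le_one, one_pow, lt_div_iff₀ hσ2]
    nlinarith [sq_nonneg σ]
  have hq2 : 1 ≤ √(1 / (1 - σ ^ 2)) := by
    rw [Real.one_le_sqrt, le_div_iff₀ hσ2]
    nlinarith [sq_nonneg σ]
  have hcL : cL L Lt LG * I = LSum L * √I + LMax L + LtMax Lt LG := by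
    rw [cL, div_mul_cancel₀ _ hI0.ne']
  have hcL0 : 0 ≤ cL L Lt LG := by
    rw [cL]
    have : 0 ≤ LtMax Lt LG := hLG.trans hLt
    positivity
  have hle : (LSum L * √I + LG) / I ≤ cL L Lt LG := by
    rw [div_le_iff₀ hI0, hcL]
    linarith
  have hstep := h.2
  have e1 : 2 * cL L Lt LG * b * c / (1 - ρ) = 2 * cL L Lt LG * Y := by
    rw [hY]
    ring
  have e2 : 12 * LMax L * lb⁻¹ * b ^ 2 * c ^ 2 / (1 - ρ) ^ 2 = 12 * (LMax L / lb) * Y ^ 2 := by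
    rw [hY, mul_pow, div_pow, div_eq_mul_inv (LMax L)]
    ring
  rw [e1, e2, le_div_iff₀ (by positivity)] at hstep
  have hmid : a * ((LSum L + LG) * ub / (2 * I) + ub * (cL L Lt LG * Y * √(2 / (1 - σ ^ 2))
      + 6 * (LMax L / lb) * Y ^ 2 * √(1 / (1 - σ ^ 2)))) ≤ cTau τ * lb / I := by
    rw [le_div_iff₀ hI0]
    have e3 : a * ((LSum L + LG) * ub / (2 * I) + ub * (cL L Lt LG * Y * √(2 / (1 - σ ^ 2))
      + 6 * (LMax L / lb) * Y ^ 2 * √(1 / (1 - σ ^ 2)))) * I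
      = a * ((LSum L + LG) / I + 2 * cL L Lt LG * Y * √(2 / (1 - σ ^ 2))
        + 12 * (LMax L / lb) * Y ^ 2 * √(1 / (1 - σ ^ 2))) * (I * ub) / 2 := by
      field_simp
      ring
    rw [e3]
    linarith
  obtain ⟨Ly, hLy⟩ : ∃ Ly, Ly = LMax L / lb := ⟨_, rfl⟩
  have hLy0 : 0 ≤ Ly := by rw [hLy]; positivity
  rw [← hLy] at hmid ⊢
  have hx1 : (LSum L * √I + LG) / I * X ≤ cL L Lt LG * Y := by
    refine mul_le_mul hle hX hX0 hcL0
  have hx2 : Ly * X * (2 * X + √ub) ≤ 6 * Ly * Y ^ 2 * √(1 / (1 - σ ^ 2)) := by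
    have h1 : X * (2 * X + √ub) ≤ Y * (3 * Y) :=
      mul_le_mul hX (by linarith) (by positivity) hY0.le
    have h2 := mul_le_mul_of_nonneg_left h1 hLy0
    have h3 : 0 ≤ Ly * Y ^ 2 := by positivity
    nlinarith
  rcases eq_or_lt_of_le hcL0 with h0 | h0
  · -- all Lipschitz constants vanish
    rw [← h0, zero_mul] at hcL
    have hs : 0 ≤ LSum L * √I := by positivity
    have hLS0 : LSum L * √I = 0 := by linarith
    have hLG0 : (LG : ℝ) = 0 := by linarith
    have hLM0 : LMax L = 0 := by linarith
    have hLS1 : LSum L = 0 := by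
      rcases mul_eq_zero.1 hLS0 with h1 | h1
      · exact h1
      · exact absurd h1 (Real.sqrt_pos.2 hI0).ne'
    rw [hLy, hLS1, hLG0, hLM0]
    simpa using hpos
  · have h1 : cL L Lt LG * Y < cL L Lt LG * Y * √(2 / (1 - σ ^ 2)) :=
      lt_mul_of_one_lt_right (by positivity) hq1
    refine lt_of_lt_of_le (mul_lt_mul_of_pos_left ?_ ha) hmid
    have h2 : (LSum L * √I + LG) / I * X + Ly * X * (2 * X + √ub)
        < cL L Lt LG * Y * √(2 / (1 - σ ^ 2)) + 6 * Ly * Y ^ 2 * √(1 / (1 - σ ^ 2)) := by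
      linarith
    have h3 := mul_lt_mul_of_pos_left h2 hub
    linarith

lemma StepBound.le_one {L Lt : Fin I → ℝ≥0} {LG : ℝ≥0} {τ : Fin I → ℝ} {c lb ub ρ σ a : ℝ}
    {b : ℕ} (h : StepBound L Lt LG τ c b lb ub ρ σ a) (hc : 1 ≤ c) (hb : 0 < b) (hρ0 : 0 ≤ ρ)
    (hσ0 : 0 < σ) (hσ1 : σ < 1) : a ≤ 1 := by
  refine h.1.trans ?_
  have h2 : (1 : ℝ) ≤ √2 := Real.one_le_sqrt.2 one_le_two
  have hb1 : (1 : ℝ) ≤ b := by exact_mod_cast hb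
  have h3 : 1 ≤ √2 * c * b := one_le_mul_of_one_le_of_one_le
    (one_le_mul_of_one_le_of_one_le h2 hc) hb1
  rw [div_le_one (by linarith)]
  nlinarith

lemma StepBound.window_pos {L Lt : Fin I → ℝ≥0} {LG : ℝ≥0} {τ : Fin I → ℝ} {c lb ub ρ σ a : ℝ}
    {b : ℕ} (h : StepBound L Lt LG τ c b lb ub ρ σ a) (ha : 0 < a) : 0 < b := by
  rcases Nat.eq_zero_or_pos b with rfl | hb
  · have h1 := h.1
    simp at h1
    exact absurd ha (not_lt.2 h1)
  · exact hb

variable {K O : Set (Vec m)} {f : Fin I → Vec m → ℝ} {Gp Gm : Vec m → ℝ}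
  {L : Fin I → ℝ≥0} {LG : ℝ≥0} {𝒢 : ℕ → Digraph (Fin I)} {B : ℕ}
  {A : ℕ → Matrix (Fin I) (Fin I) ℝ} {κ : ℝ} {ft : Fin I → Vec m → Vec m → ℝ}
  {dft : Fin I → Vec m → Vec m → Vec m} {τ : Fin I → ℝ} {Lt : Fin I → ℝ≥0}
  {α : ℕ → ℝ} {φ : ℕ → Fin I → ℝ} {x xt y : ℕ → Fin I → Vec m} {lb ub : ℝ}

lemma not_summable_of_constant {a : ℝ} (ha : 0 < a) (hα : ∀ n, α n = a) : ¬ Summable α := by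
  intro hs
  have h1 := hs.tendsto_atTop_zero
  have h2 : α = fun _ => a := funext hα
  rw [h2] at h1
  exact ha.ne' (tendsto_nhds_unique tendsto_const_nhds h1)

lemma tendsto_of_diminishing (hI : 0 < I) (hP : ProblemAssumptions K O f Gp Gm L LG)
    (hN : PushSum 𝒢 B A κ φ) (hS : SurrogateAssumptions K f ft dft τ Lt) (hα : Diminishing α)
    (hrun : IsRun K f Gp Gm ft A α φ x xt y) :
    Tendsto (fun n => M K f Gp Gm (x n)) atTop (𝓝 0) := by
  have h : Run K O f Gp Gm L LG 𝒢 B A κ ft dft τ Lt α φ x xt y (phiLb I B κ) I :=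
    ⟨hI, hP, hN, hS, hrun, hα.1, hN.phiLb_pos, hN.phiLb_le, hN.phi_le⟩
  have hB := hN.connected.1
  -- the window `I * B` instead of `(I - 1) * B` is positive for a single agent, too
  have hT : 0 < I * B := Nat.mul_pos hI hB
  have hT' : (I - 1) * B ≤ I * B := Nat.mul_le_mul_right _ (Nat.sub_le _ _)
  have hκ := hN.kappaTilde_pos ⟨0, hI⟩
  have hκ1 := hN.kappaTilde_le_one ⟨0, hI⟩
  have hη1 : kappaTilde I B κ ^ (I * B) ≤ 1 := pow_le_one₀ hκ.le hκ1
  have hη0 : 0 < kappaTilde I B κ ^ (I * B) := pow_pos hκ _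
  have hdiv : ¬ Summable α :=
    (not_summable_iff_tendsto_nat_atTop_of_nonneg fun n => (hα.1 n).1.le).2 hα.2.2
  have hcτ := cTau_pos hI hS.tau_pos
  have hε : 0 < cTau τ * phiLb I B κ / I / 2 := by
    have := h.lb_pos
    have := h.size_pos
    positivity
  refine h.M_tendsto_zero (h.errors_tendsto_zero hT (by linarith) (by linarith) (Nat.cast_nonneg I)
    (hN.stackNorm_deviation_le ⟨0, hI⟩ hT' hT) hdiv hε rfl ?_)
  have h1 := hα.2.1.mul_const ((LSum L + LG) * I / (2 * I) + I * ((LSum L * √I + LG) / I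
    * (I * ((I * B : ℕ) / (1 - (1 - kappaTilde I B κ ^ (I * B)))))
    + LMax L / phiLb I B κ * (I * ((I * B : ℕ) / (1 - (1 - kappaTilde I B κ ^ (I * B)))))
    * (2 * (I * ((I * B : ℕ) / (1 - (1 - kappaTilde I B κ ^ (I * B))))) + √I)))
  rw [zero_mul] at h1
  have h2 : 0 < cTau τ * phiLb I B κ / I - cTau τ * phiLb I B κ / I / 2 := by linarith
  exact (h1.eventually_lt_const h2).mono fun n hn => hn.le

lemma tendsto_of_constant_general (hI : 2 ≤ I) (hP : ProblemAssumptions K O f Gp Gm L LG)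
    (hN : PushSum 𝒢 B A κ φ) (hS : SurrogateAssumptions K f ft dft τ Lt) {a σ : ℝ} (ha : 0 < a)
    (hα : ∀ n, α n = a) (hσ0 : 0 < σ) (hσ1 : σ < 1) {Bbar : ℕ} (hρ : rhoBar I B κ Bbar < 1)
    (hstep : StepBound L Lt LG τ (I * √(2 * I)) Bbar (phiLb I B κ) (phiUb I B κ)
      (rhoBar I B κ Bbar) σ a) (hrun : IsRun K f Gp Gm ft A α φ x xt y) :
    Tendsto (fun n => M K f Gp Gm (x n)) atTop (𝓝 0) := by
  have hI0 : 0 < I := by omega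
  have hI1 : (1 : ℝ) ≤ I := by exact_mod_cast hI0
  have hb := hstep.window_pos ha
  have hκ := hN.kappaTilde_pos ⟨0, hI0⟩
  have hκ1 := hN.kappaTilde_le_one ⟨0, hI0⟩
  have hrho0 : 0 ≤ rho I B κ := sub_nonneg.2 (pow_le_one₀ hκ.le hκ1)
  have hrho1 : rho I B κ ≤ 1 := by
    have := pow_nonneg hκ.le ((I - 1) * B)
    rw [rho]
    linarith
  have hc0 : 2 ≤ c0 I B κ := by
    have : 0 ≤ (kappaTilde I B κ ^ ((I - 1) * B))⁻¹ := by positivity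
    rw [c0]
    linarith
  have hρ0 : 0 ≤ rhoBar I B κ Bbar := by
    rw [rhoBar]
    positivity
  have hs2 : 1 ≤ √(2 * (I : ℝ)) := Real.one_le_sqrt.2 (by linarith)
  have hc1 : 1 ≤ I * √(2 * (I : ℝ)) := one_le_mul_of_one_le_of_one_le hI1 hs2
  have hstep1 : ∀ n, 0 < α n ∧ α n ≤ 1 := fun n => by
    rw [hα]
    exact ⟨ha, hstep.le_one hc1 hb hρ0 hσ0 hσ1⟩
  have h : Run K O f Gp Gm L LG 𝒢 B A κ ft dft τ Lt α φ x xt y (phiLb I B κ) (phiUb I B κ) :=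
    ⟨hI0, hP, hN, hS, hrun, hstep1, hN.phiLb_pos, hN.phiLb_le, hN.phi_le_phiUb hI⟩
  have hT0 : 0 < (I - 1) * B := Nat.mul_pos (by omega) hN.connected.1
  have hdev0 := fun n s v =>
    hN.stackNorm_deviation_le (E := Vec m) ⟨0, hI0⟩ le_rfl hT0 n s v
  have hdev := hN.mixing.geometric_decay (E := Vec m) (c := I) hb hρ0
    (fun n s v => (hdev0 n s v).trans (mul_le_mul_of_nonneg_right
      (mul_le_of_le_one_right (by linarith) (pow_le_one₀ hrho0 hrho1)) stackNorm_nonneg))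
    (fun n v => (hdev0 n Bbar v).trans (mul_le_mul_of_nonneg_right (by
      have h1 : 0 ≤ rho I B κ ^ (Bbar / ((I - 1) * B)) := pow_nonneg hrho0 _
      have h2 : (I : ℝ) ≤ 2 * c0 I B κ * I := by nlinarith
      exact mul_le_mul_of_nonneg_right h2 h1) stackNorm_nonneg)) (Nat.cast_nonneg I)
  have hq : 1 ≤ Bbar / (1 - rhoBar I B κ Bbar) := by
    rw [one_le_div (by linarith)]
    have : (1 : ℝ) ≤ Bbar := by exact_mod_cast hb
    linarith
  have hX : I * (Bbar / (1 - rhoBar I B κ Bbar))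
      ≤ I * √(2 * (I : ℝ)) * (Bbar / (1 - rhoBar I B κ Bbar)) :=
    mul_le_mul_of_nonneg_right (le_mul_of_one_le_right (by linarith) hs2) (by linarith)
  have hub : √(phiUb I B κ) ≤ I * √(2 * (I : ℝ)) * (Bbar / (1 - rhoBar I B κ Bbar)) := by
    refine le_trans ?_ hX
    have h1 : √(phiUb I B κ) ≤ √((I : ℝ) ^ 2) := by
      refine Real.sqrt_le_sqrt ?_
      have h2 : phiUb I B κ ≤ I := sub_le_self _ (pow_nonneg hN.compliant.pos.le _)
      nlinarith
    rw [Real.sqrt_sq (by linarith)] at h1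
    nlinarith
  have hgain := hstep.gain_lt hI0 hS.tau_pos ha hσ0 hσ1 h.lb_pos h.ub_pos
    (X := I * (Bbar / (1 - rhoBar I B κ Bbar))) (mul_nonneg (by linarith) (by linarith)) hX hub
  refine h.M_tendsto_zero (h.errors_tendsto_zero hb hρ0 hρ (Nat.cast_nonneg I) hdev
    (not_summable_of_constant ha hα) (sub_pos.2 hgain) rfl ?_)
  refine Eventually.of_forall fun n => ?_
  rw [hα, sub_sub_cancel]

lemma tendsto_of_constant_doublyStochastic (hI : 0 < I)
    (hP : ProblemAssumptions K O f Gp Gm L LG)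
    (hN : PushSum 𝒢 B A κ φ) (hS : SurrogateAssumptions K f ft dft τ Lt) {a σ : ℝ} (ha : 0 < a)
    (hα : ∀ n, α n = a) (hσ0 : 0 < σ) (hσ1 : σ < 1) (hrow : RowStochastic A)
    (hstep : StepBound L Lt LG τ 1 B 1 1 (√(1 - κ / (2 * (I : ℝ) ^ 2))) σ a)
    (hrun : IsRun K f Gp Gm ft A α φ x xt y) :
    Tendsto (fun n => M K f Gp Gm (x n)) atTop (𝓝 0) := by
  have hI1 : (1 : ℝ) ≤ I := by exact_mod_cast hI
  have hb := hN.connected.1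
  obtain ⟨ρ, hρ⟩ : ∃ ρ, ρ = √(1 - κ / (2 * (I : ℝ) ^ 2)) := ⟨_, rfl⟩
  have hκ := hN.compliant.pos
  have hρ0 : 0 ≤ ρ := by rw [hρ]; exact Real.sqrt_nonneg _
  have hρ1 : ρ < 1 := by
    rw [hρ, Real.sqrt_lt' one_pos, one_pow]
    have : 0 < κ / (2 * (I : ℝ) ^ 2) := by positivity
    linarith
  rw [← hρ] at hstep
  have hstep1 : ∀ n, 0 < α n ∧ α n ≤ 1 := fun n => by
    rw [hα]
    exact ⟨ha, hstep.le_one le_rfl hb hρ0 hσ0 hσ1⟩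
  have hφ := hN.phi_eq_one hrow
  have h : Run K O f Gp Gm L LG 𝒢 B A κ ft dft τ Lt α φ x xt y 1 1 :=
    ⟨hI, hP, hN, hS, hrun, hstep1, one_pos, fun n i => (hφ n i).ge, fun n i => (hφ n i).le⟩
  have hdev := hN.mixing.geometric_decay (E := Vec m) (c := 1) (ρ := ρ) (b := B) hb hρ0
    (fun n s v => by
      rw [hN.pushSumMatrix_eq hrow]
      exact hN.stackNorm_deviation_le_self hrow n s v)
    (fun n v => by
      rw [hN.pushSumMatrix_eq hrow, hρ]
      exact hN.stackNorm_deviation_le_sqrt hrow n v) zero_le_one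
  have hq : 1 ≤ B / (1 - ρ) := by
    rw [one_le_div (by linarith)]
    have : (1 : ℝ) ≤ B := by exact_mod_cast hb
    linarith
  have hgain := hstep.gain_lt hI hS.tau_pos ha hσ0 hσ1 one_pos one_pos
    (X := 1 * (B / (1 - ρ))) (by linarith) le_rfl (by rw [Real.sqrt_one]; linarith)
  refine h.M_tendsto_zero (h.errors_tendsto_zero hb hρ0 hρ1 zero_le_one hdev
    (not_summable_of_constant ha hα) (sub_pos.2 hgain) rfl ?_)
  refine Eventually.of_forall fun n => ?_
  rw [hα, sub_sub_cancel]

end StepSize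

end Sonata

theorem theorem1 {m I : ℕ} (hI : 0 < I)
    (K O : Set (Sonata.Vec m)) (f : Fin I → Sonata.Vec m → ℝ) (Gp Gm : Sonata.Vec m → ℝ)
    (L : Fin I → ℝ≥0) (LG : ℝ≥0)
    (hP : Sonata.ProblemAssumptions K O f Gp Gm L LG)
    (𝒢 : ℕ → Digraph (Fin I)) (B : ℕ) (hG : Sonata.BStronglyConnected 𝒢 B)
    (A : ℕ → Matrix (Fin I) (Fin I) ℝ) (κ : ℝ) (hA : Sonata.Compliant 𝒢 A κ)
    (hcol : Sonata.ColumnStochastic A)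
    (ft : Fin I → Sonata.Vec m → Sonata.Vec m → ℝ)
    (dft : Fin I → Sonata.Vec m → Sonata.Vec m → Sonata.Vec m)
    (τ : Fin I → ℝ) (Lt : Fin I → ℝ≥0)
    (hS : Sonata.SurrogateAssumptions K f ft dft τ Lt)
    (α : ℕ → ℝ)
    (hα : Sonata.Diminishing α ∨ Sonata.ConstantSmall A B κ L Lt LG τ α)
    (φ : ℕ → Fin I → ℝ) (x xt y : ℕ → Fin I → Sonata.Vec m)
    (hrun : Sonata.IsRun K f Gp Gm ft A α φ x xt y) :
    (∀ v ∈ K, ∃! z, Sonata.IsArgmin K (Sonata.proxModel f Gp Gm v) z) ∧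
      Tendsto (fun n => Sonata.M K f Gp Gm (x n)) atTop (𝓝 0) := by
  refine ⟨fun v hv => hP.existsUnique_proxModel hv, ?_⟩
  have hN : Sonata.PushSum 𝒢 B A κ φ := ⟨hG, hA, hcol, hrun.phi_init, hrun.phi_step⟩
  rcases hα with hα | ⟨a, ha, haα, σ, hσ0, hσ1, ⟨hI2, Bbar, hρ, hstep⟩ | ⟨hrow, hstep⟩⟩
  · exact Sonata.tendsto_of_diminishing hI hP hN hS hα hrun
  · exact Sonata.tendsto_of_constant_general hI2 hP hN hS ha haα hσ0 hσ1 hρ hstep hrun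
  · exact Sonata.tendsto_of_constant_doublyStochastic hI hP hN hS ha haα hσ0 hσ1 hrow hstep hrun
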